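/- Let $d\ge 1$ be an integer, $\alpha_R\in(0,1)$ and $\alpha_B=1-\alpha_R$. For $n\ge 1$ let $n_R+n_B=n$ with $n_R/n\to\alpha_R$ and $n_B/n\to\alpha_B$ as $n\to\infty$, and let $R^n=(X_i)_{i=1}^{n_R}$, $B^n=(Y_j)_{j=1}^{n_B}$ be (jointly) i.i.d. random variables, uniformly distributed on $[0,1]^d$. For $p>0$ let $\mathcal C^p_{MST}(R^n,B^n)$ be the cost of a minimum spanning tree of the complete bipartite graph with independent sets $R^n$, $B^n$ and edge weights $|X_i-Y_j|^p$ (the infimum of the total weight over connected spanning subgraphs), and let $\mathcal C^p_{MST}(R^n,B^n\,|\,\mathbb T^d)$ be the same cost with $|X_i-Y_j|$ replaced by the flat distance $\min_{z\in\mathbb Z^d}|X_i-Y_j+z|$ on the torus $\mathbb T^d=\mathbb R^d/\mathbb Z^d$. For every $p>0$ there is a constant $C=C(p,d)>0$ (not depending on $\alpha_R$, $n_R$, $n_B$) such that, for all $n$ large enough, both expected costs are finite and $$\mathbb E\big[\mathcal C^p_{MST}(R^n,B^n)\big]-\mathbb E\big[\mathcal C^p_{MST}(R^n,B^n\,|\,\mathbb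 T^d)\big]\le C\,n^{1-(p+1)/d}(\log n)^{(p+1)/d}.$$ In particular, for every $0<p<d$, $$\lim_{n\to\infty}\frac{\mathbb E[\mathcal C^p_{MST}(R^n,B^n)]}{n^{1-p/d}}=\lim_{n\to\infty}\frac{\mathbb E[\mathcal C^p_{MST}(R^n,B^n\,|\,\mathbb T^d)]}{n^{1-p/d}}=\beta_{bMST}(p,d),$$ where $\beta_{bMST}(p,d)\in(0,\infty)$ depends only on $p$, $d$, $\alpha_R$ and is given by $$\beta_{bMST}(p,d)=\frac pd\,\Gamma\!\Big(\frac pd\Big)\omega_d^{-p/d}\Big(\alpha_R\alpha_B^{-p/d}+\alpha_B\alpha_R^{-p/d}\Big)+\frac pd\sum_{k_R,k_B=1}^\infty\frac{\alpha_R^{k_R}}{k_R!}\frac{\alpha_B^{k_B}}{k_B!}\,\frac{\Gamma(k_R+k_B-1+p/d)}{k_R+k_B}\,E(k_R,k_B),$$ $$E(k_R,k_B)=\int_{\Theta(k_R,k_B)}\Big(\alpha_R\,|D(\{b_j\}_j)|+\alpha_B\,|D(\{r_i\}_i)|\Big)^{-(k_R+k_B-1+p/d)}\big(k_R\,\delta_0(r_1)\,db_1+k_B\,dr_1\,\delta_0(b_1)\big)\,dr_2\cdots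 dr_{k_R}\,db_2\cdots db_{k_B}.$$ Here $\omega_d$ is the volume of the unit ball of $\mathbb R^d$, $\Theta(k_R,k_B)\subseteq(\mathbb R^d)^{k_R}\times(\mathbb R^d)^{k_B}$ is the set of $((r_i)_i,(b_j)_j)$ for which the bipartite graph of the pairs $\{r_i,b_j\}$ with $|r_i-b_j|<1$ is connected, and $|D(A)|$ is the Lebesgue measure of $D(A)=\{x\in\mathbb R^d:\operatorname{dist}(A,x)\le1\}$. -/

import Mathlib

open MeasureTheory ProbabilityTheory Filter Topology
open scoped ENNReal NNReal

noncomputable section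

/-- The cost of a minimum spanning tree of the weighted graph `(V, G, w)`: the infimum of the total
weight over all connected spanning subgraphs (`⊤` if there is none). -/
def mstCost {V : Type*} (G : SimpleGraph V) (w : Sym2 V → ℝ≥0∞) : ℝ≥0∞ :=
  ⨅ (T : SimpleGraph V) (_ : T ≤ G ∧ T.Connected), ∑' e : T.edgeSet, w e

/-- The weight `dist(z u, z v) ^ p` of the edge `{u, v}`, for points `z` in a metric space. -/
def distWeight {V M : Type*} [PseudoMetricSpace M] (p : ℝ) (z : V → M) : Sym2 V → ℝ≥0∞ :=
  Sym2.lift ⟨fun u v => ENNReal.ofReal (dist (z u) (z v) ^ p), fun u v => by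
    simp only [dist_comm]⟩

/-- The bipartite MST cost, with exponent `p`, of red points `x` and blue points `y`. -/
def bipartiteMSTCost {M : Type*} [PseudoMetricSpace M] {a b : ℕ} (p : ℝ)
    (x : Fin a → M) (y : Fin b → M) : ℝ≥0∞ :=
  mstCost (completeBipartiteGraph (Fin a) (Fin b)) (distWeight p (Sum.elim x y))

/-- The lattice of points of `ℝ^d` with integer coordinates. -/
def intLattice (d : ℕ) : AddSubgroup (EuclideanSpace ℝ (Fin d)) where
  carrier := {x | ∀ i, ∃ m : ℤ, x i = m}
  zero_mem' := fun _ => ⟨0, by simp⟩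
  add_mem' := fun {x y} hx hy i => by
    obtain ⟨m, hm⟩ := hx i
    obtain ⟨k, hk⟩ := hy i
    exact ⟨m + k, by simp [hm, hk]⟩
  neg_mem' := fun {x} hx i => by
    obtain ⟨m, hm⟩ := hx i
    exact ⟨-m, by simp [hm]⟩

/-- The torus `ℝ^d / ℤ^d`; as a quotient of a normed group it carries the flat distance
(see `FlatTorus.dist_mk`). -/
abbrev FlatTorus (d : ℕ) : Type := EuclideanSpace ℝ (Fin d) ⧸ intLattice d

/-- The projection of `ℝ^d` onto the torus. -/
def FlatTorus.mk {d : ℕ} (x : EuclideanSpace ℝ (Fin d)) : FlatTorus d := QuotientAddGroup.mk x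

theorem FlatTorus.dist_mk {d : ℕ} (x y : EuclideanSpace ℝ (Fin d)) :
    dist (FlatTorus.mk x) (FlatTorus.mk y) =
      ⨅ z : Fin d → ℤ, ‖x - y + WithLp.toLp 2 (fun i => (z i : ℝ))‖ := by
  have h1 : dist (FlatTorus.mk x) (FlatTorus.mk y) =
      Metric.infDist (x - y) (intLattice d : Set (EuclideanSpace ℝ (Fin d))) := by
    rw [dist_eq_norm]
    exact QuotientAddGroup.norm_mk (S := intLattice d) (x - y)
  rw [h1, Metric.infDist_eq_iInf]
  let e : (Fin d → ℤ) → (intLattice d : Set (EuclideanSpace ℝ (Fin d))) := fun z =>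
    ⟨WithLp.toLp 2 (fun i => ((-z i : ℤ) : ℝ)), fun i => ⟨-z i, rfl⟩⟩
  have he : Function.Surjective e := by
    rintro ⟨v, hv⟩
    have hv2 : ∀ i, ∃ m : ℤ, v i = m := hv
    choose m hm using hv2
    refine ⟨fun i => -m i, Subtype.ext ?_⟩
    ext i
    simp [e, hm]
  rw [← he.iInf_comp]
  congr 1
  funext z
  rw [dist_eq_norm]
  congr 1
  ext i
  simp [e]

/-- The cube `[0,1]^d`. -/
def unitCube (d : ℕ) : Set (EuclideanSpace ℝ (Fin d)) := {x | ∀ i, x i ∈ Set.Icc (0 : ℝ) 1}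

/-- The random points `X 0, …, X (a-1), Y 0, …, Y (b-1)` are jointly independent and uniformly
distributed on the cube `[0,1]^d`. -/
structure IsUniformSample {d a b : ℕ} {Ω : Type*} [MeasurableSpace Ω] (P : Measure Ω)
    (X : Fin a → Ω → EuclideanSpace ℝ (Fin d)) (Y : Fin b → Ω → EuclideanSpace ℝ (Fin d)) :
    Prop where
  measurable_red : ∀ i, Measurable (X i)
  measurable_blue : ∀ j, Measurable (Y j)
  uniform_red : ∀ i, pdf.IsUniform (X i) (unitCube d) P volume
  uniform_blue : ∀ j, pdf.IsUniform (Y j) (unitCube d) P volume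
  indep : iIndepFun (Sum.elim X Y) P

/-- The expected bipartite MST cost in the Euclidean metric. -/
def expectedCubeCost {d a b : ℕ} {Ω : Type*} [MeasurableSpace Ω] (P : Measure Ω) (p : ℝ)
    (X : Fin a → Ω → EuclideanSpace ℝ (Fin d)) (Y : Fin b → Ω → EuclideanSpace ℝ (Fin d)) :
    ℝ≥0∞ :=
  ∫⁻ ω, bipartiteMSTCost p (fun i => X i ω) (fun j => Y j ω) ∂P

/-- The expected bipartite MST cost of the projections of the points to the flat torus. -/
def expectedTorusCost {d a b : ℕ} {Ω : Type*} [MeasurableSpace Ω] (P : Measure Ω) (p : ℝ)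
    (X : Fin a → Ω → EuclideanSpace ℝ (Fin d)) (Y : Fin b → Ω → EuclideanSpace ℝ (Fin d)) :
    ℝ≥0∞ :=
  ∫⁻ ω, bipartiteMSTCost p (fun i => FlatTorus.mk (X i ω)) (fun j => FlatTorus.mk (Y j ω)) ∂P

/-- The bipartite graph on the points `r`, `b` whose edges are the red-blue pairs at distance
less than `1`. -/
def closeGraph {d k l : ℕ} (r : Fin k → EuclideanSpace ℝ (Fin d))
    (b : Fin l → EuclideanSpace ℝ (Fin d)) : SimpleGraph (Fin k ⊕ Fin l) where
  Adj u v := (completeBipartiteGraph (Fin k) (Fin l)).Adj u v ∧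
    dist (Sum.elim r b u) (Sum.elim r b v) < 1
  symm := ⟨fun _ _ h => ⟨h.1.symm, by rw [dist_comm]; exact h.2⟩⟩
  loopless := ⟨fun _ h => (completeBipartiteGraph (Fin k) (Fin l)).irrefl h.1⟩

/-- The set `Θ(k, l)` of configurations of `k` red and `l` blue points of `ℝ^d` for which
`closeGraph` is connected. -/
def connectedConfigs (d k l : ℕ) :
    Set ((Fin k → EuclideanSpace ℝ (Fin d)) × (Fin l → EuclideanSpace ℝ (Fin d))) :=
  {c | (closeGraph c.1 c.2).Connected}

/-- The function `1_Θ(r, b) * (α |D(b)| + (1 - α) |D(r)|) ^ (-s)`, where `|D(A)|` is the Lebesgue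
measure of the set of points at distance at most `1` from `A`. -/
def configDensity {d k l : ℕ} (α s : ℝ) (r : Fin k → EuclideanSpace ℝ (Fin d))
    (b : Fin l → EuclideanSpace ℝ (Fin d)) : ℝ≥0∞ :=
  (connectedConfigs d k l).indicator
    (fun c => (ENNReal.ofReal α * volume (Metric.cthickening 1 (Set.range c.2)) +
      ENNReal.ofReal (1 - α) * volume (Metric.cthickening 1 (Set.range c.1))) ^ (-s)) (r, b)

/-- The integral of `configDensity` over configurations of `k + 1` red and `l + 1` blue points,
against `(k + 1) δ₀(r₁) db₁ + (l + 1) dr₁ δ₀(b₁)` in the first red and blue points, and Lebesgue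
measure in all other points. -/
def configIntegral (d k l : ℕ) (α s : ℝ) : ℝ≥0∞ :=
  ((k + 1 : ℕ) : ℝ≥0∞) * (∫⁻ (r : Fin k → EuclideanSpace ℝ (Fin d))
      (b : Fin (l + 1) → EuclideanSpace ℝ (Fin d)),
        configDensity (k := k + 1) α s (Fin.cons 0 r) b) +
  ((l + 1 : ℕ) : ℝ≥0∞) * (∫⁻ (r : Fin (k + 1) → EuclideanSpace ℝ (Fin d))
      (b : Fin l → EuclideanSpace ℝ (Fin d)),
        configDensity (l := l + 1) α s r (Fin.cons 0 b))

/-- The coefficient, in the series for the limit constant, of the integral over configurations of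
`k` red and `l` blue points, for `k, l ≥ 1`. -/
def betaCoeff (d k l : ℕ) (p α : ℝ) : ℝ :=
  p / d * (α ^ k / k.factorial) * ((1 - α) ^ l / l.factorial) *
    (Real.Gamma (k + l - 1 + p / d) / (k + l))

/-- The limit constant `β_bMST(d, p)` at red fraction `α`: the contribution of the isolated points
plus a series over the numbers `k, l ≥ 1` of red and blue points (written as `k + 1`, `l + 1`). -/
def betaBMST (d : ℕ) (p α : ℝ) : ℝ≥0∞ :=
  ENNReal.ofReal (p / d * Real.Gamma (p / d) *
      (α * (1 - α) ^ (-(p / d)) + (1 - α) * α ^ (-(p / d)))) *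
    volume (Metric.closedBall (0 : EuclideanSpace ℝ (Fin d)) 1) ^ (-(p / d)) +
  ∑' k : ℕ, ∑' l : ℕ, ENNReal.ofReal (betaCoeff d (k + 1) (l + 1) p α) *
    configIntegral d k l α ((k + 1 : ℝ) + (l + 1) - 1 + p / d)

end

/-!
The cost of a minimum spanning tree is an integral over distance thresholds. By Kruskal's algorithm
one spanning tree minimizes, for all `u` at once, the number of edges of length at least `u`, and
that minimum is the number of components, minus one, of the graph of the edges shorter than `u`
(`SimpleGraph.exists_kruskal_forest`, `mstCost_eq_lintegral`). Hence both expected costs equal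
`∫ p u ^ (p - 1) K(u) du`, where `K(u)` is the expected number of components, minus one, of the
level graph at distance `u`, in the cube (`cubeExcess`) or in the torus (`torusExcess`).

*Difference of the costs.* The level graph of the cube is contained in that of the torus, and the
additional edges have their end points at distance at most `u` from the boundary of the cube. So the
two component counts differ at most by the number of components that touch this boundary strip. Let
`ε = (log n / n) ^ (1 / d)`. For `u ≤ ε` this number is bounded by the number of points in the
strip, about `2 d n u`, which contributes a multiple of `n ε ^ (p + 1)`. For `u` between `ε` and
`K ε` it is bounded, up to a constant, by the number `u ^ (1 - d)` of grid cells of side comparable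
to `u` that meet the strip, because a cell with points of both colours lies in a single component;
this gains a factor `log n`, which absorbs all constants depending on the proportion of the colours.
For `u > K ε` all cells contain points of both colours up to a probability `n ^ (-A)` with `A`
large, and then the level graph is connected (`eventually_cube_le_torus_add`).

*Limit.* On the scale `u = s n ^ (-1 / d)` the number of components is expanded according to their
numbers `k` of red and `l` of blue points. The expected number of components of type `(k, l)`,
divided by `n`, converges to an integral over the connected configurations with one point at the
origin, weighted by the probability `exp (-s ^ d (α |D(b)| + (1 - α) |D(r)|))` that a pair of
Poisson processes has no further points attached to the configuration (`tendsto_compProb_div`,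
`tendsto_compFreq`). Since a component of type `(k, l)` uses up `k + l` of the `n` points, the tails
of these series are uniformly small, so the sums converge too (`tendsto_tsum_of_weight`,
`tendsto_cubeExcess_div`). The bound of `K(u)` by a multiple of `u ^ (-d)`
(`cubeExcess_le_inv_pow`) provides an integrable domination in `s` if `p < d`
(`tendsto_cube_integral`). Finally the integral over `s` is a Gamma integral, which turns the
exponential into the power in the limit constant. The component types `(1, 0)` and `(0, 1)` give the
term of the isolated points, and averaging over a red and a blue root, whose integrals agree because
both are limits of the same frequency, gives the series (`lintegral_tsum_limitFreq`). The limit for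
the torus follows from the bound on the difference, which is of smaller order.
-/

/-! ### Connected components and minimum spanning trees -/

namespace SimpleGraph

variable {V : Type*}

/-- The number of connected components. -/
noncomputable def numComp (G : SimpleGraph V) : ℕ := Nat.card G.ConnectedComponent

lemma reachable_of_forall_adj_reachable {G T : SimpleGraph V}
    (h : ∀ x y, G.Adj x y → T.Reachable x y) {x y : V} (hxy : G.Reachable x y) :
    T.Reachable x y := by
  rw [reachable_iff_reflTransGen] at hxy
  induction hxy with
  | refl => exact Reachable.rfl
  | tail _ hbc ih => exact ih.trans (h _ _ hbc)

lemma numComp_anti [Finite V] {G H : SimpleGraph V} (h : G ≤ H) : numComp H ≤ numComp G :=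
  ConnectedComponent.card_le_card_of_le h

lemma numComp_congr {G H : SimpleGraph V} (h : ∀ x y, G.Reachable x y ↔ H.Reachable x y) :
    numComp G = numComp H := by
  have : G.Reachable = H.Reachable := by ext x y; exact h x y
  unfold numComp ConnectedComponent
  rw [this]

lemma numComp_pos [Finite V] [Nonempty V] (G : SimpleGraph V) : 0 < numComp G := by
  have : Nonempty G.ConnectedComponent := ⟨G.connectedComponentMk (Classical.arbitrary V)⟩
  exact Nat.card_pos

lemma numComp_le_card [Finite V] (G : SimpleGraph V) : numComp G ≤ Nat.card V :=
  Nat.card_le_card_of_surjective G.connectedComponentMk Quot.mk_surjective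

lemma Preconnected.numComp_le_one {G : SimpleGraph V} (h : G.Preconnected) : numComp G ≤ 1 :=
  have := h.subsingleton_connectedComponent
  Finite.card_le_one_iff_subsingleton.2 this

lemma Reachable.deleteEdges_singleton {G : SimpleGraph V} {a b x y : V} (h : G.Reachable x y) :
    (G.deleteEdges {s(a, b)}).Reachable x y ∨
      ((G.deleteEdges {s(a, b)}).Reachable x a ∨ (G.deleteEdges {s(a, b)}).Reachable x b) ∧
      ((G.deleteEdges {s(a, b)}).Reachable y a ∨ (G.deleteEdges {s(a, b)}).Reachable y b) := by
  rw [reachable_iff_reflTransGen] at h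
  induction h with
  | refl => exact Or.inl Reachable.rfl
  | @tail v w _ hbc ih =>
    by_cases he : s(v, w) = s(a, b)
    · rcases Sym2.eq_iff.1 he with ⟨rfl, rfl⟩ | ⟨rfl, rfl⟩
      · refine Or.inr ⟨?_, Or.inr Reachable.rfl⟩
        rcases ih with ih | ih
        · exact Or.inl ih
        · exact ih.1
      · refine Or.inr ⟨?_, Or.inl Reachable.rfl⟩
        rcases ih with ih | ih
        · exact Or.inr ih
        · exact ih.1
    · have hadj : (G.deleteEdges {s(a, b)}).Adj v w := by
        rw [deleteEdges_adj]; exact ⟨hbc, he⟩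
      have hr := hadj.reachable
      rcases ih with ih | ⟨ih1, ih2⟩
      · exact Or.inl (ih.trans hr)
      · exact Or.inr ⟨ih1, ih2.imp hr.symm.trans hr.symm.trans⟩

lemma numComp_deleteEdges_singleton_le [Finite V] (G : SimpleGraph V) (e : Sym2 V) :
    numComp (G.deleteEdges {e}) ≤ numComp G + 1 := by
  classical
  induction e with | h a b => ?_
  set G' := G.deleteEdges {s(a, b)} with hG'
  have hle : G' ≤ G := deleteEdges_le _
  let f : G'.ConnectedComponent → Option G.ConnectedComponent := fun c =>
    if c = G'.connectedComponentMk b then none else some (c.map (Hom.ofLE hle))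
  have hf : Function.Injective f := by
    intro c c' h
    induction c using ConnectedComponent.ind with | h x => ?_
    induction c' using ConnectedComponent.ind with | h y => ?_
    simp only [f] at h
    split_ifs at h with h1 h2 h2
    · rw [h1, h2]
    · simp only [ConnectedComponent.map_mk, Option.some.injEq, ConnectedComponent.eq] at h
      have hxy : G.Reachable x y := h
      rw [ConnectedComponent.eq] at h1 h2 ⊢
      rcases hxy.deleteEdges_singleton (a := a) (b := b) with h3 | ⟨h3, h4⟩
      · exact h3
      · exact (h3.resolve_right h1).trans (h4.resolve_right h2).symm
  have := Nat.card_le_card_of_injective f hf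
  rwa [Finite.card_option] at this

/-- Deleting a set of edges creates at most as many components as there are deleted edges. -/
lemma numComp_deleteEdges_le [Finite V] (G : SimpleGraph V) (s : Set (Sym2 V)) :
    numComp (G.deleteEdges s) ≤ numComp G + (G.edgeSet ∩ s).ncard := by
  induction s, s.toFinite using Set.Finite.induction_on with
  | empty => simp
  | @insert e s he hs ih =>
    have h1 : G.deleteEdges (insert e s) = (G.deleteEdges s).deleteEdges {e} := by
      rw [deleteEdges_deleteEdges, Set.union_singleton]
    by_cases hG : e ∈ G.edgeSet
    · have h2 : (G.edgeSet ∩ insert e s).ncard = (G.edgeSet ∩ s).ncard + 1 := by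
        rw [Set.inter_insert_of_mem hG, Set.ncard_insert_of_notMem (fun h => he h.2)]
      rw [h1, h2]
      have := numComp_deleteEdges_singleton_le (G.deleteEdges s) e
      omega
    · have h2 : G.edgeSet ∩ insert e s = G.edgeSet ∩ s := Set.inter_insert_of_notMem hG
      have h3 : (G.deleteEdges s).deleteEdges {e} = G.deleteEdges s := by
        refine le_antisymm (deleteEdges_le _) ?_
        intro x y hxy
        rw [deleteEdges_adj]
        refine ⟨hxy, ?_⟩
        rintro rfl
        exact hG ((deleteEdges_le s) hxy)
      rw [h1, h2, h3]
      exact ih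

/-- Adding an edge between two components merges them. -/
lemma numComp_succ_le_of_not_reachable [Finite V] {G H : SimpleGraph V} (hle : G ≤ H) {a b : V}
    (hab : H.Reachable a b) (hn : ¬ G.Reachable a b) : numComp H + 1 ≤ numComp G := by
  classical
  have := Fintype.ofFinite G.ConnectedComponent
  have := Fintype.ofFinite H.ConnectedComponent
  have := Fintype.card_lt_of_surjective_not_injective
    (ConnectedComponent.map (Hom.ofLE hle)) (ConnectedComponent.surjective_map_ofLE hle)
    (fun hinj => hn (ConnectedComponent.exact (hinj (a₁ := G.connectedComponentMk a)
      (a₂ := G.connectedComponentMk b) (ConnectedComponent.sound hab))))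
  simp only [numComp, Nat.card_eq_fintype_card]
  exact this

/-- Kruskal's algorithm: some spanning forest has, for every `u` at once, as few edges of length
at least `u` as the numbers of components allow. The forest is built by removing an edge of maximal
length and putting it back when its end points have become disconnected. -/
theorem exists_kruskal_forest [Finite V] (ρ : Sym2 V → ℝ) (G : SimpleGraph V) :
    ∃ T ≤ G, (∀ x y, G.Reachable x y → T.Reachable x y) ∧
      ∀ u, (T.edgeSet ∩ {e | u ≤ ρ e}).ncard + numComp G ≤
        numComp (G.deleteEdges {e | u ≤ ρ e}) := by
  induction hn : G.edgeSet.ncard generalizing G with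
  | zero =>
    have hG : G = ⊥ := by
      rw [Set.ncard_eq_zero] at hn
      rwa [← edgeSet_eq_empty]
    subst hG
    exact ⟨⊥, le_rfl, fun _ _ h => h, fun u => by
      simpa using numComp_anti (deleteEdges_le _)⟩
  | succ n ih =>
    have hne : G.edgeSet.Nonempty := by
      rw [← Set.ncard_pos]; omega
    obtain ⟨e, heG, hmax⟩ := Set.exists_max_image G.edgeSet ρ (Set.toFinite _) hne
    induction e with | h a b => ?_
    set G' := G.deleteEdges {s(a, b)} with hG'
    have hle : G' ≤ G := deleteEdges_le _
    have hcard : G'.edgeSet.ncard = n := by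
      rw [hG', edgeSet_deleteEdges, Set.ncard_sdiff_singleton_of_mem heG, hn]; rfl
    obtain ⟨T, hT, hreach, hu⟩ := ih G' hcard
    -- Levels above the maximal length delete no edge; the others delete the edge `s(a, b)`.
    have hdel : ∀ u ≤ ρ s(a, b), G.deleteEdges {e | u ≤ ρ e} = G'.deleteEdges {e | u ≤ ρ e} := by
      intro u hu
      rw [hG', deleteEdges_deleteEdges]
      congr 1
      ext e
      simp only [Set.mem_ofPred_eq, Set.mem_union, Set.mem_singleton_iff]
      constructor
      · exact Or.inr
      · rintro (rfl | h)
        · exact hu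
        · exact h
    have hhigh : ∀ T' ≤ G, ∀ u, ρ s(a, b) < u →
        (T'.edgeSet ∩ {e | u ≤ ρ e}).ncard + numComp G ≤
          numComp (G.deleteEdges {e | u ≤ ρ e}) := by
      intro T' hT' u hu
      have h1 : T'.edgeSet ∩ {e | u ≤ ρ e} = ∅ := by
        ext e
        simp only [Set.mem_inter_iff, Set.mem_ofPred_eq, Set.mem_empty_iff_false, iff_false,
          not_and, not_le]
        exact fun he => (hmax e (edgeSet_mono hT' he)).trans_lt hu
      rw [h1, Set.ncard_empty, zero_add]
      exact numComp_anti (deleteEdges_le _)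
    by_cases hab : G'.Reachable a b
    · have hGG' : ∀ x y, G.Reachable x y → G'.Reachable x y := by
        intro x y h
        refine reachable_of_forall_adj_reachable (fun v w hvw => ?_) h
        by_cases he : s(v, w) = s(a, b)
        · rcases Sym2.eq_iff.1 he with ⟨rfl, rfl⟩ | ⟨rfl, rfl⟩
          · exact hab
          · exact hab.symm
        · exact Adj.reachable (by rw [hG', deleteEdges_adj]; exact ⟨hvw, he⟩)
      refine ⟨T, hT.trans hle, fun x y h => hreach x y (hGG' x y h), fun u => ?_⟩
      rcases le_or_gt u (ρ s(a, b)) with h | h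
      · rw [hdel u h, numComp_congr (fun x y => ⟨hGG' x y, fun h => h.mono hle⟩)]
        exact hu u
      · exact hhigh T (hT.trans hle) u h
    · have hadj : G.Adj a b := heG
      have hTle : T ⊔ edge a b ≤ G := by
        refine sup_le (hT.trans hle) ?_
        rw [edge_le_iff]
        exact Or.inr hadj
      refine ⟨T ⊔ edge a b, hTle, fun x y h => ?_, fun u => ?_⟩
      · refine reachable_of_forall_adj_reachable (fun v w hvw => ?_) h
        by_cases he : s(v, w) = s(a, b)
        · refine Adj.reachable ?_
          rw [sup_adj, edge_adj]
          have := hvw.ne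
          rw [Sym2.eq_iff] at he
          exact Or.inr ⟨by tauto, this⟩
        · exact (hreach v w (Adj.reachable (by
            rw [hG', deleteEdges_adj]; exact ⟨hvw, he⟩))).mono le_sup_left
      · rcases le_or_gt u (ρ s(a, b)) with h | h
        · rw [hdel u h]
          have h1 := hu u
          have h2 := numComp_succ_le_of_not_reachable hle hadj.reachable hab
          have h3 : ((T ⊔ edge a b).edgeSet ∩ {e | u ≤ ρ e}).ncard ≤
              (T.edgeSet ∩ {e | u ≤ ρ e}).ncard + 1 := by
            refine le_trans (Set.ncard_le_ncard (t := insert s(a, b) (T.edgeSet ∩ {e | u ≤ ρ e}))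
              ?_ (Set.toFinite _)) (Set.ncard_insert_le _ _)
            rw [edgeSet_sup, edgeSet_edge_of_ne hadj.ne]
            rintro e ⟨he1 | he1, he2⟩
            · exact Or.inr ⟨he1, he2⟩
            · exact Or.inl he1
          omega
        · exact hhigh _ hTle u h

end SimpleGraph

lemma setLIntegral_Ioc_rpow {p T : ℝ} (hp : 0 < p) (hT : 0 ≤ T) :
    ∫⁻ u in Set.Ioc 0 T, ENNReal.ofReal (p * u ^ (p - 1)) = ENNReal.ofReal (T ^ p) := by
  have hint : IntervalIntegrable (fun u : ℝ => p * u ^ (p - 1)) volume 0 T :=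
    (intervalIntegral.intervalIntegrable_rpow' (by linarith)).const_mul p
  have h := (intervalIntegrable_iff_integrableOn_Ioc_of_le hT).1 hint
  rw [← ofReal_integral_eq_lintegral_ofReal h]
  · rw [← intervalIntegral.integral_of_le hT, intervalIntegral.integral_const_mul,
      integral_rpow (Or.inl (by linarith))]
    congr 1
    rw [sub_add_cancel, Real.zero_rpow hp.ne', sub_zero]
    field_simp
  · filter_upwards [ae_restrict_mem measurableSet_Ioc] with u hu
    have := hu.1
    simp only [Pi.zero_apply]
    positivity

/-- Layer-cake formula for a power, in the form used for edge lengths. -/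
lemma ofReal_rpow_eq_lintegral {p r : ℝ} (hp : 0 < p) (hr : 0 ≤ r) :
    ENNReal.ofReal (r ^ p) =
      ∫⁻ u in Set.Ioi (0 : ℝ), ENNReal.ofReal (p * u ^ (p - 1)) * (if u ≤ r then 1 else 0) := by
  have h1 : ∀ u : ℝ, ENNReal.ofReal (p * u ^ (p - 1)) * (if u ≤ r then 1 else 0) =
      (Set.Iic r).indicator (fun u => ENNReal.ofReal (p * u ^ (p - 1))) u := by
    intro u
    by_cases h : u ≤ r <;> simp [h, Set.indicator]
  simp_rw [h1]
  rw [lintegral_indicator measurableSet_Iic, Measure.restrict_restrict measurableSet_Iic,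
    Set.inter_comm, Set.Ioi_inter_Iic, setLIntegral_Ioc_rpow hp hr]

/-- The MST cost as an integral over length thresholds: the number of edges of length at least `u`
in a spanning tree is at least the number of components at level `u` minus one, with equality for
all `u` for the tree of Kruskal's algorithm. -/
theorem mstCost_eq_lintegral {V : Type*} [Finite V] {G : SimpleGraph V} (hG : G.Connected)
    {ρ : Sym2 V → ℝ} (hρ : ∀ e, 0 ≤ ρ e) {p : ℝ} (hp : 0 < p) :
    mstCost G (fun e => ENNReal.ofReal (ρ e ^ p)) =
      ∫⁻ u in Set.Ioi (0 : ℝ), ENNReal.ofReal (p * u ^ (p - 1)) *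
        (((G.deleteEdges {e | u ≤ ρ e}).numComp : ℝ≥0∞) - 1) := by
  classical
  have : Fintype V := Fintype.ofFinite V
  have : Nonempty V := hG.nonempty
  have key : ∀ T : SimpleGraph V, ∑' e : T.edgeSet, ENNReal.ofReal (ρ e ^ p) =
      ∫⁻ u in Set.Ioi (0 : ℝ), ENNReal.ofReal (p * u ^ (p - 1)) *
        ((T.edgeSet ∩ {e | u ≤ ρ e}).ncard : ℝ≥0∞) := by
    intro T
    rw [tsum_fintype]
    simp_rw [ofReal_rpow_eq_lintegral hp (hρ _)]
    rw [← lintegral_finsetSum]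
    · refine lintegral_congr fun u => ?_
      rw [← Finset.mul_sum, Finset.sum_boole]
      congr 2
      rw [← Set.ncard_coe_finset, ← Set.ncard_image_of_injective _ Subtype.val_injective]
      congr 1
      ext e
      simp only [Finset.coe_filter, Finset.mem_univ, true_and, Set.mem_image, Set.mem_ofPred_eq,
        Subtype.exists, exists_and_left, exists_prop, exists_eq_right_right, Set.mem_inter_iff]
      tauto
    · intro e _
      refine Measurable.mul (by fun_prop) ?_
      exact Measurable.ite measurableSet_Iic measurable_const measurable_const
  refine le_antisymm ?_ ?_
  · obtain ⟨T, hT, hreach, hu⟩ := SimpleGraph.exists_kruskal_forest ρ G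
    have hTc : T.Connected := ⟨fun x y => hreach x y (hG.preconnected x y)⟩
    refine (iInf₂_le T ⟨hT, hTc⟩).trans ?_
    rw [key]
    refine lintegral_mono fun u => ?_
    gcongr
    have h1 := hu u
    have h2 := SimpleGraph.numComp_pos G
    refine ENNReal.le_sub_of_add_le_right (by simp) ?_
    exact_mod_cast (by omega :
      (T.edgeSet ∩ {e | u ≤ ρ e}).ncard + 1 ≤ (G.deleteEdges {e | u ≤ ρ e}).numComp)
  · refine le_iInf₂ fun T hT => ?_
    rw [key]
    refine lintegral_mono fun u => ?_
    gcongr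
    rw [tsub_le_iff_right]
    have h1 := T.numComp_deleteEdges_le {e | u ≤ ρ e}
    have h2 := hT.2.preconnected.numComp_le_one
    have h3 : (G.deleteEdges {e | u ≤ ρ e}).numComp ≤ (T.deleteEdges {e | u ≤ ρ e}).numComp :=
      SimpleGraph.numComp_anti (SimpleGraph.deleteEdges_mono hT.1)
    exact_mod_cast (by omega :
      (G.deleteEdges {e | u ≤ ρ e}).numComp ≤ (T.edgeSet ∩ {e | u ≤ ρ e}).ncard + 1)

/-- The bipartite graph on the points `x`, `y` whose edges are the red-blue pairs at distance
less than `u`. For `u = 1` it is `closeGraph`, but here the points may lie in any metric space,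
in particular in the torus. -/
def levelGraph {A B M : Type*} [PseudoMetricSpace M] (u : ℝ) (x : A → M) (y : B → M) :
    SimpleGraph (A ⊕ B) where
  Adj v w := (completeBipartiteGraph A B).Adj v w ∧
    dist (Sum.elim x y v) (Sum.elim x y w) < u
  symm := ⟨fun _ _ h => ⟨h.1.symm, by rw [dist_comm]; exact h.2⟩⟩
  loopless := ⟨fun _ h => (completeBipartiteGraph A B).irrefl h.1⟩

/-- The number of components of the level graph, as an extended nonnegative real. -/
noncomputable def levelComp {A B M : Type*} [PseudoMetricSpace M] (u : ℝ) (x : A → M)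
    (y : B → M) : ℝ≥0∞ := ((levelGraph u x y).numComp : ℝ≥0∞)

lemma connected_completeBipartiteGraph {a b : ℕ} (ha : 0 < a) (hb : 0 < b) :
    (completeBipartiteGraph (Fin a) (Fin b)).Connected := by
  have hlr : ∀ i j, (completeBipartiteGraph (Fin a) (Fin b)).Reachable (.inl i) (.inr j) :=
    fun i j => SimpleGraph.Adj.reachable (by simp)
  rw [SimpleGraph.connected_iff_exists_forall_reachable]
  refine ⟨.inl ⟨0, ha⟩, ?_⟩
  rintro (i | j)
  · exact (hlr _ ⟨0, hb⟩).trans (hlr i _).symm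
  · exact hlr _ _

theorem bipartiteMSTCost_eq_lintegral {M : Type*} [PseudoMetricSpace M] {a b : ℕ} (ha : 0 < a)
    (hb : 0 < b) {p : ℝ} (hp : 0 < p) (x : Fin a → M) (y : Fin b → M) :
    bipartiteMSTCost p x y = ∫⁻ u in Set.Ioi (0 : ℝ), ENNReal.ofReal (p * u ^ (p - 1)) *
        (levelComp u x y - 1) := by
  let ρ : Sym2 (Fin a ⊕ Fin b) → ℝ := Sym2.lift
    ⟨fun v w => dist (Sum.elim x y v) (Sum.elim x y w), fun _ _ => dist_comm _ _⟩
  have hρ : ∀ e, 0 ≤ ρ e := fun e => by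
    induction e with | h v w => exact dist_nonneg
  have hw : distWeight p (Sum.elim x y) = fun e => ENNReal.ofReal (ρ e ^ p) := by
    ext e
    induction e with | h v w => rfl
  rw [bipartiteMSTCost, hw, mstCost_eq_lintegral (connected_completeBipartiteGraph ha hb) hρ hp]
  refine lintegral_congr fun u => ?_
  unfold levelComp
  congr 4
  ext v w
  rw [SimpleGraph.deleteEdges_adj]
  simp [levelGraph, ρ]

/-! ### Comparison of component counts -/

namespace SimpleGraph

variable {V : Type*}

/-- If all edges of `H` missing from `G` have their end points in `S`, then passing from `G` to `H`
merges only components that touch `S`. -/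
lemma numComp_le_add_touching [Finite V] {G H : SimpleGraph V} (hle : G ≤ H) (S : Set V)
    (hS : ∀ v w, H.Adj v w → ¬ G.Adj v w → v ∈ S) :
    numComp G ≤ numComp H + (G.connectedComponentMk '' S).ncard := by
  classical
  have key : ∀ x y, G.connectedComponentMk x ∉ G.connectedComponentMk '' S → H.Reachable x y →
      G.Reachable x y := by
    intro x y hx h
    rw [reachable_iff_reflTransGen] at h
    induction h with
    | refl => exact Reachable.rfl
    | @tail v w _ hbc ih =>
      refine ih.trans (Adj.reachable ?_)
      by_contra hG
      exact hx ⟨v, hS v w hbc hG, ConnectedComponent.sound ih.symm⟩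
  let f : G.ConnectedComponent → H.ConnectedComponent ⊕ (G.connectedComponentMk '' S) := fun c =>
    if h : c ∈ G.connectedComponentMk '' S then .inr ⟨c, h⟩ else .inl (c.map (Hom.ofLE hle))
  have hf : Function.Injective f := by
    intro c c' h
    simp only [f] at h
    split_ifs at h with h1 h2 h2
    · simpa using h
    · induction c using ConnectedComponent.ind with | h x => ?_
      induction c' using ConnectedComponent.ind with | h y => ?_
      simp only [ConnectedComponent.map_mk, Sum.inl.injEq, ConnectedComponent.eq] at h
      exact ConnectedComponent.sound (key x y h1 h)
  have := Nat.card_le_card_of_injective f hf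
  rwa [Nat.card_sum, Nat.card_coe_set_eq] at this

/-- If good vertices with the same label are connected, then the components touching `S` are
counted by the labels and the bad vertices of `S`. -/
lemma ncard_touching_le [Finite V] (G : SimpleGraph V) (S good : Set V) {ι : Type*} (f : V → ι)
    (h : ∀ v ∈ good, ∀ w ∈ good, f v = f w → G.Reachable v w) :
    (G.connectedComponentMk '' S).ncard ≤ (f '' S).ncard + (S \ good).ncard := by
  classical
  rcases isEmpty_or_nonempty V with hV | hV
  · have : S = ∅ := Set.eq_empty_of_isEmpty S
    simp [this]
  let g : ι → G.ConnectedComponent := fun i =>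
    if hi : ∃ v ∈ S ∩ good, f v = i then G.connectedComponentMk hi.choose
    else G.connectedComponentMk (Classical.arbitrary V)
  have hsub : G.connectedComponentMk '' S ⊆
      g '' (f '' S) ∪ G.connectedComponentMk '' (S \ good) := by
    rintro _ ⟨v, hv, rfl⟩
    by_cases hg : v ∈ good
    · refine Or.inl ⟨f v, ⟨v, hv, rfl⟩, ?_⟩
      have hi : ∃ w ∈ S ∩ good, f w = f v := ⟨v, ⟨hv, hg⟩, rfl⟩
      simp only [g, dif_pos hi]
      exact ConnectedComponent.sound (h _ hi.choose_spec.1.2 _ hg hi.choose_spec.2)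
    · exact Or.inr ⟨v, ⟨hv, hg⟩, rfl⟩
  calc _ ≤ _ := Set.ncard_le_ncard hsub (Set.toFinite _)
    _ ≤ _ := Set.ncard_union_le _ _
    _ ≤ _ := add_le_add (Set.ncard_image_le (Set.toFinite _)) (Set.ncard_image_le (Set.toFinite _))

end SimpleGraph

/-! ### The cube, its grid cells and its boundary strip -/

section Cube

variable {d : ℕ}

/-- The half-open unit cube; its grid cells partition it exactly. -/
def hcube (d : ℕ) : Set (EuclideanSpace ℝ (Fin d)) := {x | ∀ i, x i ∈ Set.Ico (0 : ℝ) 1}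

/-- The set of points within coordinate distance `u` of the boundary of the unit cube. -/
def strip (d : ℕ) (u : ℝ) : Set (EuclideanSpace ℝ (Fin d)) := {x | ∃ i, x i < u ∨ 1 - u < x i}

/-- The index of the cell of the grid of mesh `1 / m` containing a point. -/
noncomputable def gridCell (m : ℕ) (x : EuclideanSpace ℝ (Fin d)) : Fin d → ℤ :=
  fun i => ⌊(m : ℝ) * x i⌋

lemma measurableSet_coord_box {s : Fin d → Set ℝ} (hs : ∀ i, MeasurableSet (s i)) :
    MeasurableSet {x : EuclideanSpace ℝ (Fin d) | ∀ i, x i ∈ s i} := by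
  have : {x : EuclideanSpace ℝ (Fin d) | ∀ i, x i ∈ s i} = ⋂ i, (fun x => x i) ⁻¹' (s i) := by
    ext; simp
  rw [this]
  exact MeasurableSet.iInter fun i => (by fun_prop : Measurable
    fun x : EuclideanSpace ℝ (Fin d) => x i) (hs i)

lemma volume_coord_box (s : Fin d → Set ℝ) (hs : ∀ i, MeasurableSet (s i)) :
    volume {x : EuclideanSpace ℝ (Fin d) | ∀ i, x i ∈ s i} = ∏ i, volume (s i) := by
  have h := (EuclideanSpace.volume_preserving_symm_measurableEquiv_toLp (Fin d)).measure_preimage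
    (MeasurableSet.univ_pi hs).nullMeasurableSet
  rw [volume_pi_pi] at h
  rw [← h]
  congr 1
  ext x
  simp

lemma measurableSet_hcube : MeasurableSet (hcube d) :=
  measurableSet_coord_box fun _ => measurableSet_Ico

lemma volume_hcube : volume (hcube d) = 1 := by
  unfold hcube
  rw [volume_coord_box _ fun _ => measurableSet_Ico]
  simp

lemma hcube_subset_unitCube : hcube d ⊆ unitCube d := fun _ hx i => Set.Ico_subset_Icc_self (hx i)

lemma volume_unitCube : volume (unitCube d) = 1 := by
  unfold unitCube
  rw [volume_coord_box _ fun _ => measurableSet_Icc]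
  simp

lemma hcube_ae_eq_unitCube : (hcube d : Set _) =ᵐ[volume] unitCube d := by
  refine ae_eq_of_subset_of_measure_ge hcube_subset_unitCube ?_
    measurableSet_hcube.nullMeasurableSet (by simp [volume_unitCube])
  rw [volume_unitCube, volume_hcube]

lemma convex_hcube : Convex ℝ (hcube d) := by
  intro x hx y hy a b ha hb hab i
  exact (convex_Ico (0 : ℝ) 1) (hx i) (hy i) ha hb hab

lemma measurable_gridCell (m : ℕ) : Measurable (gridCell (d := d) m) := by
  unfold gridCell
  fun_prop

/-- The cell of index `c` of the grid of mesh `1 / m`. -/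
lemma gridCell_eq_iff {m : ℕ} (hm : 0 < m) (x : EuclideanSpace ℝ (Fin d)) (c : Fin d → ℤ) :
    gridCell m x = c ↔ ∀ i, x i ∈ Set.Ico ((c i : ℝ) / m) ((c i + 1) / m) := by
  have hm' : (0 : ℝ) < m := by exact_mod_cast hm
  simp only [gridCell, funext_iff, Int.floor_eq_iff, Set.mem_Ico, div_le_iff₀ hm', lt_div_iff₀ hm',
    mul_comm]

lemma gridCell_mem_Ico {m : ℕ} (hm : 0 < m) {x : EuclideanSpace ℝ (Fin d)} (hx : x ∈ hcube d)
    (i : Fin d) : 0 ≤ gridCell m x i ∧ gridCell m x i + 1 ≤ m := by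
  have hm' : (0 : ℝ) < m := by exact_mod_cast hm
  constructor
  · exact Int.floor_nonneg.2 (mul_nonneg hm'.le (hx i).1)
  · have : gridCell m x i < (m : ℤ) := by
      refine Int.floor_lt.2 ?_
      have := (hx i).2
      push_cast
      nlinarith
    omega

lemma gridCell_eq_subset_hcube {m : ℕ} (hm : 0 < m) {x y : EuclideanSpace ℝ (Fin d)}
    (hx : x ∈ hcube d) (h : gridCell m y = gridCell m x) : y ∈ hcube d := by
  have hm' : (0 : ℝ) < m := by exact_mod_cast hm
  rw [gridCell_eq_iff hm] at h
  intro i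
  obtain ⟨h1, h2⟩ := gridCell_mem_Ico hm hx i
  obtain ⟨h3, h4⟩ := h i
  refine ⟨le_trans (by positivity) h3, h4.trans_le ?_⟩
  rw [div_le_one hm']
  exact_mod_cast h2

lemma volume_gridCell_eq {m : ℕ} (hm : 0 < m) (c : Fin d → ℤ) :
    volume {y : EuclideanSpace ℝ (Fin d) | gridCell m y = c} = ((m : ℝ≥0∞) ^ d)⁻¹ := by
  have hm' : (0 : ℝ) < m := by exact_mod_cast hm
  simp_rw [gridCell_eq_iff hm]
  rw [volume_coord_box _ fun _ => measurableSet_Ico]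
  have : ∀ i, volume (Set.Ico ((c i : ℝ) / m) ((c i + 1) / m)) = (m : ℝ≥0∞)⁻¹ := by
    intro i
    rw [Real.volume_Ico, ← sub_div, add_sub_cancel_left, one_div, ENNReal.ofReal_inv_of_pos hm',
      ENNReal.ofReal_natCast]
  simp [this, ENNReal.inv_pow]

lemma dist_le_of_coord_le {x y : EuclideanSpace ℝ (Fin d)} {r : ℝ} (hr : 0 ≤ r)
    (h : ∀ i, |x i - y i| ≤ r) : dist x y ≤ √d * r := by
  rw [EuclideanSpace.dist_eq]
  have : √(d : ℝ) * r = √(∑ _i : Fin d, r ^ 2) := by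
    rw [Finset.sum_const, Finset.card_univ, Fintype.card_fin, nsmul_eq_mul,
      Real.sqrt_mul (by positivity), Real.sqrt_sq hr]
  rw [this]
  refine Real.sqrt_le_sqrt (Finset.sum_le_sum fun i _ => ?_)
  rw [Real.dist_eq]
  exact pow_le_pow_left₀ (abs_nonneg _) (h i) 2

lemma coord_close_of_gridCell_eq {m : ℕ} (hm : 0 < m) {x y : EuclideanSpace ℝ (Fin d)}
    (h : gridCell m x = gridCell m y) (i : Fin d) : |x i - y i| ≤ 1 / m := by
  have hm' : (0 : ℝ) < m := by exact_mod_cast hm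
  have h1 := Int.abs_sub_lt_one_of_floor_eq_floor (congrFun h i)
  rw [← mul_sub, abs_mul, abs_of_pos hm'] at h1
  rw [le_div_iff₀ hm']
  linarith

lemma dist_le_of_gridCell_eq {m : ℕ} (hm : 0 < m) {x y : EuclideanSpace ℝ (Fin d)}
    (h : gridCell m x = gridCell m y) : dist x y ≤ √d / m := by
  have := dist_le_of_coord_le (by positivity) (coord_close_of_gridCell_eq hm h)
  rwa [mul_one_div] at this

lemma finite_gridCell_image {m : ℕ} (hm : 0 < m) (S : Set (EuclideanSpace ℝ (Fin d))) :
    (gridCell m '' (S ∩ hcube d)).Finite := by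
  refine Set.Finite.subset (Set.Finite.pi' fun _ : Fin d => Set.finite_Icc (0 : ℤ) m) ?_
  rintro _ ⟨x, hx, rfl⟩ i
  obtain ⟨h1, h2⟩ := gridCell_mem_Ico hm hx.2 i
  exact ⟨h1, by omega⟩

/-- The cells meeting `S` are disjoint and of equal volume, so there are at most as many as fit
into a set `S'` containing them. -/
lemma ncard_gridCell_image_le {m : ℕ} (hm : 0 < m) {S S' : Set (EuclideanSpace ℝ (Fin d))}
    (h : ∀ x ∈ S ∩ hcube d, ∀ y, gridCell m y = gridCell m x → y ∈ S') :
    ((gridCell m '' (S ∩ hcube d)).ncard : ℝ≥0∞) ≤ (m : ℝ≥0∞) ^ d * volume (S' ∩ hcube d) := by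
  have hfin := finite_gridCell_image hm S
  have h1 : volume (⋃ c ∈ hfin.toFinset, {y : EuclideanSpace ℝ (Fin d) | gridCell m y = c}) =
      ∑ c ∈ hfin.toFinset, ((m : ℝ≥0∞) ^ d)⁻¹ := by
    rw [measure_biUnion_finset]
    · exact Finset.sum_congr rfl fun c _ => volume_gridCell_eq hm c
    · intro c _ c' _ hcc
      exact Set.disjoint_left.2 fun y hy hy' => hcc (hy.symm.trans hy')
    · intro c _
      exact measurable_gridCell m (measurableSet_singleton c)
  have h2 : (⋃ c ∈ hfin.toFinset, {y : EuclideanSpace ℝ (Fin d) | gridCell m y = c}) ⊆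
      S' ∩ hcube d := by
    intro y hy
    simp only [Set.mem_iUnion, Set.Finite.mem_toFinset, Set.mem_image, exists_prop] at hy
    obtain ⟨_, ⟨x, hx, rfl⟩, hy⟩ := hy
    exact ⟨h x hx y hy, gridCell_eq_subset_hcube hm hx.2 hy⟩
  have h3 := measure_mono (μ := volume) h2
  have hm0 : ((m : ℝ≥0∞) ^ d) ≠ 0 := pow_ne_zero _ (by exact_mod_cast hm.ne')
  have hmt : ((m : ℝ≥0∞) ^ d) ≠ ∞ := ENNReal.pow_ne_top (by simp)
  rw [h1, Finset.sum_const, nsmul_eq_mul, ← Set.ncard_eq_toFinset_card _ hfin] at h3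
  calc _ = (m : ℝ≥0∞) ^ d * ((gridCell m '' (S ∩ hcube d)).ncard * ((m : ℝ≥0∞) ^ d)⁻¹) := by
        rw [mul_comm, mul_assoc, ENNReal.inv_mul_cancel hm0 hmt, mul_one]
    _ ≤ _ := by gcongr

lemma measurableSet_strip (u : ℝ) : MeasurableSet (strip d u) := by
  have : strip d u = ⋃ i, ((fun x : EuclideanSpace ℝ (Fin d) => x i) ⁻¹' Set.Iio u ∪
      (fun x : EuclideanSpace ℝ (Fin d) => x i) ⁻¹' Set.Ioi (1 - u)) := by
    ext; simp [strip]
  rw [this]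
  refine MeasurableSet.iUnion fun i => ?_
  have hm : Measurable fun x : EuclideanSpace ℝ (Fin d) => x i := by fun_prop
  exact (hm measurableSet_Iio).union (hm measurableSet_Ioi)

lemma volume_strip_le (u : ℝ) :
    volume (strip d u ∩ hcube d) ≤ 2 * d * ENNReal.ofReal u := by
  have hslab : ∀ (i : Fin d) (s : Set ℝ), MeasurableSet s →
      volume {x : EuclideanSpace ℝ (Fin d) | x i ∈ s ∧ x ∈ hcube d} ≤ volume s := by
    intro i s hs
    refine (measure_mono (t := {x | ∀ j, x j ∈ if j = i then s else Set.Ico (0 : ℝ) 1}) ?_).trans ?_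
    · rintro x ⟨h1, h2⟩ j
      split_ifs with h
      · rwa [h]
      · exact h2 j
    · rw [volume_coord_box]
      · rw [Finset.prod_eq_single i]
        · simp
        · intro j _ hj; simp [hj]
        · simp
      · intro j; split_ifs; exacts [hs, measurableSet_Ico]
  have hsub : strip d u ∩ hcube d ⊆ ⋃ i : Fin d,
      ({x | x i ∈ Set.Ico 0 u ∧ x ∈ hcube d} ∪ {x | x i ∈ Set.Ioo (1 - u) 1 ∧ x ∈ hcube d}) := by
    rintro x ⟨⟨i, hi⟩, hx⟩
    refine Set.mem_iUnion.2 ⟨i, hi.imp (fun h => ⟨⟨(hx i).1, h⟩, hx⟩) fun h => ⟨⟨h, (hx i).2⟩, hx⟩⟩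
  calc _ ≤ _ := measure_mono hsub
    _ ≤ ∑ i : Fin d, _ := measure_iUnion_fintype_le _ _
    _ ≤ ∑ i : Fin d, (2 * ENNReal.ofReal u) := by
        refine Finset.sum_le_sum fun i _ => (measure_union_le _ _).trans ?_
        rw [two_mul]
        refine add_le_add ((hslab i _ measurableSet_Ico).trans ?_)
          ((hslab i _ measurableSet_Ioo).trans ?_)
        · rw [Real.volume_Ico, sub_zero]
        · rw [Real.volume_Ioo, sub_sub_cancel]
    _ = _ := by
        rw [Finset.sum_const, Finset.card_univ, Fintype.card_fin, nsmul_eq_mul]; ring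

/-- A cell meeting the strip of width `u` lies in the strip of width `2 * u`. -/
lemma mem_strip_of_gridCell_eq {m : ℕ} (hm : 0 < m) {u : ℝ} (hmu : 1 / m < u)
    {x y : EuclideanSpace ℝ (Fin d)} (hx : x ∈ strip d u) (h : gridCell m y = gridCell m x) :
    y ∈ strip d (2 * u) := by
  obtain ⟨i, hi⟩ := hx
  have h1 := abs_le.1 (coord_close_of_gridCell_eq hm h i)
  exact ⟨i, hi.imp (fun h => by linarith) fun h => by linarith⟩

/-! ### Level graphs of points in the cube -/

variable {A B : Type*}

/-- The red or blue points lying in `S` without a point of the other colour in their grid cell. -/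
def lonely (m : ℕ) (S : Set (EuclideanSpace ℝ (Fin d))) (x : A → EuclideanSpace ℝ (Fin d))
    (y : B → EuclideanSpace ℝ (Fin d)) : Set A :=
  {i | x i ∈ S ∧ ∀ j, gridCell m (y j) ≠ gridCell m (x i)}

/-- The components of the level graph that touch `S`. -/
def touching (u : ℝ) (S : Set (EuclideanSpace ℝ (Fin d))) (x : A → EuclideanSpace ℝ (Fin d))
    (y : B → EuclideanSpace ℝ (Fin d)) : Set (levelGraph u x y).ConnectedComponent :=
  (levelGraph u x y).connectedComponentMk '' {v | Sum.elim x y v ∈ S}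

lemma levelGraph_adj {M : Type*} [PseudoMetricSpace M] {u : ℝ} {x : A → M} {y : B → M} {i : A}
    {j : B} : (levelGraph u x y).Adj (.inl i) (.inr j) ↔ dist (x i) (y j) < u := by
  simp [levelGraph]

/-- A cell containing points of both colours has all its points in one component of the level graph,
as soon as `u` exceeds the diameter of a cell. -/
lemma ncard_touching_le_cells [Finite A] [Finite B] {m : ℕ} (hm : 0 < m) {u : ℝ} (hmu : √d / m < u)
    (S : Set (EuclideanSpace ℝ (Fin d))) {x : A → EuclideanSpace ℝ (Fin d)}
    {y : B → EuclideanSpace ℝ (Fin d)} (hx : ∀ i, x i ∈ hcube d) (hy : ∀ j, y j ∈ hcube d) :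
    (touching u S x y).ncard ≤ (gridCell m '' (S ∩ hcube d)).ncard +
      ((lonely m S x y).ncard + (lonely m S y x).ncard) := by
  let f : A ⊕ B → Fin d → ℤ := fun v => gridCell m (Sum.elim x y v)
  have hadj : ∀ i j, f (.inl i) = f (.inr j) → (levelGraph u x y).Reachable (.inl i) (.inr j) :=
    fun i j h => by
      have hd : dist (x i) (y j) < u := (dist_le_of_gridCell_eq hm h).trans_lt hmu
      exact (levelGraph_adj.2 hd).reachable
  -- A vertex is good if its cell contains both colours.
  let good : Set (A ⊕ B) := {v | (∃ i, f (.inl i) = f v) ∧ ∃ j, f (.inr j) = f v}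
  have h := (levelGraph u x y).ncard_touching_le {v | Sum.elim x y v ∈ S} good f (by
    rintro v ⟨⟨i, hi⟩, ⟨j, hj⟩⟩ w ⟨_, _⟩ hvw
    have hij := hadj i j (hi.trans hj.symm)
    have hto : ∀ w, f v = f w → (levelGraph u x y).Reachable (.inl i) w := by
      rintro (k | k) hk
      · exact hij.trans (hadj k j (by rw [hj, hk])).symm
      · exact hadj i k (by rw [hi, hk])
    exact (hto v rfl).symm.trans (hto w hvw))
  refine h.trans (add_le_add (Set.ncard_le_ncard ?_ (finite_gridCell_image hm S)) ?_)
  · rintro _ ⟨v, hv, rfl⟩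
    refine ⟨Sum.elim x y v, ⟨hv, ?_⟩, rfl⟩
    rcases v with i | j
    exacts [hx i, hy j]
  · have hsub : {v | Sum.elim x y v ∈ S} \ good ⊆
        Sum.inl '' (lonely m S x y) ∪ Sum.inr '' (lonely m S y x) := by
      rintro (i | j) ⟨hv, hg⟩
      · exact Or.inl ⟨i, ⟨hv, fun j hj => hg ⟨⟨i, rfl⟩, ⟨j, hj⟩⟩⟩, rfl⟩
      · exact Or.inr ⟨j, ⟨hv, fun i hi => hg ⟨⟨i, hi⟩, ⟨j, rfl⟩⟩⟩, rfl⟩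
    refine (Set.ncard_le_ncard hsub (Set.toFinite _)).trans ((Set.ncard_union_le _ _).trans ?_)
    exact add_le_add (Set.ncard_image_le (Set.toFinite _)) (Set.ncard_image_le (Set.toFinite _))

lemma numComp_eq_ncard_touching_univ {u : ℝ} {x : A → EuclideanSpace ℝ (Fin d)}
    {y : B → EuclideanSpace ℝ (Fin d)} :
    (levelGraph u x y).numComp = (touching u Set.univ x y).ncard := by
  have : touching u Set.univ x y = Set.univ := by
    unfold touching
    rw [Set.eq_univ_iff_forall]
    intro c
    induction c using SimpleGraph.ConnectedComponent.ind with | h v => exact ⟨v, trivial, rfl⟩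
  rw [this, Set.ncard_univ]
  rfl

lemma ncard_touching_le_points [Finite A] [Finite B] (u : ℝ) (S : Set (EuclideanSpace ℝ (Fin d)))
    (x : A → EuclideanSpace ℝ (Fin d)) (y : B → EuclideanSpace ℝ (Fin d)) :
    (touching u S x y).ncard ≤ {i | x i ∈ S}.ncard + {j | y j ∈ S}.ncard := by
  have hsub : {v | Sum.elim x y v ∈ S} ⊆ Sum.inl '' {i | x i ∈ S} ∪ Sum.inr '' {j | y j ∈ S} := by
    rintro (i | j) hv
    · exact Or.inl ⟨i, hv, rfl⟩
    · exact Or.inr ⟨j, hv, rfl⟩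
  refine (Set.ncard_image_le (Set.toFinite _)).trans ?_
  refine (Set.ncard_le_ncard hsub (Set.toFinite _)).trans ((Set.ncard_union_le _ _).trans ?_)
  exact add_le_add (Set.ncard_image_le (Set.toFinite _)) (Set.ncard_image_le (Set.toFinite _))

/-- If the red points and the blue points are both dense in the cube, then the level graph is
connected: the component of a red point close to `z` is a locally constant function of `z`. -/
lemma preconnected_levelGraph_of_dense {u δ : ℝ} (hu : 3 * δ ≤ u)
    {x : A → EuclideanSpace ℝ (Fin d)} {y : B → EuclideanSpace ℝ (Fin d)}
    (hx : ∀ i, x i ∈ hcube d) (hy : ∀ j, y j ∈ hcube d)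
    (hxd : ∀ z ∈ hcube d, ∃ i, dist z (x i) < δ) (hyd : ∀ z ∈ hcube d, ∃ j, dist z (y j) < δ) :
    (levelGraph u x y).Preconnected := by
  classical
  rcases isEmpty_or_nonempty A with hA | hA
  · rintro (i | j)
    · exact hA.elim i
    · obtain ⟨i, _⟩ := hxd _ (hy j)
      exact hA.elim i
  have hB : Nonempty B := by
    obtain ⟨j, _⟩ := hyd _ (hx hA.some)
    exact ⟨j⟩
  choose! r hr using hxd
  choose! b hb using hyd
  have hδ : ∀ z ∈ hcube d, 0 < δ := fun z hz => dist_nonneg.trans_lt (hr z hz)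
  have hclose : ∀ z ∈ hcube d, ∀ z' ∈ hcube d, dist z z' < δ →
      (levelGraph u x y).Reachable (.inl (r z)) (.inr (b z')) := by
    intro z hz z' hz' h
    refine (levelGraph_adj.2 ?_).reachable
    calc dist (x (r z)) (y (b z')) ≤ dist (x (r z)) z + dist z z' + dist z' (y (b z')) :=
          dist_triangle4 _ _ _ _
      _ < δ + δ + δ := by
          have h1 := hr z hz
          have h2 := hb z' hz'
          rw [dist_comm] at h1
          linarith
      _ ≤ u := by linarith
  let f : EuclideanSpace ℝ (Fin d) → (levelGraph u x y).ConnectedComponent :=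
    fun z => (levelGraph u x y).connectedComponentMk (.inl (r z))
  let _ : TopologicalSpace (levelGraph u x y).ConnectedComponent := ⊥
  have : DiscreteTopology (levelGraph u x y).ConnectedComponent := ⟨rfl⟩
  have hf : ContinuousOn f (hcube d) := by
    intro z hz
    have hev : f =ᶠ[𝓝[hcube d] z] fun _ => f z := by
      filter_upwards [self_mem_nhdsWithin, mem_nhdsWithin_of_mem_nhds (Metric.ball_mem_nhds z
        (hδ z hz))] with z' hz' hzz
      refine SimpleGraph.ConnectedComponent.sound ((hclose z' hz' z hz hzz).trans
        (hclose z hz z hz ?_).symm)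
      rw [dist_self]
      exact hδ z hz
    exact (continuousWithinAt_const (b := f z)).congr_of_eventuallyEq hev rfl
  have hconst : ∀ z ∈ hcube d, ∀ z' ∈ hcube d,
      (levelGraph u x y).Reachable (.inl (r z)) (.inl (r z')) := fun z hz z' hz' =>
    SimpleGraph.ConnectedComponent.exact (convex_hcube.isPreconnected.constant hf hz hz')
  have hto : ∀ v, (levelGraph u x y).Reachable v (.inl (r (Sum.elim x y v))) ∧
      Sum.elim x y v ∈ hcube d := by
    rintro (i | j)
    · have h0 := hδ _ (hx i)
      refine ⟨?_, hx i⟩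
      have h1 : (levelGraph u x y).Reachable (.inl i) (.inr (b (x i))) :=
        (levelGraph_adj.2 (by linarith [hb _ (hx i)])).reachable
      exact h1.trans (hclose _ (hx i) _ (hx i) (by rwa [dist_self])).symm
    · have h0 := hδ _ (hy j)
      refine ⟨?_, hy j⟩
      refine SimpleGraph.Reachable.symm (levelGraph_adj.2 ?_).reachable
      have := hr _ (hy j)
      rw [dist_comm] at this
      exact this.trans_le (by linarith)
  intro v w
  exact (hto v).1.trans ((hconst _ (hto v).2 _ (hto w).2).trans (hto w).1.symm)

/-! ### Torus and cube -/

lemma FlatTorus.dist_mk_le (x y : EuclideanSpace ℝ (Fin d)) :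
    dist (FlatTorus.mk x) (FlatTorus.mk y) ≤ dist x y := by
  rw [FlatTorus.dist_mk]
  refine (ciInf_le ⟨0, ?_⟩ (0 : Fin d → ℤ)).trans (le_of_eq ?_)
  · rintro _ ⟨z, rfl⟩
    exact norm_nonneg _
  · rw [dist_eq_norm]
    congr 1
    ext i
    simp

/-- Two points of the cube whose distance is shortened by wrapping around the torus lie close to
the boundary of the cube. -/
lemma mem_strip_of_dist_mk_lt {u : ℝ} {x y : EuclideanSpace ℝ (Fin d)}
    (hx : x ∈ hcube d) (hy : y ∈ hcube d) (h : dist (FlatTorus.mk x) (FlatTorus.mk y) < u)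
    (h' : ¬ dist x y < u) : x ∈ strip d u := by
  rw [FlatTorus.dist_mk] at h
  obtain ⟨z, hz⟩ := exists_lt_of_ciInf_lt h
  have hz0 : z ≠ 0 := by
    rintro rfl
    apply h'
    have h0 : x - y = x - y + WithLp.toLp 2 (fun i => (((0 : Fin d → ℤ) i : ℤ) : ℝ)) := by
      ext i
      simp
    rw [dist_eq_norm, h0]
    exact hz
  obtain ⟨i, hi⟩ := Function.ne_iff.1 hz0
  have h1 := (PiLp.norm_apply_le _ i).trans_lt hz
  simp only [PiLp.add_apply, PiLp.sub_apply, Real.norm_eq_abs] at h1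
  have h2 := abs_lt.1 h1
  obtain ⟨hx0, hx1⟩ := hx i
  obtain ⟨hy0, hy1⟩ := hy i
  refine ⟨i, ?_⟩
  rcases lt_or_gt_of_ne hi with hneg | hpos
  · right
    have : (z i : ℝ) ≤ -1 := by
      exact_mod_cast (by have : z i < 0 := hneg; omega : z i ≤ -1)
    linarith
  · left
    have : (1 : ℝ) ≤ z i := by
      exact_mod_cast (by have : 0 < z i := hpos; omega : 1 ≤ z i)
    linarith

lemma levelGraph_le_torus (u : ℝ) (x : A → EuclideanSpace ℝ (Fin d))
    (y : B → EuclideanSpace ℝ (Fin d)) :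
    levelGraph u x y ≤
      levelGraph u (fun i => FlatTorus.mk (x i)) (fun j => FlatTorus.mk (y j)) := by
  rintro (i | i) (j | j) h
  · exact absurd h.1 (by simp)
  · rw [levelGraph_adj] at h ⊢
    exact (FlatTorus.dist_mk_le _ _).trans_lt h
  · rw [SimpleGraph.adj_comm, levelGraph_adj] at h ⊢
    exact (FlatTorus.dist_mk_le _ _).trans_lt h
  · exact absurd h.1 (by simp)

lemma numComp_cube_le_torus [Finite A] [Finite B] {u : ℝ}
    {x : A → EuclideanSpace ℝ (Fin d)} {y : B → EuclideanSpace ℝ (Fin d)}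
    (hx : ∀ i, x i ∈ hcube d) (hy : ∀ j, y j ∈ hcube d) :
    (levelGraph u x y).numComp ≤
      (levelGraph u (fun i => FlatTorus.mk (x i)) (fun j => FlatTorus.mk (y j))).numComp +
        (touching u (strip d u) x y).ncard := by
  refine SimpleGraph.numComp_le_add_touching (levelGraph_le_torus u x y) _ ?_
  rintro (i | i) (j | j) h h'
  · exact absurd h.1 (by simp)
  · rw [levelGraph_adj] at h h'
    exact mem_strip_of_dist_mk_lt (hx i) (hy j) h h'
  · rw [SimpleGraph.adj_comm, levelGraph_adj, dist_comm] at h h'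
    exact mem_strip_of_dist_mk_lt (hy i) (hx j) h h'
  · exact absurd h.1 (by simp)

end Cube

/-! ### Expected numbers of components -/

/-- A function of a random graph on finitely many vertices is measurable when the edges are. -/
lemma measurable_comp_simpleGraph {Ω V β : Type*} [MeasurableSpace Ω] [MeasurableSpace β] [Finite V]
    {G : Ω → SimpleGraph V} (hG : ∀ v w, MeasurableSet {ω | (G ω).Adj v w})
    (F : SimpleGraph V → β) : Measurable fun ω => F (G ω) := by
  let _ : MeasurableSpace (SimpleGraph V) := ⊤
  have hF : Measurable F := measurable_from_top
  refine hF.comp (measurable_to_countable' fun H => ?_)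
  have : G ⁻¹' {H} = ⋂ v, ⋂ w, {ω | (G ω).Adj v w ↔ H.Adj v w} := by
    ext ω
    simp [SimpleGraph.ext_iff, funext_iff]
  rw [this]
  refine MeasurableSet.iInter fun v => MeasurableSet.iInter fun w => ?_
  by_cases h : H.Adj v w
  · simpa [h] using hG v w
  · simp only [h, iff_false]
    exact (hG v w).compl

lemma measurable_comp_levelGraph {Ω A B M β : Type*} [MeasurableSpace Ω] [MeasurableSpace β]
    [Finite A] [Finite B] [PseudoMetricSpace M] {u : Ω → ℝ} (hu : Measurable u) {x : Ω → A → M}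
    {y : Ω → B → M} (hxy : ∀ i j, Measurable fun ω => dist (x ω i) (y ω j))
    (F : SimpleGraph (A ⊕ B) → β) : Measurable fun ω => F (levelGraph (u ω) (x ω) (y ω)) := by
  refine measurable_comp_simpleGraph ?_ F
  rintro (i | i) (j | j)
  · simp [levelGraph]
  · simp_rw [levelGraph_adj]
    exact measurableSet_lt (hxy i j) hu
  · simp_rw [SimpleGraph.adj_comm _ (Sum.inr i), levelGraph_adj]
    exact measurableSet_lt (hxy j i) hu
  · simp [levelGraph]

section Expectation

variable {d : ℕ}

/-- The uniform distribution on the unit cube. -/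
noncomputable def unif (d : ℕ) : Measure (EuclideanSpace ℝ (Fin d)) := volume.restrict (hcube d)

instance : IsProbabilityMeasure (unif d) := ⟨by simp [unif, volume_hcube]⟩

lemma unif_apply {s : Set (EuclideanSpace ℝ (Fin d))} (hs : MeasurableSet s) :
    unif d s = volume (s ∩ hcube d) := Measure.restrict_apply hs

/-- The joint law of `a` red and `b` blue independent uniform points. -/
noncomputable def sampleLaw (d a b : ℕ) :
    Measure ((Fin a → EuclideanSpace ℝ (Fin d)) × (Fin b → EuclideanSpace ℝ (Fin d))) :=
  (Measure.pi fun _ => unif d).prod (Measure.pi fun _ => unif d)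

instance (a b : ℕ) : IsProbabilityMeasure (sampleLaw d a b) := by
  unfold sampleLaw; infer_instance

lemma IsUniformSample.map_eq {a b : ℕ} {Ω : Type*} [MeasurableSpace Ω] {P : Measure Ω}
    [IsProbabilityMeasure P] {X : Fin a → Ω → EuclideanSpace ℝ (Fin d)}
    {Y : Fin b → Ω → EuclideanSpace ℝ (Fin d)} (h : IsUniformSample P X Y) :
    P.map (fun ω => ((fun i => X i ω), fun j => Y j ω)) = sampleLaw d a b := by
  have hmeas : ∀ v, Measurable ((Sum.elim X Y : Fin a ⊕ Fin b → _) v) := by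
    rintro (i | j)
    exacts [h.measurable_red i, h.measurable_blue j]
  have hlaw : ∀ v, P.map ((Sum.elim X Y : Fin a ⊕ Fin b → _) v) = unif d := by
    have hc : ProbabilityTheory.cond volume (unitCube d) = unif d := by
      rw [ProbabilityTheory.cond, volume_unitCube, inv_one, one_smul, unif,
        Measure.restrict_congr_set hcube_ae_eq_unitCube]
    rintro (i | j)
    · exact Eq.trans (h.uniform_red i) hc
    · exact Eq.trans (h.uniform_blue j) hc
  have h1 := (iIndepFun_iff_map_fun_eq_pi_map fun v => (hmeas v).aemeasurable).1 h.indep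
  simp_rw [hlaw] at h1
  have h2 := (measurePreserving_sumPiEquivProdPi
    (fun _ : Fin a ⊕ Fin b => unif d)).map_eq
  rw [← h1, Measure.map_map (MeasurableEquiv.measurable _) (by fun_prop)] at h2
  exact h2

lemma IsUniformSample.lintegral_eq {a b : ℕ} {Ω : Type*} [MeasurableSpace Ω] {P : Measure Ω}
    [IsProbabilityMeasure P] {X : Fin a → Ω → EuclideanSpace ℝ (Fin d)}
    {Y : Fin b → Ω → EuclideanSpace ℝ (Fin d)} (h : IsUniformSample P X Y)
    {f : (Fin a → EuclideanSpace ℝ (Fin d)) × (Fin b → EuclideanSpace ℝ (Fin d)) → ℝ≥0∞}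
    (hf : Measurable f) :
    ∫⁻ ω, f ((fun i => X i ω), fun j => Y j ω) ∂P = ∫⁻ z, f z ∂sampleLaw d a b := by
  rw [← h.map_eq, lintegral_map hf]
  have := h.measurable_red
  have := h.measurable_blue
  fun_prop

/-- The expected number of components of the level graph of a sample in the cube, minus one. -/
noncomputable def cubeExcess (d a b : ℕ) (u : ℝ) : ℝ≥0∞ :=
  ∫⁻ z, (levelComp u z.1 z.2 - 1) ∂sampleLaw d a b

/-- The expected number of components of the level graph of a sample in the torus, minus one. -/
noncomputable def torusExcess (d a b : ℕ) (u : ℝ) : ℝ≥0∞ :=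
  ∫⁻ z, (levelComp u (fun i => FlatTorus.mk (z.1 i)) (fun j => FlatTorus.mk (z.2 j)) - 1)
    ∂sampleLaw d a b

lemma continuous_flatTorus_mk : Continuous (FlatTorus.mk (d := d)) :=
  (LipschitzWith.mk_one FlatTorus.dist_mk_le).continuous

lemma measurable_dist_comp {Ω M : Type*} [MeasurableSpace Ω] [PseudoMetricSpace M]
    {φ : EuclideanSpace ℝ (Fin d) → M} (hφ : Continuous φ) {f g : Ω → EuclideanSpace ℝ (Fin d)}
    (hf : Measurable f) (hg : Measurable g) : Measurable fun ω => dist (φ (f ω)) (φ (g ω)) := by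
  have hc : Continuous fun z : EuclideanSpace ℝ (Fin d) × EuclideanSpace ℝ (Fin d) =>
      dist (φ z.1) (φ z.2) := (hφ.comp continuous_fst).dist (hφ.comp continuous_snd)
  exact hc.measurable.comp (hf.prodMk hg)

lemma measurable_levelComp {Ω : Type*} [MeasurableSpace Ω] {a b : ℕ} {u : Ω → ℝ} (hu : Measurable u)
    {x : Ω → Fin a → EuclideanSpace ℝ (Fin d)} {y : Ω → Fin b → EuclideanSpace ℝ (Fin d)}
    (hx : Measurable x) (hy : Measurable y) : Measurable fun ω => levelComp (u ω) (x ω) (y ω) :=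
  measurable_comp_levelGraph hu (fun i j => by fun_prop) fun G => (G.numComp : ℝ≥0∞)

lemma measurable_levelComp_mk {Ω : Type*} [MeasurableSpace Ω] {a b : ℕ} {u : Ω → ℝ}
    (hu : Measurable u) {x : Ω → Fin a → EuclideanSpace ℝ (Fin d)}
    {y : Ω → Fin b → EuclideanSpace ℝ (Fin d)} (hx : Measurable x) (hy : Measurable y) :
    Measurable fun ω => levelComp (u ω) (fun i => FlatTorus.mk (x ω i))
      (fun j => FlatTorus.mk (y ω j)) :=
  measurable_comp_levelGraph hu
    (fun i j => measurable_dist_comp continuous_flatTorus_mk (by fun_prop) (by fun_prop))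
    fun G => (G.numComp : ℝ≥0∞)

lemma measurable_cubeExcess (d a b : ℕ) : Measurable (cubeExcess d a b) := by
  unfold cubeExcess
  refine Measurable.lintegral_prod_right'
    (f := fun q : ℝ × ((Fin a → EuclideanSpace ℝ (Fin d)) × (Fin b → EuclideanSpace ℝ (Fin d))) =>
      levelComp q.1 q.2.1 q.2.2 - 1) ?_
  exact (measurable_levelComp (by fun_prop) (by fun_prop) (by fun_prop)).sub measurable_const

/-- The expected cost depends on the sample only through the expected numbers of components. -/
lemma expectedCubeCost_eq_lintegral {a b : ℕ} (ha : 0 < a) (hb : 0 < b) {Ω : Type*}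
    [MeasurableSpace Ω] {P : Measure Ω} [IsProbabilityMeasure P]
    {X : Fin a → Ω → EuclideanSpace ℝ (Fin d)} {Y : Fin b → Ω → EuclideanSpace ℝ (Fin d)}
    (h : IsUniformSample P X Y) {p : ℝ} (hp : 0 < p) :
    expectedCubeCost P p X Y = ∫⁻ u in Set.Ioi (0 : ℝ), ENNReal.ofReal (p * u ^ (p - 1)) *
        cubeExcess d a b u := by
  have hm : Measurable fun q : ((Fin a → EuclideanSpace ℝ (Fin d)) ×
      (Fin b → EuclideanSpace ℝ (Fin d))) × ℝ =>
      ENNReal.ofReal (p * q.2 ^ (p - 1)) * (levelComp q.2 q.1.1 q.1.2 - 1) :=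
    Measurable.mul (by fun_prop)
      ((measurable_levelComp (by fun_prop) (by fun_prop) (by fun_prop)).sub measurable_const)
  unfold expectedCubeCost
  simp_rw [bipartiteMSTCost_eq_lintegral ha hb hp]
  rw [h.lintegral_eq (f := fun z => ∫⁻ u in Set.Ioi (0 : ℝ), ENNReal.ofReal (p * u ^ (p - 1)) *
        (levelComp u z.1 z.2 - 1)) hm.lintegral_prod_right',
    lintegral_lintegral_swap hm.aemeasurable]
  refine lintegral_congr fun u => ?_
  rw [lintegral_const_mul]
  · rfl
  · exact (measurable_levelComp (by fun_prop) (by fun_prop) (by fun_prop)).sub measurable_const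

lemma expectedTorusCost_eq_lintegral {a b : ℕ} (ha : 0 < a) (hb : 0 < b) {Ω : Type*}
    [MeasurableSpace Ω] {P : Measure Ω} [IsProbabilityMeasure P]
    {X : Fin a → Ω → EuclideanSpace ℝ (Fin d)} {Y : Fin b → Ω → EuclideanSpace ℝ (Fin d)}
    (h : IsUniformSample P X Y) {p : ℝ} (hp : 0 < p) :
    expectedTorusCost P p X Y = ∫⁻ u in Set.Ioi (0 : ℝ), ENNReal.ofReal (p * u ^ (p - 1)) *
        torusExcess d a b u := by
  have hm : Measurable fun q : ((Fin a → EuclideanSpace ℝ (Fin d)) ×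
      (Fin b → EuclideanSpace ℝ (Fin d))) × ℝ =>
      ENNReal.ofReal (p * q.2 ^ (p - 1)) * (levelComp q.2 (fun i => FlatTorus.mk (q.1.1 i))
        (fun j => FlatTorus.mk (q.1.2 j)) - 1) :=
    Measurable.mul (by fun_prop)
      ((measurable_levelComp_mk (by fun_prop) (by fun_prop) (by fun_prop)).sub measurable_const)
  unfold expectedTorusCost
  simp_rw [bipartiteMSTCost_eq_lintegral ha hb hp]
  rw [h.lintegral_eq (f := fun z => ∫⁻ u in Set.Ioi (0 : ℝ), ENNReal.ofReal (p * u ^ (p - 1)) *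
        (levelComp u (fun i => FlatTorus.mk (z.1 i)) (fun j => FlatTorus.mk (z.2 j)) - 1))
        hm.lintegral_prod_right',
    lintegral_lintegral_swap hm.aemeasurable]
  refine lintegral_congr fun u => ?_
  rw [lintegral_const_mul]
  · rfl
  · exact (measurable_levelComp_mk (by fun_prop) (by fun_prop) (by fun_prop)).sub measurable_const

lemma torusExcess_le_cubeExcess (d a b : ℕ) (u : ℝ) : torusExcess d a b u ≤ cubeExcess d a b u := by
  refine lintegral_mono fun z => tsub_le_tsub_right ?_ 1
  unfold levelComp
  exact_mod_cast SimpleGraph.numComp_anti (levelGraph_le_torus u z.1 z.2)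

lemma levelGraph_mono {A B M : Type*} [PseudoMetricSpace M] {u u' : ℝ} (h : u ≤ u') (x : A → M)
    (y : B → M) : levelGraph u x y ≤ levelGraph u' x y := fun _ _ hvw => ⟨hvw.1, hvw.2.trans_le h⟩

lemma cubeExcess_anti (d a b : ℕ) : Antitone (cubeExcess d a b) := by
  intro u u' h
  refine lintegral_mono fun z => tsub_le_tsub_right ?_ 1
  unfold levelComp
  exact_mod_cast SimpleGraph.numComp_anti (levelGraph_mono h z.1 z.2)

lemma cubeExcess_le_card (d a b : ℕ) (u : ℝ) : cubeExcess d a b u ≤ (a + b : ℕ) := by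
  refine (lintegral_mono (g := fun _ => ((a + b : ℕ) : ℝ≥0∞)) fun z => ?_).trans (by simp)
  refine tsub_le_self.trans ?_
  have := (levelGraph u z.1 z.2).numComp_le_card
  rw [Nat.card_sum, Nat.card_fin, Nat.card_fin] at this
  unfold levelComp
  beta_reduce
  exact_mod_cast this

lemma ae_mem_hcube_pi (a : ℕ) :
    ∀ᵐ x ∂(Measure.pi fun _ : Fin a => unif d), ∀ i, x i ∈ hcube d := by
  rw [ae_all_iff]
  intro i
  exact (measurePreserving_eval (fun _ : Fin a => unif d) i).quasiMeasurePreserving.ae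
    (ae_restrict_mem measurableSet_hcube)

lemma ae_mem_hcube (a b : ℕ) : ∀ᵐ z ∂sampleLaw d a b, (∀ i, z.1 i ∈ hcube d) ∧
    ∀ j, z.2 j ∈ hcube d :=
  (Measure.quasiMeasurePreserving_fst.ae (ae_mem_hcube_pi a)).and
    (Measure.quasiMeasurePreserving_snd.ae (ae_mem_hcube_pi b))

lemma lintegral_pi_eval (a : ℕ) (i : Fin a) {f : EuclideanSpace ℝ (Fin d) → ℝ≥0∞}
    (hf : Measurable f) :
    ∫⁻ x, f (x i) ∂(Measure.pi fun _ : Fin a => unif d) = ∫⁻ x, f x ∂unif d :=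
  (measurePreserving_eval (fun _ : Fin a => unif d) i).lintegral_comp hf

lemma unif_gridCell_ne {m : ℕ} (hm : 0 < m) {x : EuclideanSpace ℝ (Fin d)} (hx : x ∈ hcube d) :
    unif d {y | gridCell m y ≠ gridCell m x} = 1 - ((m : ℝ≥0∞) ^ d)⁻¹ := by
  have hms : MeasurableSet {y : EuclideanSpace ℝ (Fin d) | gridCell m y = gridCell m x} :=
    measurable_gridCell m (measurableSet_singleton _)
  have h1 : {y : EuclideanSpace ℝ (Fin d) | gridCell m y ≠ gridCell m x} =
    {y | gridCell m y = gridCell m x}ᶜ := rfl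
  rw [h1, prob_compl_eq_one_sub hms, unif_apply hms, Set.inter_eq_left.2, volume_gridCell_eq hm]
  exact fun y hy => gridCell_eq_subset_hcube hm hx hy

lemma pi_gridCell_ne {m : ℕ} (hm : 0 < m) {x : EuclideanSpace ℝ (Fin d)} (hx : x ∈ hcube d)
    (b : ℕ) : (Measure.pi fun _ : Fin b => unif d) {y | ∀ j, gridCell m (y j) ≠ gridCell m x} =
      (1 - ((m : ℝ≥0∞) ^ d)⁻¹) ^ b := by
  have h1 : {y : Fin b → EuclideanSpace ℝ (Fin d) | ∀ j, gridCell m (y j) ≠ gridCell m x} =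
    Set.univ.pi fun _ => {y | gridCell m y ≠ gridCell m x} := by ext; simp
  rw [h1, Measure.pi_pi]
  simp [unif_gridCell_ne hm hx]

lemma measurableSet_lonely (m : ℕ) {S : Set (EuclideanSpace ℝ (Fin d))} (hS : MeasurableSet S)
    {a b : ℕ} (i : Fin a) : MeasurableSet {z : (Fin a → EuclideanSpace ℝ (Fin d)) ×
      (Fin b → EuclideanSpace ℝ (Fin d)) |
      z.1 i ∈ S ∧ ∀ j, gridCell m (z.2 j) ≠ gridCell m (z.1 i)} := by
  have h1 : Measurable fun z : (Fin a → EuclideanSpace ℝ (Fin d)) ×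
    (Fin b → EuclideanSpace ℝ (Fin d)) => z.1 i := by fun_prop
  have h2 : ∀ j, Measurable fun z : (Fin a → EuclideanSpace ℝ (Fin d)) ×
    (Fin b → EuclideanSpace ℝ (Fin d)) => z.2 j := by fun_prop
  refine (h1 hS).inter ?_
  have : {z : (Fin a → EuclideanSpace ℝ (Fin d)) × (Fin b → EuclideanSpace ℝ (Fin d)) |
      ∀ j, gridCell m (z.2 j) ≠ gridCell m (z.1 i)} =
      ⋂ j, {z | gridCell m (z.2 j) = gridCell m (z.1 i)}ᶜ := by ext; simp
  refine (congrArg MeasurableSet this).mpr (MeasurableSet.iInter fun j => ?_)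
  exact (measurableSet_eq_fun ((measurable_gridCell m).comp (h2 j))
    ((measurable_gridCell m).comp h1)).compl

lemma ncard_lonely_eq_sum (m : ℕ) (S : Set (EuclideanSpace ℝ (Fin d))) {a b : ℕ}
    (z : (Fin a → EuclideanSpace ℝ (Fin d)) × (Fin b → EuclideanSpace ℝ (Fin d))) :
    ((lonely m S z.1 z.2).ncard : ℝ≥0∞) = ∑ i, Set.indicator
      {z | z.1 i ∈ S ∧ ∀ j, gridCell m (z.2 j) ≠ gridCell m (z.1 i)} 1 z := by
  classical
  simp only [Set.indicator_apply, Set.mem_ofPred_eq, Pi.one_apply, Finset.sum_boole]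
  rw [← Set.ncard_coe_finset]
  simp [lonely]

lemma lintegral_ncard_lonely {m : ℕ} (hm : 0 < m) {S : Set (EuclideanSpace ℝ (Fin d))}
    (hS : MeasurableSet S) (a b : ℕ) :
    ∫⁻ z, ((lonely m S z.1 z.2).ncard : ℝ≥0∞) ∂sampleLaw d a b =
      a * (volume (S ∩ hcube d) * (1 - ((m : ℝ≥0∞) ^ d)⁻¹) ^ b) := by
  have hset := fun i : Fin a => measurableSet_lonely m hS (b := b) i
  simp_rw [ncard_lonely_eq_sum]
  rw [lintegral_finsetSum _ fun i _ => measurable_one.indicator (hset i)]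
  have hterm : ∀ i : Fin a, ∫⁻ z, Set.indicator
        {z | z.1 i ∈ S ∧ ∀ j, gridCell m (z.2 j) ≠ gridCell m (z.1 i)} 1 z ∂sampleLaw d a b =
      volume (S ∩ hcube d) * (1 - ((m : ℝ≥0∞) ^ d)⁻¹) ^ b := by
    intro i
    rw [lintegral_indicator_one (hset i), sampleLaw, Measure.prod_apply (hset i)]
    calc _ = ∫⁻ x, S.indicator (fun _ => (1 - ((m : ℝ≥0∞) ^ d)⁻¹) ^ b) (x i)
          ∂(Measure.pi fun _ : Fin a => unif d) := by
          refine lintegral_congr_ae ?_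
          filter_upwards [ae_mem_hcube_pi a] with x hx
          by_cases h : x i ∈ S
          · simp only [Set.preimage_ofPred_eq, h, true_and, Set.indicator_of_mem]
            exact pi_gridCell_ne hm (hx i) b
          · simp [h]
      _ = _ := by
          rw [lintegral_pi_eval a i (measurable_const.indicator hS), lintegral_indicator_const hS,
            unif_apply hS, mul_comm]
  simp [hterm]

lemma sampleLaw_swap (d a b : ℕ) : (sampleLaw d a b).map Prod.swap = sampleLaw d b a :=
  Measure.prod_swap

lemma lintegral_sampleLaw_swap (a b : ℕ) (f : (Fin b → EuclideanSpace ℝ (Fin d)) ×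
    (Fin a → EuclideanSpace ℝ (Fin d)) → ℝ≥0∞) :
    ∫⁻ z, f z.swap ∂sampleLaw d a b = ∫⁻ z, f z ∂sampleLaw d b a := by
  rw [← sampleLaw_swap d a b]
  exact (lintegral_map_equiv f MeasurableEquiv.prodComm).symm

/-- `a * (1 - 1/M) ^ b ≤ M * (a / b)`, because `t * exp (-t) ≤ 1`. -/
lemma mul_one_sub_inv_pow_le {M c : ℝ} (hM : 1 ≤ M) (hc : 0 < c) {a b : ℕ} (hab : c * a ≤ b) :
    (a : ℝ≥0∞) * (1 - (ENNReal.ofReal M)⁻¹) ^ b ≤ ENNReal.ofReal (M / c) := by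
  have hM0 : 0 < M := by linarith
  rw [← ENNReal.ofReal_inv_of_pos hM0, ← ENNReal.ofReal_one,
    ← ENNReal.ofReal_sub _ (by positivity), ← ENNReal.ofReal_natCast a,
    ← ENNReal.ofReal_pow (sub_nonneg.2 (inv_le_one_of_one_le₀ hM)),
    ← ENNReal.ofReal_mul (by positivity)]
  refine ENNReal.ofReal_le_ofReal ?_
  have h1 : (1 - M⁻¹) ^ b ≤ Real.exp (-(b * M⁻¹)) := by
    rw [← mul_neg, Real.exp_nat_mul]
    exact pow_le_pow_left₀ (sub_nonneg.2 (inv_le_one_of_one_le₀ hM))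
      (by linarith [Real.add_one_le_exp (-M⁻¹)]) b
  have h2 : b * M⁻¹ * Real.exp (-(b * M⁻¹)) ≤ 1 := by
    rw [Real.exp_neg, ← div_eq_mul_inv, div_le_one (Real.exp_pos _)]
    linarith [Real.add_one_le_exp (b * M⁻¹)]
  rw [le_div_iff₀ hc]
  calc (a : ℝ) * (1 - M⁻¹) ^ b * c = c * a * (1 - M⁻¹) ^ b := by ring
    _ ≤ b * Real.exp (-(b * M⁻¹)) := by
        gcongr
        exact pow_nonneg (sub_nonneg.2 (inv_le_one_of_one_le₀ hM)) b
    _ = M * (b * M⁻¹ * Real.exp (-(b * M⁻¹))) := by field_simp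
    _ ≤ M * 1 := by gcongr
    _ = M := mul_one M

/-- The expected number of components touching `S`, where `S'` contains all cells meeting `S`. -/
lemma lintegral_touching_le {m : ℕ} (hm : 0 < m) {u : ℝ} (hmu : √d / m < u)
    {S S' : Set (EuclideanSpace ℝ (Fin d))} (hS : MeasurableSet S)
    (hSS : ∀ x ∈ S ∩ hcube d, ∀ y, gridCell m y = gridCell m x → y ∈ S') {c : ℝ} (hc : 0 < c)
    {a b : ℕ} (hab : c * a ≤ b) (hba : c * b ≤ a) :
    ∫⁻ z, ((touching u S z.1 z.2).ncard : ℝ≥0∞) ∂sampleLaw d a b ≤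
      ENNReal.ofReal ((m : ℝ) ^ d) * volume (S' ∩ hcube d) +
        2 * (volume (S ∩ hcube d) * ENNReal.ofReal ((m : ℝ) ^ d / c)) := by
  have hM : (1 : ℝ) ≤ (m : ℝ) ^ d := one_le_pow₀ (by exact_mod_cast hm)
  have hMe : ENNReal.ofReal ((m : ℝ) ^ d) = (m : ℝ≥0∞) ^ d := by
    rw [ENNReal.ofReal_pow (by positivity), ENNReal.ofReal_natCast]
  have hmeas : Measurable fun z : (Fin a → EuclideanSpace ℝ (Fin d)) ×
      (Fin b → EuclideanSpace ℝ (Fin d)) => ((lonely m S z.1 z.2).ncard : ℝ≥0∞) := by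
    simp_rw [ncard_lonely_eq_sum]
    exact Finset.measurable_sum _ fun i _ => measurable_one.indicator (measurableSet_lonely m hS i)
  calc _ ≤ ∫⁻ z, (((gridCell m '' (S ∩ hcube d)).ncard : ℝ≥0∞) +
        (((lonely m S z.1 z.2).ncard : ℝ≥0∞) + (lonely m S z.2 z.1).ncard)) ∂sampleLaw d a b := by
        refine lintegral_mono_ae ?_
        filter_upwards [ae_mem_hcube a b] with z hz
        exact_mod_cast ncard_touching_le_cells hm hmu S hz.1 hz.2
    _ = (gridCell m '' (S ∩ hcube d)).ncard +
        (a * (volume (S ∩ hcube d) * (1 - ((m : ℝ≥0∞) ^ d)⁻¹) ^ b) +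
          b * (volume (S ∩ hcube d) * (1 - ((m : ℝ≥0∞) ^ d)⁻¹) ^ a)) := by
        rw [lintegral_add_left measurable_const, lintegral_add_left hmeas,
          lintegral_ncard_lonely hm hS, ← lintegral_ncard_lonely hm hS b a,
          ← lintegral_sampleLaw_swap a b]
        simp
    _ ≤ _ := by
        refine add_le_add ?_ ?_
        · rw [hMe]
          exact ncard_gridCell_image_le hm hSS
        · rw [two_mul, ← hMe, mul_left_comm, mul_left_comm (b : ℝ≥0∞)]
          gcongr
          · exact mul_one_sub_inv_pow_le hM hc hab
          · exact mul_one_sub_inv_pow_le hM hc hba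

end Expectation

/-! ### Bounds at small, intermediate and large distances -/

section ExcessBounds

variable {d : ℕ}

/-- A grid fine enough for cells to have diameter less than `u / k`, but not finer than needed. -/
lemma exists_grid {k : ℕ} {u : ℝ} (hd : 1 ≤ d) (hk : 1 ≤ k) (hu : 0 < u) (hud : u ≤ √d) :
    ∃ m : ℕ, 0 < m ∧ √d / m < u / k ∧ (m : ℝ) ^ d ≤ ((k + 1) * √d) ^ d * (u ^ d)⁻¹ := by
  have hk0 : (0 : ℝ) < k := by exact_mod_cast hk
  have hd0 : 0 < √(d : ℝ) := Real.sqrt_pos.2 (by exact_mod_cast hd)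
  have hm : (0 : ℝ) < (⌊k * √d / u⌋₊ + 1 : ℕ) := by positivity
  refine ⟨⌊k * √d / u⌋₊ + 1, by positivity, ?_, ?_⟩
  · have h1 := Nat.lt_floor_add_one (k * √d / u)
    rw [div_lt_div_iff₀ hm hk0]
    rw [div_lt_iff₀ hu] at h1
    push_cast
    linarith
  · rw [← inv_pow, ← mul_pow]
    refine pow_le_pow_left₀ hm.le ?_ d
    have h1 : (⌊k * √d / u⌋₊ : ℝ) ≤ k * √d / u := Nat.floor_le (by positivity)
    have h2 : 1 ≤ √d / u := (one_le_div hu).2 hud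
    push_cast
    calc (⌊k * √d / u⌋₊ : ℝ) + 1 ≤ k * √d / u + √d / u := by linarith
      _ = _ := by rw [add_mul, add_mul, div_eq_mul_inv, div_eq_mul_inv]; ring

lemma dist_le_sqrt_of_mem_hcube {x y : EuclideanSpace ℝ (Fin d)} (hx : x ∈ hcube d)
    (hy : y ∈ hcube d) : dist x y ≤ √d := by
  have := dist_le_of_coord_le (x := x) (y := y) zero_le_one fun i => by
    obtain ⟨h1, h2⟩ := hx i
    obtain ⟨h3, h4⟩ := hy i
    rw [abs_le]
    constructor <;> linarith
  rwa [mul_one] at this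

lemma levelComp_sub_one_eq_zero {u : ℝ} {A B M : Type*} [PseudoMetricSpace M] {x : A → M}
    {y : B → M} (h : (levelGraph u x y).Preconnected) : levelComp u x y - 1 = 0 := by
  rw [tsub_eq_zero_iff_le]
  unfold levelComp
  exact_mod_cast h.numComp_le_one

/-- Beyond the diameter of the cube the level graph is complete bipartite. -/
lemma cubeExcess_eq_zero {a b : ℕ} (ha : 0 < a) (hb : 0 < b) {u : ℝ} (hu : √d < u) :
    cubeExcess d a b u = 0 := by
  unfold cubeExcess
  rw [← lintegral_zero (μ := sampleLaw d a b)]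
  refine lintegral_congr_ae ?_
  filter_upwards [ae_mem_hcube a b] with z hz
  refine levelComp_sub_one_eq_zero
    ((connected_completeBipartiteGraph ha hb).preconnected.mono ?_)
  rintro (i | i) (j | j) h
  · simp at h
  · exact ⟨h, (dist_le_sqrt_of_mem_hcube (hz.1 i) (hz.2 j)).trans_lt hu⟩
  · exact ⟨h, (dist_le_sqrt_of_mem_hcube (hz.2 i) (hz.1 j)).trans_lt hu⟩
  · simp at h

/-- A bound independent of the number of points, by the number of grid cells of side comparable
to `u`; the points whose cell has only their own colour are also at most that many on average, up to
a factor depending on the ratio of the colours. -/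
lemma cubeExcess_le_inv_pow (hd : 1 ≤ d) {a b : ℕ} (ha : 0 < a) (hb : 0 < b) {c : ℝ} (hc : 0 < c)
    (hab : c * a ≤ b) (hba : c * b ≤ a) {u : ℝ} (hu : 0 < u) :
    cubeExcess d a b u ≤ ENNReal.ofReal ((2 * √d) ^ d * (u ^ d)⁻¹ * (1 + 2 / c)) := by
  rcases lt_or_ge √d u with h | h
  · rw [cubeExcess_eq_zero ha hb h]
    exact zero_le
  · obtain ⟨m, hm, hmu, hmd⟩ := exists_grid hd le_rfl hu h
    rw [Nat.cast_one, div_one] at hmu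
    norm_num at hmd
    have h1 := lintegral_touching_le hm hmu MeasurableSet.univ (S' := Set.univ)
      (fun _ _ _ _ => trivial) hc hab hba
    rw [Set.univ_inter, volume_hcube, mul_one, one_mul] at h1
    calc cubeExcess d a b u ≤
        ∫⁻ z, ((touching u Set.univ z.1 z.2).ncard : ℝ≥0∞) ∂sampleLaw d a b := by
          refine lintegral_mono fun z => tsub_le_self.trans ?_
          rw [← numComp_eq_ncard_touching_univ]
          rfl
      _ ≤ _ := h1
      _ = ENNReal.ofReal ((m : ℝ) ^ d * (1 + 2 / c)) := by
          rw [← ENNReal.ofReal_ofNat, ← ENNReal.ofReal_mul (by positivity),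
            ← ENNReal.ofReal_add (by positivity) (by positivity)]
          congr 1
          ring
      _ ≤ _ := ENNReal.ofReal_le_ofReal (by gcongr)

/-- Passing to the torus merges only components with a point close to the boundary. -/
lemma cubeExcess_le_torusExcess_add (d a b : ℕ) (u : ℝ) :
    cubeExcess d a b u ≤ torusExcess d a b u +
      ∫⁻ z, ((touching u (strip d u) z.1 z.2).ncard : ℝ≥0∞) ∂sampleLaw d a b := by
  unfold cubeExcess torusExcess
  rw [← lintegral_add_left]
  · refine lintegral_mono_ae ?_
    filter_upwards [ae_mem_hcube a b] with z hz
    have h := numComp_cube_le_torus (u := u) hz.1 hz.2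
    refine (tsub_le_tsub_right (c := 1) (b := levelComp u (fun i => FlatTorus.mk (z.1 i))
      (fun j => FlatTorus.mk (z.2 j)) + (touching u (strip d u) z.1 z.2).ncard) ?_).trans ?_
    · unfold levelComp
      exact_mod_cast h
    · exact add_tsub_le_tsub_add
  · exact (measurable_levelComp_mk measurable_const (by fun_prop) (by fun_prop)).sub
      measurable_const

lemma ncard_red_mem_eq_sum (S : Set (EuclideanSpace ℝ (Fin d))) {a b : ℕ}
    (z : (Fin a → EuclideanSpace ℝ (Fin d)) × (Fin b → EuclideanSpace ℝ (Fin d))) :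
    ((Set.ncard {i | z.1 i ∈ S} : ℕ) : ℝ≥0∞) = ∑ i, S.indicator 1 (z.1 i) := by
  classical
  simp only [Set.indicator_apply, Pi.one_apply, Finset.sum_boole]
  rw [← Set.ncard_coe_finset]
  simp

lemma lintegral_ncard_red_mem {S : Set (EuclideanSpace ℝ (Fin d))} (hS : MeasurableSet S)
    (a b : ℕ) : ∫⁻ z, ((Set.ncard {i | z.1 i ∈ S} : ℕ) : ℝ≥0∞) ∂sampleLaw d a b =
      a * volume (S ∩ hcube d) := by
  have hm1 : Measurable (S.indicator (1 : EuclideanSpace ℝ (Fin d) → ℝ≥0∞)) :=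
    measurable_one.indicator hS
  have hmi : ∀ i, Measurable fun z : (Fin a → EuclideanSpace ℝ (Fin d)) ×
      (Fin b → EuclideanSpace ℝ (Fin d)) => S.indicator
      (1 : EuclideanSpace ℝ (Fin d) → ℝ≥0∞) (z.1 i) :=
    fun i => hm1.comp (by fun_prop)
  simp_rw [ncard_red_mem_eq_sum]
  rw [lintegral_finsetSum _ fun i _ => hmi i]
  have : ∀ i : Fin a, ∫⁻ z, S.indicator 1 (z.1 i) ∂sampleLaw d a b = volume (S ∩ hcube d) := by
    intro i
    rw [sampleLaw, lintegral_prod _ (hmi i).aemeasurable]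
    simp only [lintegral_const, measure_univ, mul_one]
    rw [lintegral_pi_eval a i hm1, lintegral_indicator_one hS, unif_apply hS]
  simp [this]

lemma measurable_ncard_red_mem {S : Set (EuclideanSpace ℝ (Fin d))} (hS : MeasurableSet S)
    (a b : ℕ) : Measurable fun z : (Fin a → EuclideanSpace ℝ (Fin d)) ×
      (Fin b → EuclideanSpace ℝ (Fin d)) => ((Set.ncard {i | z.1 i ∈ S} : ℕ) : ℝ≥0∞) := by
  simp_rw [ncard_red_mem_eq_sum]
  exact Finset.measurable_sum _ fun i _ => (measurable_one.indicator hS).comp (by fun_prop)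

/-- Boundary correction by counting the points in the strip; sharp for small `u`. -/
lemma cubeExcess_le_torusExcess_add_points (d a b : ℕ) (u : ℝ) :
    cubeExcess d a b u ≤
      torusExcess d a b u + (a + b : ℕ) * (2 * d * ENNReal.ofReal u) := by
  refine (cubeExcess_le_torusExcess_add d a b u).trans ?_
  gcongr
  have hS := measurableSet_strip (d := d) u
  calc _ ≤ ∫⁻ z, (((Set.ncard {i | z.1 i ∈ strip d u} : ℕ) : ℝ≥0∞) +
        ((Set.ncard {j | z.2 j ∈ strip d u} : ℕ) : ℝ≥0∞)) ∂sampleLaw d a b := by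
        refine lintegral_mono fun z => ?_
        beta_reduce
        exact_mod_cast ncard_touching_le_points u (strip d u) z.1 z.2
    _ = (a + b : ℕ) * volume (strip d u ∩ hcube d) := by
        have h := lintegral_sampleLaw_swap a b
          fun z => ((Set.ncard {j | z.1 j ∈ strip d u} : ℕ) : ℝ≥0∞)
        simp only [Prod.fst_swap] at h
        rw [lintegral_add_left (measurable_ncard_red_mem hS a b), h, lintegral_ncard_red_mem hS,
          lintegral_ncard_red_mem hS]
        push_cast
        ring
    _ ≤ _ := by
        gcongr
        exact volume_strip_le u

/-- Boundary correction by counting cells that meet the strip; sharp for larger `u`. -/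
lemma cubeExcess_le_torusExcess_add_cells (hd : 1 ≤ d) {a b : ℕ} {c : ℝ} (hc : 0 < c)
    (hab : c * a ≤ b) (hba : c * b ≤ a) {u : ℝ} (hu : 0 < u) (hud : u ≤ √d) :
    cubeExcess d a b u ≤ torusExcess d a b u +
      ENNReal.ofReal ((2 * √d) ^ d * (u ^ d)⁻¹ * (4 * d * (1 + 1 / c) * u)) := by
  refine (cubeExcess_le_torusExcess_add d a b u).trans ?_
  gcongr
  obtain ⟨m, hm, hmu, hmd⟩ := exists_grid hd le_rfl hu hud
  rw [Nat.cast_one, div_one] at hmu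
  norm_num at hmd
  have hm' : (0 : ℝ) < m := by exact_mod_cast hm
  have hmu' : 1 / m < u := by
    refine lt_of_le_of_lt ?_ hmu
    gcongr
    exact Real.one_le_sqrt.2 (by exact_mod_cast hd)
  calc _ ≤ _ := lintegral_touching_le hm hmu (measurableSet_strip u) (S' := strip d (2 * u))
        (fun x hx y hxy => mem_strip_of_gridCell_eq hm hmu' hx.1 hxy) hc hab hba
    _ ≤ ENNReal.ofReal ((m : ℝ) ^ d) * (2 * d * ENNReal.ofReal (2 * u)) +
        2 * (2 * d * ENNReal.ofReal u * ENNReal.ofReal ((m : ℝ) ^ d / c)) := by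
        gcongr
        · exact volume_strip_le _
        · exact volume_strip_le _
    _ = ENNReal.ofReal ((m : ℝ) ^ d * (4 * d * (1 + 1 / c) * u)) := by
        rw [← ENNReal.ofReal_ofNat, ← ENNReal.ofReal_natCast d,
          ← ENNReal.ofReal_mul (by positivity), ← ENNReal.ofReal_mul (by positivity),
          ← ENNReal.ofReal_mul (by positivity), ← ENNReal.ofReal_mul (by positivity),
          ← ENNReal.ofReal_mul (by positivity), ← ENNReal.ofReal_mul (by positivity),
          ← ENNReal.ofReal_add (by positivity) (by positivity)]
        congr 1
        field_simp
        ring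
    _ ≤ _ := ENNReal.ofReal_le_ofReal (by gcongr)

lemma one_sub_inv_pow_le_exp {M N : ℝ} (hM : 1 ≤ M) {a : ℕ} (hN : N ≤ a) :
    (1 - (ENNReal.ofReal M)⁻¹) ^ a ≤ ENNReal.ofReal (Real.exp (-(N / M))) := by
  have hM0 : 0 < M := by linarith
  have h0 := sub_nonneg.2 (inv_le_one_of_one_le₀ hM)
  rw [← ENNReal.ofReal_inv_of_pos hM0, ← ENNReal.ofReal_one,
    ← ENNReal.ofReal_sub _ (by positivity), ← ENNReal.ofReal_pow h0]
  refine ENNReal.ofReal_le_ofReal ?_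
  calc (1 - M⁻¹) ^ a ≤ Real.exp (-M⁻¹) ^ a :=
        pow_le_pow_left₀ h0 (by linarith [Real.add_one_le_exp (-M⁻¹)]) a
    _ = Real.exp (-(a / M)) := by rw [← Real.exp_nat_mul]; congr 1; ring
    _ ≤ _ := by gcongr

/-- The level graph is connected with overwhelming probability once all cells of a grid of mesh
comparable to `u` are expected to contain many points. -/
lemma cubeExcess_le_exp (hd : 1 ≤ d) {a b : ℕ} {N : ℝ} (hNa : N ≤ a) (hNb : N ≤ b) (hN : 0 ≤ N)
    {u : ℝ} (hu : 0 < u) (hud : u ≤ √d) :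
    cubeExcess d a b u ≤ ENNReal.ofReal (2 * (a + b) * ((4 * √d) ^ d * (u ^ d)⁻¹) *
      Real.exp (-(N / ((4 * √d) ^ d * (u ^ d)⁻¹)))) := by
  obtain ⟨m, hm, hmu, hmd⟩ := exists_grid (k := 3) hd (by norm_num) hu hud
  norm_num at hmd hmu
  have hM : (1 : ℝ) ≤ (m : ℝ) ^ d := one_le_pow₀ (by exact_mod_cast hm)
  have hMe : (m : ℝ≥0∞) ^ d = ENNReal.ofReal ((m : ℝ) ^ d) := by
    rw [ENNReal.ofReal_pow (by positivity), ENNReal.ofReal_natCast]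
  set F := (finite_gridCell_image hm (Set.univ : Set (EuclideanSpace ℝ (Fin d)))).toFinset with hF
  -- The events that some cell of the cube contains no red (blue) point.
  let badR : Set ((Fin a → EuclideanSpace ℝ (Fin d)) × (Fin b → EuclideanSpace ℝ (Fin d))) :=
    ⋃ c ∈ F, {x | ∀ i, gridCell m (x i) ≠ c} ×ˢ Set.univ
  let badB : Set ((Fin a → EuclideanSpace ℝ (Fin d)) × (Fin b → EuclideanSpace ℝ (Fin d))) :=
    ⋃ c ∈ F, Set.univ ×ˢ {y | ∀ i, gridCell m (y i) ≠ c}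
  have hFcard : (F.card : ℝ≥0∞) ≤ ENNReal.ofReal ((m : ℝ) ^ d) := by
    have := ncard_gridCell_image_le (S := Set.univ) (S' := Set.univ) hm (d := d)
      (fun _ _ _ _ => trivial)
    have hv : volume (Set.univ ∩ hcube d) = 1 := by rw [Set.univ_inter, volume_hcube]
    rwa [Set.ncard_eq_toFinset_card _ (finite_gridCell_image hm _), hv, mul_one, hMe] at this
  have hprob : ∀ (k : ℕ), N ≤ k → ∀ c ∈ F, (Measure.pi fun _ : Fin k => unif d)
      {x | ∀ i, gridCell m (x i) ≠ c} ≤ ENNReal.ofReal (Real.exp (-(N / (m : ℝ) ^ d))) := by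
    intro k hk c hc
    simp only [hF, Set.Finite.mem_toFinset, Set.mem_image] at hc
    obtain ⟨x, hx, rfl⟩ := hc
    rw [pi_gridCell_ne hm hx.2, hMe]
    exact one_sub_inv_pow_le_exp hM hk
  have hsum : ∀ f : (Fin d → ℤ) → Set ((Fin a → EuclideanSpace ℝ (Fin d)) ×
      (Fin b → EuclideanSpace ℝ (Fin d))),
      (∀ c ∈ F, sampleLaw d a b (f c) ≤ ENNReal.ofReal (Real.exp (-(N / (m : ℝ) ^ d)))) →
      sampleLaw d a b (⋃ c ∈ F, f c) ≤
        ENNReal.ofReal ((m : ℝ) ^ d) * ENNReal.ofReal (Real.exp (-(N / (m : ℝ) ^ d))) := by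
    intro f hf
    refine (measure_biUnion_finset_le _ _).trans ((Finset.sum_le_sum hf).trans ?_)
    rw [Finset.sum_const, nsmul_eq_mul]
    gcongr
  have hR : sampleLaw d a b badR ≤
      ENNReal.ofReal ((m : ℝ) ^ d) * ENNReal.ofReal (Real.exp (-(N / (m : ℝ) ^ d))) := by
    refine hsum _ fun c hc => ?_
    rw [sampleLaw, Measure.prod_prod, measure_univ, mul_one]
    exact hprob a hNa c hc
  have hB : sampleLaw d a b badB ≤
      ENNReal.ofReal ((m : ℝ) ^ d) * ENNReal.ofReal (Real.exp (-(N / (m : ℝ) ^ d))) := by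
    refine hsum _ fun c hc => ?_
    rw [sampleLaw, Measure.prod_prod, measure_univ, one_mul]
    exact hprob b hNb c hc
  have hgood : ∀ᵐ z ∂sampleLaw d a b, levelComp u z.1 z.2 - 1 ≤
      (badR ∪ badB).indicator (fun _ => ((a + b : ℕ) : ℝ≥0∞)) z := by
    filter_upwards [ae_mem_hcube a b] with z hz
    by_cases hbad : z ∈ badR ∪ badB
    · rw [Set.indicator_of_mem hbad]
      refine tsub_le_self.trans ?_
      have := (levelGraph u z.1 z.2).numComp_le_card
      rw [Nat.card_sum, Nat.card_fin, Nat.card_fin] at this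
      unfold levelComp
      exact_mod_cast this
    · rw [Set.indicator_of_notMem hbad]
      refine le_of_eq (levelComp_sub_one_eq_zero
        (preconnected_levelGraph_of_dense (δ := u / 3) (by linarith) hz.1 hz.2 ?_ ?_))
      · intro w hw
        by_contra! hcon
        refine hbad (Or.inl (Set.mem_biUnion (x := gridCell m w) ?_ ⟨fun i h => ?_, trivial⟩))
        · simp only [hF, Set.Finite.coe_toFinset]
          exact ⟨w, ⟨trivial, hw⟩, rfl⟩
        · exact absurd ((dist_le_of_gridCell_eq hm h.symm).trans_lt hmu) (not_lt.2 (hcon i))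
      · intro w hw
        by_contra! hcon
        refine hbad (Or.inr (Set.mem_biUnion (x := gridCell m w) ?_ ⟨trivial, fun i h => ?_⟩))
        · simp only [hF, Set.Finite.coe_toFinset]
          exact ⟨w, ⟨trivial, hw⟩, rfl⟩
        · exact absurd ((dist_le_of_gridCell_eq hm h.symm).trans_lt hmu) (not_lt.2 (hcon i))
  calc cubeExcess d a b u ≤ ((a + b : ℕ) : ℝ≥0∞) * sampleLaw d a b (badR ∪ badB) :=
        (lintegral_mono_ae hgood).trans (lintegral_indicator_const_le _ _)
    _ ≤ ((a + b : ℕ) : ℝ≥0∞) *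
        (ENNReal.ofReal ((m : ℝ) ^ d) * ENNReal.ofReal (Real.exp (-(N / (m : ℝ) ^ d))) +
        ENNReal.ofReal ((m : ℝ) ^ d) * ENNReal.ofReal (Real.exp (-(N / (m : ℝ) ^ d)))) := by
        gcongr
        exact (measure_union_le _ _).trans (add_le_add hR hB)
    _ = ENNReal.ofReal (2 * (a + b) * (m : ℝ) ^ d * Real.exp (-(N / (m : ℝ) ^ d))) := by
        rw [← two_mul, ← ENNReal.ofReal_ofNat, ← ENNReal.ofReal_natCast (a + b),
          ← ENNReal.ofReal_mul (by positivity), ← ENNReal.ofReal_mul (by positivity),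
          ← ENNReal.ofReal_mul (by positivity)]
        congr 1
        push_cast
        ring
    _ ≤ _ := ENNReal.ofReal_le_ofReal (by gcongr)

end ExcessBounds

/-! ### Splitting a sample at a prospective component -/

namespace SimpleGraph

variable {V W : Type*}

lemma Reachable.lift_comap {G : SimpleGraph V} {f : W → V}
    (h : ∀ x v, v ∉ Set.range f → ¬ G.Adj (f x) v) {x : W} {v : V} (hv : G.Reachable (f x) v) :
    ∃ y, f y = v ∧ (G.comap f).Reachable x y := by
  rw [reachable_iff_reflTransGen] at hv
  induction hv with
  | refl => exact ⟨x, rfl, Reachable.rfl⟩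
  | @tail v w _ hvw ih =>
    obtain ⟨y, rfl, hy⟩ := ih
    by_cases hw : w ∈ Set.range f
    · obtain ⟨z, rfl⟩ := hw
      exact ⟨z, rfl, hy.trans (Adj.reachable hvw)⟩
    · exact absurd hvw (h y w hw)

/-- A set of vertices is the support of a component if and only if it is connected and has no edge
leaving it. -/
lemma exists_supp_eq_range_iff {G : SimpleGraph V} {f : W → V} (hf : Function.Injective f) :
    (∃ c : G.ConnectedComponent, c.supp = Set.range f) ↔
      (G.comap f).Connected ∧ ∀ x v, v ∉ Set.range f → ¬ G.Adj (f x) v := by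
  constructor
  · rintro ⟨c, hc⟩
    have hno : ∀ x v, v ∉ Set.range f → ¬ G.Adj (f x) v := by
      intro x v hv hadj
      rw [← hc] at hv
      have hx : f x ∈ c.supp := hc ▸ Set.mem_range_self x
      exact hv ((c.mem_supp_congr_adj hadj).1 hx)
    refine ⟨(connected_iff _).2 ⟨fun x y => ?_, ?_⟩, hno⟩
    · have hxy : G.Reachable (f x) (f y) :=
        c.reachable_of_mem_supp (hc ▸ Set.mem_range_self x) (hc ▸ Set.mem_range_self y)
      obtain ⟨z, hz, hr⟩ := hxy.lift_comap hno
      rwa [hf hz] at hr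
    · obtain ⟨v, hv⟩ := c.nonempty_supp
      rw [hc] at hv
      exact ⟨hv.choose⟩
  · rintro ⟨hconn, hno⟩
    obtain ⟨x⟩ := hconn.nonempty
    refine ⟨G.connectedComponentMk (f x), ?_⟩
    ext v
    rw [ConnectedComponent.mem_supp_iff, ConnectedComponent.eq]
    constructor
    · intro h
      obtain ⟨y, hy, _⟩ := h.symm.lift_comap hno
      exact ⟨y, hy⟩
    · rintro ⟨y, rfl⟩
      exact (hconn.preconnected y x).map ⟨f, fun h => h⟩

open Classical in
/-- The sum of a weight over the components, written as a sum over all sets of vertices. -/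
lemma sum_component_eq_sum_finset [Fintype V] (G : SimpleGraph V) (ψ : Finset V → ℝ≥0∞) :
    ∑ c : G.ConnectedComponent, ψ c.supp.toFinset =
      ∑ S : Finset V, if ∃ c : G.ConnectedComponent, c.supp = ↑S then ψ S else 0 := by
  rw [← Finset.sum_filter]
  refine Finset.sum_bij (fun c _ => c.supp.toFinset) ?_ ?_ ?_ ?_
  · intro c _
    simp only [Finset.mem_filter, Finset.mem_univ, true_and]
    exact ⟨c, by simp⟩
  · intro c _ c' _ h
    exact ConnectedComponent.supp_injective (Set.toFinset_inj.1 h)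
  · intro S hS
    simp only [Finset.mem_filter, Finset.mem_univ, true_and] at hS
    obtain ⟨c, hc⟩ := hS
    refine ⟨c, Finset.mem_univ _, ?_⟩
    ext v
    simp [hc]
  · intro c _
    rfl

end SimpleGraph

section Decomposition

variable {d : ℕ}

open Classical in
/-- The sum of the weights `φ k l` over the components of a graph on red and blue vertices, where
`k` and `l` are the numbers of red and blue vertices in the component. -/
noncomputable def componentSum {a b : ℕ} (φ : ℕ → ℕ → ℝ≥0∞) (G : SimpleGraph (Fin a ⊕ Fin b)) :
    ℝ≥0∞ :=
  ∑ R : Finset (Fin a), ∑ B : Finset (Fin b),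
    if ∃ c : G.ConnectedComponent, c.supp = ↑(R.disjSum B) then φ R.card B.card else 0

open Classical in
lemma componentSum_eq {a b : ℕ} (φ : ℕ → ℕ → ℝ≥0∞) (G : SimpleGraph (Fin a ⊕ Fin b)) :
    componentSum φ G = ∑ c : G.ConnectedComponent,
      φ c.supp.toFinset.toLeft.card c.supp.toFinset.toRight.card := by
  have h := G.sum_component_eq_sum_finset fun S => φ S.toLeft.card S.toRight.card
  refine Eq.trans ?_ (h.symm.trans (by congr!))
  rw [componentSum, ← Fintype.sum_prod_type']
  refine Finset.sum_bij' (fun q _ => q.1.disjSum q.2) (fun S _ => (S.toLeft, S.toRight))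
    (by simp) (by simp) (by simp) (fun S _ => Finset.toLeft_disjSum_toRight) ?_
  intro q _
  simp only [Finset.toLeft_disjSum, Finset.toRight_disjSum]

lemma componentSum_one {a b : ℕ} (G : SimpleGraph (Fin a ⊕ Fin b)) :
    componentSum (fun _ _ => 1) G = G.numComp := by
  classical
  rw [componentSum_eq, SimpleGraph.numComp, Nat.card_eq_fintype_card]
  simp

lemma componentSum_card {a b : ℕ} (G : SimpleGraph (Fin a ⊕ Fin b)) :
    componentSum (fun k l => ((k + l : ℕ) : ℝ≥0∞)) G = (a + b : ℕ) := by
  classical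
  rw [componentSum_eq]
  simp_rw [Finset.card_toLeft_add_card_toRight]
  rw [← Nat.cast_sum]
  congr 1
  have h := Finset.card_eq_sum_card_fiberwise (f := G.connectedComponentMk)
    (s := Finset.univ) (t := Finset.univ) (fun _ _ => Finset.mem_coe.2 (Finset.mem_univ _))
  rw [Finset.card_univ, Fintype.card_sum, Fintype.card_fin, Fintype.card_fin] at h
  rw [h]
  refine Finset.sum_congr rfl fun c _ => ?_
  congr 1
  ext v
  simp

/-- The set of points at distance at least `u` from all points of `b`. -/
def farSet {ι : Type*} (u : ℝ) (b : ι → EuclideanSpace ℝ (Fin d)) :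
    Set (EuclideanSpace ℝ (Fin d)) := {x | ∀ j, u ≤ dist x (b j)}

open Classical in
/-- The indicator of connectedness of the level graph. -/
noncomputable def connInd {A B : Type*} (u : ℝ) (r : A → EuclideanSpace ℝ (Fin d))
    (b : B → EuclideanSpace ℝ (Fin d)) : ℝ≥0∞ := if (levelGraph u r b).Connected then 1 else 0

/-- The probability that `k` red and `l` blue points are connected at level `u`, and that none
of `k'` more red and `l'` more blue points is joined to them. -/
noncomputable def compProb (d : ℕ) (u : ℝ) (k l k' l' : ℕ) : ℝ≥0∞ :=
  ∫⁻ r, ∫⁻ b, connInd u r b * unif d (farSet u b) ^ k' * unif d (farSet u r) ^ l'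
    ∂(Measure.pi fun _ : Fin l => unif d) ∂(Measure.pi fun _ : Fin k => unif d)

lemma measurableSet_far_graph (u : ℝ) (l : ℕ) :
    MeasurableSet {q : (Fin l → EuclideanSpace ℝ (Fin d)) × EuclideanSpace ℝ (Fin d) |
      q.2 ∈ farSet u q.1} := by
  have : {q : (Fin l → EuclideanSpace ℝ (Fin d)) × EuclideanSpace ℝ (Fin d) |
      q.2 ∈ farSet u q.1} = ⋂ j, {q | u ≤ dist q.2 (q.1 j)} := by ext; simp [farSet]
  rw [this]
  exact MeasurableSet.iInter fun j => measurableSet_le measurable_const (by fun_prop)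

lemma measurableSet_farSet (u : ℝ) {l : ℕ} (b : Fin l → EuclideanSpace ℝ (Fin d)) :
    MeasurableSet (farSet u b) := measurable_prodMk_left (x := b) (measurableSet_far_graph u l)

lemma measurable_measure_farSet (u : ℝ) (l : ℕ) (μ : Measure (EuclideanSpace ℝ (Fin d)))
    [SFinite μ] : Measurable fun b : Fin l → EuclideanSpace ℝ (Fin d) => μ (farSet u b) :=
  measurable_measure_prodMk_left (measurableSet_far_graph u l)

lemma measurable_connInd {Ω : Type*} [MeasurableSpace Ω] {k l : ℕ} (u : ℝ)
    {r : Ω → Fin k → EuclideanSpace ℝ (Fin d)} {b : Ω → Fin l → EuclideanSpace ℝ (Fin d)}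
    (hr : Measurable r) (hb : Measurable b) : Measurable fun ω => connInd u (r ω) (b ω) := by
  classical
  unfold connInd
  exact measurable_comp_levelGraph (u := fun _ => u) (x := r) (y := b) measurable_const
    (fun i j => by fun_prop) fun G => @ite ℝ≥0∞ G.Connected (Classical.propDecidable _) 1 0

lemma pi_forall_mem_farSet (u : ℝ) {k l : ℕ} (b : Fin l → EuclideanSpace ℝ (Fin d)) :
    (Measure.pi fun _ : Fin k => unif d) {x | ∀ i, x i ∈ farSet u b} =
      unif d (farSet u b) ^ k := by
  have : {x : Fin k → EuclideanSpace ℝ (Fin d) | ∀ i, x i ∈ farSet u b} =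
    Set.univ.pi fun _ => farSet u b := by ext; simp
  rw [this, Measure.pi_pi]
  simp

lemma measurePreserving_split {k k' a : ℕ} (e : Fin k ⊕ Fin k' ≃ Fin a) :
    MeasurePreserving (fun x : Fin a → EuclideanSpace ℝ (Fin d) =>
      ((fun i => x (e (.inl i))), fun i => x (e (.inr i))))
      (Measure.pi fun _ => unif d)
      ((Measure.pi fun _ => unif d).prod (Measure.pi fun _ => unif d)) := by
  have h1 := (measurePreserving_piCongrLeft (fun _ : Fin a => unif d) e).symm
  have h2 := measurePreserving_sumPiEquivProdPi (fun _ : Fin k ⊕ Fin k' => unif d)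
  exact h2.comp h1

/-- The points with index in `R` and `B` form a component if and only if their own level graph is
connected and all other points are far from them. -/
lemma exists_supp_eq_iff {a b k l k' l' : ℕ} (u : ℝ) (eA : Fin k ⊕ Fin k' ≃ Fin a)
    (eB : Fin l ⊕ Fin l' ≃ Fin b) {R : Finset (Fin a)} {B : Finset (Fin b)}
    (hR : (R : Set (Fin a)) = Set.range fun i => eA (.inl i))
    (hB : (B : Set (Fin b)) = Set.range fun i => eB (.inl i))
    (x : Fin a → EuclideanSpace ℝ (Fin d)) (y : Fin b → EuclideanSpace ℝ (Fin d)) :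
    (∃ c : (levelGraph u x y).ConnectedComponent, c.supp = ↑(R.disjSum B)) ↔
      (levelGraph u (fun i => x (eA (.inl i))) (fun j => y (eB (.inl j)))).Connected ∧
        (∀ i, x (eA (.inr i)) ∈ farSet u fun j => y (eB (.inl j))) ∧
        ∀ j, y (eB (.inr j)) ∈ farSet u fun i => x (eA (.inl i)) := by
  set f : Fin k ⊕ Fin l → Fin a ⊕ Fin b :=
    Sum.map (fun i => eA (.inl i)) (fun j => eB (.inl j)) with hf
  have hinj : Function.Injective f :=
    Sum.map_injective.2 ⟨eA.injective.comp Sum.inl_injective, eB.injective.comp Sum.inl_injective⟩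
  have hrange : (↑(R.disjSum B) : Set (Fin a ⊕ Fin b)) = Set.range f := by
    ext v
    rcases v with i | j
    · have := Set.ext_iff.1 hR i
      simp only [Finset.mem_coe, Set.mem_range] at this
      simp [hf, this]
    · have := Set.ext_iff.1 hB j
      simp only [Finset.mem_coe, Set.mem_range] at this
      simp [hf, this]
  have hcomap : (levelGraph u x y).comap f =
      levelGraph u (fun i => x (eA (.inl i))) (fun j => y (eB (.inl j))) := by
    ext v w
    rcases v with i | i <;> rcases w with j | j <;> simp [hf, levelGraph]
  have hnotl : ∀ i, Sum.inl (eA (.inr i)) ∉ Set.range f := by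
    rintro i ⟨v, hv⟩
    rcases v with j | j
    · simp [hf] at hv
    · simp [hf] at hv
  have hnotr : ∀ i, Sum.inr (eB (.inr i)) ∉ Set.range f := by
    rintro i ⟨v, hv⟩
    rcases v with j | j
    · simp [hf] at hv
    · simp [hf] at hv
  rw [hrange, SimpleGraph.exists_supp_eq_range_iff hinj, hcomap]
  refine and_congr_right fun _ => ?_
  constructor
  · intro h
    refine ⟨fun i j => ?_, fun j i => ?_⟩
    · have := h (.inr j) _ (hnotl i)
      rw [hf, Sum.map_inr, SimpleGraph.adj_comm, levelGraph_adj] at this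
      exact not_lt.1 this
    · have := h (.inl i) _ (hnotr j)
      rw [hf, Sum.map_inl, levelGraph_adj, dist_comm] at this
      exact not_lt.1 this
  · rintro ⟨h1, h2⟩ v w hw
    rcases v with i | j
    · rcases w with i' | j'
      · simp [hf, levelGraph]
      · obtain ⟨j'', rfl⟩ := eB.surjective j'
        rcases j'' with j'' | j''
        · exact absurd ⟨.inr j'', rfl⟩ hw
        · rw [hf, Sum.map_inl, levelGraph_adj, dist_comm]
          exact not_lt.2 (h2 j'' i)
    · rcases w with i' | j'
      · obtain ⟨i'', rfl⟩ := eA.surjective i'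
        rcases i'' with i'' | i''
        · exact absurd ⟨.inl i'', rfl⟩ hw
        · rw [hf, Sum.map_inr, SimpleGraph.adj_comm, levelGraph_adj]
          exact not_lt.2 (h1 i'' j)
      · simp [hf, levelGraph]

open Classical in
/-- The probability that given points form a component. The enumerations `eA` and `eB` list these
points before the others. -/
lemma lintegral_component_indicator {a b k l k' l' : ℕ} (u : ℝ) (eA : Fin k ⊕ Fin k' ≃ Fin a)
    (eB : Fin l ⊕ Fin l' ≃ Fin b) {R : Finset (Fin a)} {B : Finset (Fin b)}
    (hR : (R : Set (Fin a)) = Set.range fun i => eA (.inl i))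
    (hB : (B : Set (Fin b)) = Set.range fun i => eB (.inl i)) :
    ∫⁻ z, (if ∃ c : (levelGraph u z.1 z.2).ConnectedComponent, c.supp = ↑(R.disjSum B) then 1
      else 0) ∂sampleLaw d a b = compProb d u k l k' l' := by
  let H : ((Fin k → EuclideanSpace ℝ (Fin d)) × (Fin k' → EuclideanSpace ℝ (Fin d))) ×
      ((Fin l → EuclideanSpace ℝ (Fin d)) × (Fin l' → EuclideanSpace ℝ (Fin d))) → ℝ≥0∞ := fun q =>
    connInd u q.1.1 q.2.1 * {q : ((Fin k → EuclideanSpace ℝ (Fin d)) ×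
      (Fin k' → EuclideanSpace ℝ (Fin d))) × ((Fin l → EuclideanSpace ℝ (Fin d)) ×
      (Fin l' → EuclideanSpace ℝ (Fin d))) | ∀ i, q.1.2 i ∈ farSet u q.2.1}.indicator 1 q *
      {q : ((Fin k → EuclideanSpace ℝ (Fin d)) ×
      (Fin k' → EuclideanSpace ℝ (Fin d))) × ((Fin l → EuclideanSpace ℝ (Fin d)) ×
      (Fin l' → EuclideanSpace ℝ (Fin d))) | ∀ j, q.2.2 j ∈ farSet u q.1.1}.indicator 1 q
  have hHm : Measurable H := by
    refine ((measurable_connInd u (by fun_prop) (by fun_prop)).mul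
      (measurable_one.indicator ?_)).mul (measurable_one.indicator ?_)
    · refine (congrArg MeasurableSet (Set.ofPred_forall _)).mpr (MeasurableSet.iInter fun i => ?_)
      exact (by fun_prop : Measurable fun q : ((Fin k → EuclideanSpace ℝ (Fin d)) ×
        (Fin k' → EuclideanSpace ℝ (Fin d))) × ((Fin l → EuclideanSpace ℝ (Fin d)) ×
        (Fin l' → EuclideanSpace ℝ (Fin d))) => (q.2.1, q.1.2 i)) (measurableSet_far_graph u l)
    · refine (congrArg MeasurableSet (Set.ofPred_forall _)).mpr (MeasurableSet.iInter fun i => ?_)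
      exact (by fun_prop : Measurable fun q : ((Fin k → EuclideanSpace ℝ (Fin d)) ×
        (Fin k' → EuclideanSpace ℝ (Fin d))) × ((Fin l → EuclideanSpace ℝ (Fin d)) ×
        (Fin l' → EuclideanSpace ℝ (Fin d))) => (q.1.1, q.2.2 i)) (measurableSet_far_graph u k)
  have hsplit := (measurePreserving_split (d := d) eA).prod (measurePreserving_split (d := d) eB)
  calc _ = ∫⁻ z, H (Prod.map (fun x : Fin a → EuclideanSpace ℝ (Fin d) =>
          ((fun i => x (eA (.inl i))), fun i => x (eA (.inr i))))
        (fun x : Fin b → EuclideanSpace ℝ (Fin d) =>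
          ((fun i => x (eB (.inl i))), fun i => x (eB (.inr i)))) z) ∂sampleLaw d a b := by
        refine lintegral_congr fun z => ?_
        simp only [exists_supp_eq_iff u eA eB hR hB, H, connInd, Prod.map, Set.indicator_apply,
          Set.mem_ofPred_eq, Pi.one_apply]
        split_ifs <;> simp_all
    _ = _ := by
        rw [sampleLaw, hsplit.lintegral_comp hHm, lintegral_prod _ hHm.aemeasurable,
          lintegral_prod _ hHm.lintegral_prod_right'.aemeasurable, compProb]
        refine lintegral_congr fun r => ?_
        have hin : ∀ r', ∫⁻ q, H ((r, r'), q) ∂((Measure.pi fun _ : Fin l => unif d).prod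
            (Measure.pi fun _ : Fin l' => unif d)) =
            ∫⁻ b, connInd u r b * {q : (Fin k' → EuclideanSpace ℝ (Fin d)) ×
              (Fin l → EuclideanSpace ℝ (Fin d)) | ∀ i, q.1 i ∈ farSet u q.2}.indicator 1 (r', b) *
              unif d (farSet u r) ^ l' ∂(Measure.pi fun _ : Fin l => unif d) := by
          intro r'
          have hm : Measurable fun q => H ((r, r'), q) := hHm.comp measurable_prodMk_left
          rw [lintegral_prod _ hm.aemeasurable]
          refine lintegral_congr fun b => ?_
          have hms : MeasurableSet {b' : Fin l' → EuclideanSpace ℝ (Fin d) |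
              ∀ j, b' j ∈ farSet u r} := by
            have : {b' : Fin l' → EuclideanSpace ℝ (Fin d) | ∀ i, b' i ∈ farSet u r} =
              Set.univ.pi fun _ => farSet u r := by ext; simp
            rw [this]
            exact MeasurableSet.univ_pi fun _ => measurableSet_farSet u r
          calc _ = ∫⁻ b', connInd u r b * {q : (Fin k' → EuclideanSpace ℝ (Fin d)) ×
              (Fin l → EuclideanSpace ℝ (Fin d)) | ∀ i, q.1 i ∈ farSet u q.2}.indicator 1 (r', b) *
              {b' : Fin l' → EuclideanSpace ℝ (Fin d) |
              ∀ j, b' j ∈ farSet u r}.indicator 1 b' ∂(Measure.pi fun _ : Fin l' => unif d) := rfl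
            _ = _ := by
              rw [lintegral_const_mul _ (measurable_one.indicator hms),
                lintegral_indicator_one hms, pi_forall_mem_farSet]
        simp_rw [hin]
        have hset : MeasurableSet {q : (Fin k' → EuclideanSpace ℝ (Fin d)) ×
              (Fin l → EuclideanSpace ℝ (Fin d)) | ∀ i, q.1 i ∈ farSet u q.2} := by
          refine (congrArg MeasurableSet (Set.ofPred_forall _)).mpr
            (MeasurableSet.iInter fun i => ?_)
          exact (by fun_prop : Measurable fun q : (Fin k' → EuclideanSpace ℝ (Fin d)) ×
            (Fin l → EuclideanSpace ℝ (Fin d)) => (q.2, q.1 i)) (measurableSet_far_graph u l)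
        rw [lintegral_lintegral_swap]
        · refine lintegral_congr fun b => ?_
          have hms : MeasurableSet {r' : Fin k' → EuclideanSpace ℝ (Fin d) |
              ∀ j, r' j ∈ farSet u b} := measurable_prodMk_right (y := b) hset
          rw [lintegral_mul_const, lintegral_const_mul]
          · congr 2
            rw [← pi_forall_mem_farSet, ← lintegral_indicator_one hms]
            rfl
          · exact measurable_one.indicator hms
          · exact (measurable_one.indicator hms).const_mul _
        · refine Measurable.aemeasurable ?_
          refine Measurable.mul_const (Measurable.mul ?_ ?_) _
          · exact measurable_connInd u measurable_const measurable_snd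
          · exact measurable_one.indicator hset

/-- The expectation of a sum over components: choose the vertices of the component. -/
theorem lintegral_componentSum (a b : ℕ) (u : ℝ) (φ : ℕ → ℕ → ℝ≥0∞) :
    ∫⁻ z, componentSum φ (levelGraph u z.1 z.2) ∂sampleLaw d a b =
      ∑ k ∈ Finset.range (a + 1), ∑ l ∈ Finset.range (b + 1),
        a.choose k * b.choose l * φ k l * compProb d u k l (a - k) (b - l) := by
  classical
  have hterm : ∀ (R : Finset (Fin a)) (B : Finset (Fin b)),
      ∫⁻ z, (if ∃ c : (levelGraph u z.1 z.2).ConnectedComponent, c.supp = ↑(R.disjSum B) then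
        φ R.card B.card else 0) ∂sampleLaw d a b =
      φ R.card B.card * compProb d u R.card B.card (a - R.card) (b - B.card) := by
    intro R B
    have hRc : (Rᶜ).card = a - R.card := by rw [Finset.card_compl, Fintype.card_fin]
    have hBc : (Bᶜ).card = b - B.card := by rw [Finset.card_compl, Fintype.card_fin]
    have h := lintegral_component_indicator (d := d) u (finSumEquivOfFinset rfl hRc)
      (finSumEquivOfFinset rfl hBc) (R := R) (B := B) (by ext; simp) (by ext; simp)
    rw [← h, ← lintegral_const_mul]
    · simp only [mul_ite, mul_one, mul_zero]
    · exact measurable_comp_levelGraph (x := fun z : (Fin a → EuclideanSpace ℝ (Fin d)) ×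
        (Fin b → EuclideanSpace ℝ (Fin d)) => z.1) (y := fun z => z.2) measurable_const
        (fun i j => by fun_prop) fun G => if ∃ c : G.ConnectedComponent, c.supp = ↑(R.disjSum B)
          then (1 : ℝ≥0∞) else 0
  have hmeas : ∀ (R : Finset (Fin a)) (B : Finset (Fin b)), Measurable fun z :
      (Fin a → EuclideanSpace ℝ (Fin d)) × (Fin b → EuclideanSpace ℝ (Fin d)) =>
      (if ∃ c : (levelGraph u z.1 z.2).ConnectedComponent, c.supp = ↑(R.disjSum B) then
        φ R.card B.card else 0) := fun R B =>
    measurable_comp_levelGraph (x := fun z : (Fin a → EuclideanSpace ℝ (Fin d)) ×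
      (Fin b → EuclideanSpace ℝ (Fin d)) => z.1) (y := fun z => z.2) measurable_const
      (fun i j => by fun_prop)
      fun G => if ∃ c : G.ConnectedComponent, c.supp = ↑(R.disjSum B) then φ R.card B.card else 0
  unfold componentSum
  rw [lintegral_finsetSum _ fun R _ => Finset.measurable_sum _ fun B _ => hmeas R B]
  simp_rw [lintegral_finsetSum _ fun B _ => hmeas _ B, hterm]
  have h1 := Finset.sum_powerset_apply_card (fun k => ∑ B : Finset (Fin b),
    φ k B.card * compProb d u k B.card (a - k) (b - B.card)) (x := (Finset.univ : Finset (Fin a)))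
  rw [Finset.powerset_univ, Finset.card_univ, Fintype.card_fin] at h1
  rw [h1]
  refine Finset.sum_congr rfl fun k _ => ?_
  have h2 := Finset.sum_powerset_apply_card (fun l => φ k l * compProb d u k l (a - k) (b - l))
    (x := (Finset.univ : Finset (Fin b)))
  rw [Finset.powerset_univ, Finset.card_univ, Fintype.card_fin] at h2
  rw [h2, nsmul_eq_mul, Finset.mul_sum]
  refine Finset.sum_congr rfl fun l _ => ?_
  rw [nsmul_eq_mul]
  ring

end Decomposition

/-! ### The limiting frequency of components of given size -/

section ScalingLimit

variable {d : ℕ}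

lemma lintegral_comp_affine {F : Type*} [NormedAddCommGroup F] [NormedSpace ℝ F]
    [FiniteDimensional ℝ F] [MeasurableSpace F] [BorelSpace F] (μ : Measure F)
    [μ.IsAddHaarMeasure] (c : F) {u : ℝ} (hu : 0 < u) (f : F → ℝ≥0∞) :
    ∫⁻ y, f y ∂μ = ENNReal.ofReal (u ^ Module.finrank ℝ F) * ∫⁻ y, f (c + u • y) ∂μ := by
  have h1 : ∫⁻ y, f (c + u • y) ∂μ = ∫⁻ y, f (c + y) ∂(μ.map (u • ·)) :=
    ((measurableEmbedding_const_smul₀ hu.ne').lintegral_map (fun y => f (c + y))).symm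
  rw [h1, Measure.map_addHaar_smul μ hu.ne', lintegral_smul_measure, smul_eq_mul, ← mul_assoc,
    ← ENNReal.ofReal_mul (by positivity), abs_of_pos (by positivity),
    mul_inv_cancel₀ (by positivity), ENNReal.ofReal_one, one_mul, lintegral_add_left_eq_self]

lemma volume_eq_preimage_affine (c : EuclideanSpace ℝ (Fin d)) {u : ℝ} (hu : 0 < u)
    {S : Set (EuclideanSpace ℝ (Fin d))} (hS : MeasurableSet S) :
    volume S = ENNReal.ofReal (u ^ d) * volume {y | c + u • y ∈ S} := by
  have h := lintegral_comp_affine volume c hu (S.indicator (1 : EuclideanSpace ℝ (Fin d) → ℝ≥0∞))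
  rw [lintegral_indicator_one hS, finrank_euclideanSpace_fin] at h
  have hS' : MeasurableSet {y | c + u • y ∈ S} :=
    (by fun_prop : Measurable fun y : EuclideanSpace ℝ (Fin d) => c + u • y) hS
  rw [h, ← lintegral_indicator_one hS']
  rfl

lemma volume_compl_farSet {l : ℕ} (b : Fin l → EuclideanSpace ℝ (Fin d)) :
    volume (farSet 1 b)ᶜ = volume (Metric.cthickening 1 (Set.range b)) := by
  have h1 : (farSet 1 b)ᶜ = ⋃ j, Metric.ball (b j) 1 := by
    ext x; simp [farSet]
  have h2 : Metric.cthickening 1 (Set.range b) = ⋃ j, Metric.closedBall (b j) 1 := by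
    rw [(Set.finite_range b).isCompact.cthickening_eq_biUnion_closedBall zero_le_one]
    simp
  rw [h1, h2]
  refine measure_congr (Filter.EventuallyEq.countable_iUnion fun j => ?_)
  refine ae_eq_of_subset_of_measure_ge Metric.ball_subset_closedBall ?_
    measurableSet_ball.nullMeasurableSet measure_closedBall_lt_top.ne
  rw [← Metric.ball_union_sphere]
  refine (measure_union_le _ _).trans ?_
  rw [Measure.addHaar_sphere_of_ne_zero _ _ one_ne_zero, add_zero]

lemma volume_cthickening_lt_top {l : ℕ} (b : Fin l → EuclideanSpace ℝ (Fin d)) :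
    volume (Metric.cthickening 1 (Set.range b)) < ∞ :=
  ((Set.finite_range b).isCompact.cthickening).measure_lt_top

lemma farSet_affine (u : ℝ) (hu : 0 < u) (x : EuclideanSpace ℝ (Fin d)) {l : ℕ}
    (b : Fin l → EuclideanSpace ℝ (Fin d)) (y : EuclideanSpace ℝ (Fin d)) :
    x + u • y ∈ farSet u (fun j => x + u • b j) ↔ y ∈ farSet 1 b := by
  simp only [farSet, Set.mem_ofPred_eq, dist_add_left, dist_smul₀, Real.norm_eq_abs, abs_of_pos hu]
  exact forall_congr' fun j => le_mul_iff_one_le_right hu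

lemma connInd_affine {u : ℝ} (hu : 0 < u) (x : EuclideanSpace ℝ (Fin d)) {k l : ℕ}
    (r : Fin k → EuclideanSpace ℝ (Fin d)) (b : Fin l → EuclideanSpace ℝ (Fin d)) :
    connInd u (fun i => x + u • r i) (fun j => x + u • b j) = connInd 1 r b := by
  have : levelGraph u (fun i => x + u • r i) (fun j => x + u • b j) = levelGraph 1 r b := by
    ext v w
    rcases v with i | i <;> rcases w with j | j <;>
      simp [levelGraph, dist_smul₀, abs_of_pos hu, mul_lt_iff_lt_one_right hu]
  unfold connInd
  rw [this]

lemma lintegral_pi_unif {k : ℕ} (f : (Fin k → EuclideanSpace ℝ (Fin d)) → ℝ≥0∞) :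
    ∫⁻ r, f r ∂(Measure.pi fun _ : Fin k => unif d) =
      ∫⁻ r, (Set.univ.pi fun _ : Fin k => hcube d).indicator f r := by
  rw [lintegral_indicator (MeasurableSet.univ_pi fun _ => measurableSet_hcube), volume_pi,
    Measure.restrict_pi_pi]
  rfl

lemma lintegral_pi_cons {k : ℕ} (μ : Measure (EuclideanSpace ℝ (Fin d))) [SigmaFinite μ]
    {f : (Fin (k + 1) → EuclideanSpace ℝ (Fin d)) → ℝ≥0∞} (hf : Measurable f) :
    ∫⁻ r, f r ∂(Measure.pi fun _ : Fin (k + 1) => μ) =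
      ∫⁻ x, ∫⁻ r, f (Fin.cons x r) ∂(Measure.pi fun _ : Fin k => μ) ∂μ := by
  have h := (measurePreserving_piFinSuccAbove (fun _ : Fin (k + 1) => μ) 0).symm
  have hfm := hf.comp h.measurable
  rw [← h.lintegral_comp hf, lintegral_prod (fun q => f _) hfm.aemeasurable]
  refine lintegral_congr fun x => lintegral_congr fun r => ?_
  congr 1
  simp only [MeasurableEquiv.piFinSuccAbove, Fin.insertNthEquiv_zero]
  rfl

/-- The integrand for the probability of a component in coordinates relative to its first red point
`x`, with lengths measured in units of `u`. -/
noncomputable def scaledIntegrand (u : ℝ) (k l k' l' : ℕ) (q : EuclideanSpace ℝ (Fin d) ×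
    ((Fin k → EuclideanSpace ℝ (Fin d)) × (Fin l → EuclideanSpace ℝ (Fin d)))) : ℝ≥0∞ :=
  {q : EuclideanSpace ℝ (Fin d) ×
    ((Fin k → EuclideanSpace ℝ (Fin d)) × (Fin l → EuclideanSpace ℝ (Fin d))) |
    (∀ i, q.1 + u • q.2.1 i ∈ hcube d) ∧ ∀ j, q.1 + u • q.2.2 j ∈ hcube d}.indicator 1 q *
  (connInd 1 (Fin.cons 0 q.2.1 : Fin (k + 1) → EuclideanSpace ℝ (Fin d)) q.2.2 *
    unif d (farSet u fun j => q.1 + u • q.2.2 j) ^ k' *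
    unif d (farSet u fun i => q.1 +
      u • (Fin.cons 0 q.2.1 : Fin (k + 1) → EuclideanSpace ℝ (Fin d)) i) ^ l')

lemma measurable_cons {k : ℕ} : Measurable fun r : Fin k → EuclideanSpace ℝ (Fin d) =>
    (Fin.cons 0 r : Fin (k + 1) → EuclideanSpace ℝ (Fin d)) := by
  rw [measurable_pi_iff]
  intro i
  refine Fin.cases ?_ (fun i => ?_) i
  · simp
  · simpa using measurable_pi_apply i

lemma measurable_scaledIntegrand (u : ℝ) (k l k' l' : ℕ) :
    Measurable (scaledIntegrand (d := d) u k l k' l') := by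
  have hc : Measurable fun q : EuclideanSpace ℝ (Fin d) × ((Fin k → EuclideanSpace ℝ (Fin d)) ×
      (Fin l → EuclideanSpace ℝ (Fin d))) =>
      (Fin.cons 0 q.2.1 : Fin (k + 1) → EuclideanSpace ℝ (Fin d)) :=
    measurable_cons.comp (by fun_prop)
  refine Measurable.mul (measurable_one.indicator ?_) (Measurable.mul (Measurable.mul ?_ ?_) ?_)
  · refine MeasurableSet.inter ?_ ?_
    · refine (congrArg MeasurableSet (Set.ofPred_forall _)).mpr (MeasurableSet.iInter fun i => ?_)
      exact (by fun_prop : Measurable fun q : EuclideanSpace ℝ (Fin d) ×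
        ((Fin k → EuclideanSpace ℝ (Fin d)) × (Fin l → EuclideanSpace ℝ (Fin d))) =>
        q.1 + u • q.2.1 i) measurableSet_hcube
    · refine (congrArg MeasurableSet (Set.ofPred_forall _)).mpr (MeasurableSet.iInter fun i => ?_)
      exact (by fun_prop : Measurable fun q : EuclideanSpace ℝ (Fin d) ×
        ((Fin k → EuclideanSpace ℝ (Fin d)) × (Fin l → EuclideanSpace ℝ (Fin d))) =>
        q.1 + u • q.2.2 i) measurableSet_hcube
  · exact measurable_connInd 1 hc (by fun_prop)
  · exact ((measurable_measure_farSet u l (unif d)).comp (by fun_prop : Measurable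
      fun q : EuclideanSpace ℝ (Fin d) ×
        ((Fin k → EuclideanSpace ℝ (Fin d)) × (Fin l → EuclideanSpace ℝ (Fin d))) =>
        fun j => q.1 + u • q.2.2 j)).pow_const k'
  · refine ((measurable_measure_farSet u (k + 1) (unif d)).comp (?_ : Measurable
      fun q : EuclideanSpace ℝ (Fin d) ×
        ((Fin k → EuclideanSpace ℝ (Fin d)) × (Fin l → EuclideanSpace ℝ (Fin d))) =>
        fun i => q.1 + u • (Fin.cons 0 q.2.1 : Fin (k + 1) → EuclideanSpace ℝ (Fin d)) i)).pow_const
        l'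
    exact measurable_pi_iff.2 fun i =>
      measurable_fst.add (((measurable_pi_apply i).comp hc).const_smul u)

lemma finrank_pi_euclidean (k : ℕ) :
    Module.finrank ℝ (Fin k → EuclideanSpace ℝ (Fin d)) = d * k := by
  rw [Module.finrank_pi_fintype]
  simp [mul_comm]

/-- Substitution of the positions relative to the first red point, in units of `u`. -/
lemma compProb_eq_scaled {u : ℝ} (hu : 0 < u) (k l k' l' : ℕ) :
    compProb d u (k + 1) l k' l' = ENNReal.ofReal (u ^ (d * (k + l))) *
      ∫⁻ q, scaledIntegrand u k l k' l' q ∂((unif d).prod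
        ((volume : Measure (Fin k → EuclideanSpace ℝ (Fin d))).prod
          (volume : Measure (Fin l → EuclideanSpace ℝ (Fin d))))) := by
  have hK : Measurable fun q : (Fin (k + 1) → EuclideanSpace ℝ (Fin d)) ×
      (Fin l → EuclideanSpace ℝ (Fin d)) => connInd u q.1 q.2 * unif d (farSet u q.2) ^ k' *
        unif d (farSet u q.1) ^ l' :=
    ((measurable_connInd u (by fun_prop) (by fun_prop)).mul
      (((measurable_measure_farSet u l (unif d)).comp measurable_snd).pow_const k')).mul
      (((measurable_measure_farSet u (k + 1) (unif d)).comp measurable_fst).pow_const l')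
  have hsm := measurable_scaledIntegrand (d := d) u k l k' l'
  rw [compProb, lintegral_pi_cons _ hK.lintegral_prod_right', lintegral_prod _ hsm.aemeasurable,
    ← lintegral_const_mul _ hsm.lintegral_prod_right']
  refine lintegral_congr fun x => ?_
  have hsx : Measurable fun q => scaledIntegrand u k l k' l' (x, q) :=
    hsm.comp measurable_prodMk_left
  rw [lintegral_prod _ hsx.aemeasurable, lintegral_pi_unif,
    lintegral_comp_affine volume (fun _ => x) hu, finrank_pi_euclidean, mul_add, pow_add,
    ENNReal.ofReal_mul (by positivity), mul_assoc]
  congr 1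
  rw [← lintegral_const_mul _ hsx.lintegral_prod_right']
  refine lintegral_congr fun r => ?_
  have hcons : (Fin.cons x ((fun _ => x) + u • r) : Fin (k + 1) → EuclideanSpace ℝ (Fin d)) =
      fun i => x + u • (Fin.cons 0 r : Fin (k + 1) → EuclideanSpace ℝ (Fin d)) i := by
    funext i
    refine Fin.cases ?_ (fun i => ?_) i
    · simp
    · simp
  by_cases hr : ∀ i, x + u • r i ∈ hcube d
  · rw [Set.indicator_of_mem (by simpa [Set.mem_univ_pi] using hr), lintegral_pi_unif,
      lintegral_comp_affine volume (fun _ => x) hu, finrank_pi_euclidean]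
    congr 1
    refine lintegral_congr fun b => ?_
    rw [hcons]
    by_cases hb : ∀ j, x + u • b j ∈ hcube d
    · rw [Set.indicator_of_mem (by simpa [Set.mem_univ_pi] using hb)]
      have hq : (x, (r, b)) ∈ {q : EuclideanSpace ℝ (Fin d) ×
        ((Fin k → EuclideanSpace ℝ (Fin d)) × (Fin l → EuclideanSpace ℝ (Fin d))) |
        (∀ i, q.1 + u • q.2.1 i ∈ hcube d) ∧ ∀ j, q.1 + u • q.2.2 j ∈ hcube d} := ⟨hr, hb⟩
      rw [scaledIntegrand, Set.indicator_of_mem hq, Pi.one_apply, one_mul]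
      have := connInd_affine hu x (Fin.cons 0 r : Fin (k + 1) → EuclideanSpace ℝ (Fin d)) b
      rw [← this]
      rfl
    · rw [Set.indicator_of_notMem (by simpa [Set.mem_univ_pi] using hb)]
      have hq : (x, (r, b)) ∉ {q : EuclideanSpace ℝ (Fin d) ×
        ((Fin k → EuclideanSpace ℝ (Fin d)) × (Fin l → EuclideanSpace ℝ (Fin d))) |
        (∀ i, q.1 + u • q.2.1 i ∈ hcube d) ∧ ∀ j, q.1 + u • q.2.2 j ∈ hcube d} :=
        fun h => hb h.2
      rw [scaledIntegrand, Set.indicator_of_notMem hq, zero_mul]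
  · rw [Set.indicator_of_notMem (by simpa [Set.mem_univ_pi] using hr)]
    have hq : ∀ b, scaledIntegrand u k l k' l' (x, (r, b)) = 0 := by
      intro b
      have hq : (x, (r, b)) ∉ {q : EuclideanSpace ℝ (Fin d) ×
        ((Fin k → EuclideanSpace ℝ (Fin d)) × (Fin l → EuclideanSpace ℝ (Fin d))) |
        (∀ i, q.1 + u • q.2.1 i ∈ hcube d) ∧ ∀ j, q.1 + u • q.2.2 j ∈ hcube d} :=
        fun h => hr h.1
      rw [scaledIntegrand, Set.indicator_of_notMem hq, zero_mul]
    simp [hq]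

lemma dist_le_length_of_walk {A B M : Type*} [PseudoMetricSpace M] {x : A → M} {y : B → M}
    {v w : A ⊕ B} (p : (levelGraph 1 x y).Walk v w) :
    dist (Sum.elim x y v) (Sum.elim x y w) ≤ p.length := by
  induction p with
  | nil => simp
  | @cons a b c h p ih =>
    refine (dist_triangle _ (Sum.elim x y b) _).trans ?_
    have := h.2
    push_cast [SimpleGraph.Walk.length_cons]
    linarith

/-- Connected configurations rooted at the origin are bounded. -/
lemma norm_le_of_connInd_ne_zero {k l : ℕ} {r : Fin k → EuclideanSpace ℝ (Fin d)}
    {b : Fin l → EuclideanSpace ℝ (Fin d)}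
    (h : connInd 1 (Fin.cons 0 r : Fin (k + 1) → EuclideanSpace ℝ (Fin d)) b ≠ 0) :
    r ∈ Metric.closedBall 0 (k + 1 + l : ℝ) ∧ b ∈ Metric.closedBall 0 (k + 1 + l : ℝ) := by
  classical
  have hconn : (levelGraph 1
      (Fin.cons 0 r : Fin (k + 1) → EuclideanSpace ℝ (Fin d)) b).Connected := by
    by_contra hn
    exact h (if_neg hn)
  have hdist : ∀ v, ‖Sum.elim (Fin.cons 0 r : Fin (k + 1) → EuclideanSpace ℝ (Fin d)) b v‖ ≤
      (k + 1 + l : ℝ) := by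
    intro v
    obtain ⟨p, hp⟩ := hconn.exists_isPath v (.inl 0)
    have h1 := dist_le_length_of_walk p
    have h2 := hp.length_lt
    rw [Fintype.card_sum, Fintype.card_fin, Fintype.card_fin] at h2
    have h3 : (p.length : ℝ) ≤ k + 1 + l := by exact_mod_cast h2.le
    simp only [Sum.elim_inl, Fin.cons_zero, dist_zero_right] at h1
    exact h1.trans h3
  rw [mem_closedBall_zero_iff, mem_closedBall_zero_iff, pi_norm_le_iff_of_nonneg (by positivity),
    pi_norm_le_iff_of_nonneg (by positivity)]
  exact ⟨fun i => by simpa using hdist (.inl i.succ), fun j => hdist (.inr j)⟩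

/-- `(1 - v) ^ N → exp (-t)` when `v → 0` and `N * v → t`. -/
lemma tendsto_one_sub_pow {ι : Type*} {F : Filter ι} {v : ι → ℝ} {N : ι → ℕ} {t : ℝ}
    (hv : Tendsto v F (𝓝 0)) (hN : Tendsto (fun n => N n * v n) F (𝓝 t)) :
    Tendsto (fun n => (1 - v n) ^ N n) F (𝓝 (Real.exp (-t))) := by
  have hlow : Tendsto (fun n => Real.exp (-(N n * v n / (1 - v n)))) F (𝓝 (Real.exp (-t))) := by
    refine (Real.continuous_exp.tendsto _).comp ?_
    have h1 : Tendsto (fun n => 1 - v n) F (𝓝 1) := by simpa using tendsto_const_nhds.sub hv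
    simpa using (hN.div h1 one_ne_zero).neg
  have hup : Tendsto (fun n => Real.exp (-(N n * v n))) F (𝓝 (Real.exp (-t))) :=
    (Real.continuous_exp.tendsto _).comp hN.neg
  have hlt : ∀ᶠ n in F, v n < 1 := hv.eventually (gt_mem_nhds zero_lt_one)
  refine tendsto_of_tendsto_of_tendsto_of_le_of_le' hlow hup ?_ ?_
  · filter_upwards [hlt] with n hn
    have h0 : 0 < 1 - v n := by linarith
    have h1 : Real.exp (-(v n / (1 - v n))) ≤ 1 - v n := by
      rw [Real.exp_neg, inv_le_comm₀ (Real.exp_pos _) h0]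
      calc (1 - v n)⁻¹ = v n / (1 - v n) + 1 := by field_simp; ring
        _ ≤ _ := Real.add_one_le_exp _
    calc Real.exp (-(N n * v n / (1 - v n))) = Real.exp (-(v n / (1 - v n))) ^ N n := by
          rw [← Real.exp_nat_mul]; congr 1; ring
      _ ≤ _ := pow_le_pow_left₀ (Real.exp_pos _).le h1 _
  · filter_upwards [hlt] with n hn
    have h0 : 0 < 1 - v n := by linarith
    calc (1 - v n) ^ N n ≤ Real.exp (-v n) ^ N n :=
          pow_le_pow_left₀ h0.le (by linarith [Real.add_one_le_exp (-v n)]) _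
      _ = _ := by rw [← Real.exp_nat_mul]; congr 1; ring

/-- Far from the boundary of the cube, the excluded region has its full Euclidean volume. -/
lemma eventually_unif_farSet {x : EuclideanSpace ℝ (Fin d)} (hx : x ∈ interior (hcube d)) {l : ℕ}
    (b : Fin l → EuclideanSpace ℝ (Fin d)) {ι : Type*} {F : Filter ι} {u : ι → ℝ}
    (hu : Tendsto u F (𝓝 0)) (hpos : ∀ᶠ n in F, 0 < u n) :
    ∀ᶠ n in F, unif d (farSet (u n) fun j => x + u n • b j) =
      ENNReal.ofReal (1 - u n ^ d * (volume (Metric.cthickening 1 (Set.range b))).toReal) := by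
  obtain ⟨ε, hε, hball⟩ := Metric.mem_nhds_iff.1 (mem_interior_iff_mem_nhds.1 hx)
  have h1 : Tendsto (fun n => u n * (‖b‖ + 1)) F (𝓝 0) := by simpa using hu.mul_const (‖b‖ + 1)
  filter_upwards [hpos, h1.eventually (gt_mem_nhds hε)] with n hn hsmall
  have hms := measurableSet_farSet (u n) fun j => x + u n • b j
  have hsub : (farSet (u n) fun j => x + u n • b j)ᶜ ⊆ hcube d := by
    intro y hy
    simp only [farSet, Set.mem_compl_iff, Set.mem_ofPred_eq, not_forall, not_le] at hy
    obtain ⟨j, hj⟩ := hy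
    refine hball (Metric.mem_ball.2 (lt_of_le_of_lt ?_ hsmall))
    calc dist y x ≤ dist y (x + u n • b j) + dist (x + u n • b j) x := dist_triangle _ _ _
      _ ≤ u n + u n * ‖b‖ := by
          refine add_le_add hj.le ?_
          rw [dist_eq_norm, add_sub_cancel_left, norm_smul, Real.norm_eq_abs, abs_of_pos hn]
          exact mul_le_mul_of_nonneg_left (norm_le_pi_norm b j) hn.le
      _ = _ := by ring
  have hvol : unif d (farSet (u n) fun j => x + u n • b j)ᶜ =
      ENNReal.ofReal (u n ^ d * (volume (Metric.cthickening 1 (Set.range b))).toReal) := by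
    rw [unif_apply hms.compl, Set.inter_eq_left.2 hsub, volume_eq_preimage_affine x hn hms.compl,
      ENNReal.ofReal_mul (by positivity),
      ENNReal.ofReal_toReal (volume_cthickening_lt_top b).ne, ← volume_compl_farSet]
    congr 2
    ext y
    simp only [Set.mem_ofPred_eq, Set.mem_compl_iff, farSet_affine (u n) hn]
  rw [ENNReal.ofReal_sub _ (by positivity), ENNReal.ofReal_one, ← hvol,
    ← prob_compl_eq_one_sub hms.compl, compl_compl]

/-- The integrand of the limiting frequency of components with `k` red and `l` blue points, at
intensities `A` and `B` of red and blue points. -/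
noncomputable def limitIntegrand {k l : ℕ} (A B : ℝ) (r : Fin k → EuclideanSpace ℝ (Fin d))
    (b : Fin l → EuclideanSpace ℝ (Fin d)) : ℝ≥0∞ :=
  connInd 1 r b * ENNReal.ofReal (Real.exp
    (-(A * (volume (Metric.cthickening 1 (Set.range b))).toReal +
      B * (volume (Metric.cthickening 1 (Set.range r))).toReal)))

lemma measurable_volume_cthickening (m : ℕ) : Measurable fun b : Fin m → EuclideanSpace ℝ (Fin d) =>
    (volume (Metric.cthickening 1 (Set.range b))).toReal := by
  simp_rw [← volume_compl_farSet]
  exact (measurable_measure_prodMk_left (measurableSet_far_graph 1 m).compl).ennreal_toReal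

lemma measurable_limitIntegrand {Ω : Type*} [MeasurableSpace Ω] {k l : ℕ} {A B : Ω → ℝ}
    (hA : Measurable A) (hB : Measurable B) {r : Ω → Fin k → EuclideanSpace ℝ (Fin d)}
    {b : Ω → Fin l → EuclideanSpace ℝ (Fin d)} (hr : Measurable r) (hb : Measurable b) :
    Measurable fun ω => limitIntegrand (A ω) (B ω) (r ω) (b ω) := by
  refine (measurable_connInd 1 hr hb).mul (ENNReal.measurable_ofReal.comp
    (Real.measurable_exp.comp (Measurable.neg (Measurable.add ?_ ?_))))
  · exact hA.mul ((measurable_volume_cthickening l).comp hb)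
  · exact hB.mul ((measurable_volume_cthickening k).comp hr)

/-- The probability of a given component, in units of the volume of its configurations, converges
as the scale tends to `0`: the boundary of the cube is negligible and the probability that no other
point is close tends to an exponential. -/
theorem tendsto_compProb_div (k l : ℕ) {u : ℕ → ℝ} (hu : Tendsto u atTop (𝓝 0))
    (hpos : ∀ᶠ n in atTop, 0 < u n) {k' l' : ℕ → ℕ} {A B : ℝ}
    (hA : Tendsto (fun n => (k' n : ℝ) * u n ^ d) atTop (𝓝 A))
    (hB : Tendsto (fun n => (l' n : ℝ) * u n ^ d) atTop (𝓝 B)) (hd : 1 ≤ d) :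
    Tendsto (fun n => compProb d (u n) (k + 1) l (k' n) (l' n) /
      ENNReal.ofReal (u n ^ (d * (k + l)))) atTop
      (𝓝 (∫⁻ (r : Fin k → EuclideanSpace ℝ (Fin d)) (b : Fin l → EuclideanSpace ℝ (Fin d)),
        limitIntegrand (k := k + 1) A B (Fin.cons 0 r) b)) := by
  have hev : ∀ᶠ n in atTop, ∫⁻ q, scaledIntegrand (u n) k l (k' n) (l' n) q ∂((unif d).prod
        ((volume : Measure (Fin k → EuclideanSpace ℝ (Fin d))).prod
          (volume : Measure (Fin l → EuclideanSpace ℝ (Fin d))))) =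
        compProb d (u n) (k + 1) l (k' n) (l' n) / ENNReal.ofReal (u n ^ (d * (k + l))) := by
    filter_upwards [hpos] with n hn
    rw [compProb_eq_scaled hn, mul_comm, ENNReal.mul_div_cancel_right _ ENNReal.ofReal_ne_top]
    rw [Ne, ENNReal.ofReal_eq_zero, not_le]
    positivity
  refine Tendsto.congr' hev ?_
  have hud : Tendsto (fun n => u n ^ d) atTop (𝓝 0) := by
    have := hu.pow d
    rwa [zero_pow (by omega)] at this
  have hlimm : Measurable fun q : (Fin k → EuclideanSpace ℝ (Fin d)) ×
      (Fin l → EuclideanSpace ℝ (Fin d)) =>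
      limitIntegrand (k := k + 1) A B (Fin.cons 0 q.1) q.2 :=
    measurable_limitIntegrand measurable_const measurable_const
      (measurable_cons.comp measurable_fst) measurable_snd
  have hlim : ∫⁻ (r : Fin k → EuclideanSpace ℝ (Fin d)) (b : Fin l → EuclideanSpace ℝ (Fin d)),
        limitIntegrand (k := k + 1) A B (Fin.cons 0 r) b =
      ∫⁻ q : EuclideanSpace ℝ (Fin d) × ((Fin k → EuclideanSpace ℝ (Fin d)) ×
        (Fin l → EuclideanSpace ℝ (Fin d))),
        limitIntegrand (k := k + 1) A B (Fin.cons 0 q.2.1) q.2.2 ∂((unif d).prod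
        ((volume : Measure (Fin k → EuclideanSpace ℝ (Fin d))).prod
          (volume : Measure (Fin l → EuclideanSpace ℝ (Fin d))))) := by
    have hlimm' : Measurable fun q : EuclideanSpace ℝ (Fin d) ×
        ((Fin k → EuclideanSpace ℝ (Fin d)) × (Fin l → EuclideanSpace ℝ (Fin d))) =>
        limitIntegrand (k := k + 1) A B (Fin.cons 0 q.2.1) q.2.2 := hlimm.comp measurable_snd
    rw [lintegral_prod _ hlimm'.aemeasurable]
    simp only [lintegral_const, measure_univ, mul_one]
    rw [lintegral_prod _ hlimm.aemeasurable]
  rw [hlim]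
  let K : Set (EuclideanSpace ℝ (Fin d) × ((Fin k → EuclideanSpace ℝ (Fin d)) ×
      (Fin l → EuclideanSpace ℝ (Fin d)))) :=
    Set.univ ×ˢ (Metric.closedBall 0 (k + 1 + l : ℝ) ×ˢ Metric.closedBall 0 (k + 1 + l : ℝ))
  have hK : MeasurableSet K :=
    MeasurableSet.univ.prod (measurableSet_closedBall.prod measurableSet_closedBall)
  refine tendsto_lintegral_filter_of_dominated_convergence (K.indicator 1)
    (.of_forall fun n => measurable_scaledIntegrand _ _ _ _ _) (.of_forall fun n => ?_) ?_ ?_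
  · refine .of_forall fun q => ?_
    have hle1 : ∀ S : Set (EuclideanSpace ℝ (Fin d)), ∀ m, unif d S ^ m ≤ 1 := fun S m =>
      pow_le_one' prob_le_one m
    by_cases hq : connInd 1 (Fin.cons 0 q.2.1 : Fin (k + 1) → EuclideanSpace ℝ (Fin d)) q.2.2 = 0
    · simp [scaledIntegrand, hq]
    · have hqK : q ∈ K := ⟨trivial, norm_le_of_connInd_ne_zero hq⟩
      rw [Set.indicator_of_mem hqK, scaledIntegrand]
      refine mul_le_one' (Set.indicator_le_self' (fun _ _ => zero_le) q)
        (mul_le_one' (mul_le_one' ?_ (hle1 _ _)) (hle1 _ _))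
      unfold connInd
      split_ifs <;> simp
  · rw [lintegral_indicator_one hK, Measure.prod_prod, Measure.prod_prod, measure_univ, one_mul]
    exact ENNReal.mul_ne_top measure_closedBall_lt_top.ne measure_closedBall_lt_top.ne
  · have hint : ∀ᵐ q ∂((unif d).prod ((volume : Measure (Fin k → EuclideanSpace ℝ (Fin d))).prod
          (volume : Measure (Fin l → EuclideanSpace ℝ (Fin d))))), q.1 ∈ interior (hcube d) := by
      refine Measure.quasiMeasurePreserving_fst.ae (?_ : ∀ᵐ x ∂unif d, x ∈ interior (hcube d))
      have h0 : ∀ᵐ x ∂unif d, x ∉ frontier (hcube d) := by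
        refine ae_restrict_of_ae ?_
        rw [ae_iff]
        simpa using convex_hcube.addHaar_frontier volume
      filter_upwards [h0, ae_restrict_mem measurableSet_hcube] with x hx hx'
      rw [← self_sdiff_frontier]
      exact ⟨hx', hx⟩
    filter_upwards [hint] with q hq
    have hmem : ∀ {m : ℕ} (w : Fin m → EuclideanSpace ℝ (Fin d)),
        ∀ᶠ n in atTop, ∀ i, q.1 + u n • w i ∈ hcube d := by
      intro m w
      rw [eventually_all]
      intro i
      have : Tendsto (fun n => q.1 + u n • w i) atTop (𝓝 q.1) := by
        simpa using tendsto_const_nhds.add (hu.smul_const (w i))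
      exact this (mem_interior_iff_mem_nhds.1 hq)
    have hpow : ∀ {m : ℕ} (w : Fin m → EuclideanSpace ℝ (Fin d)) {N : ℕ → ℕ} {t : ℝ},
        Tendsto (fun n => (N n : ℝ) * u n ^ d) atTop (𝓝 t) →
        Tendsto (fun n => unif d (farSet (u n) fun j => q.1 + u n • w j) ^ N n) atTop
          (𝓝 (ENNReal.ofReal (Real.exp
            (-(t * (volume (Metric.cthickening 1 (Set.range w))).toReal))))) := by
      intro m w N t hN
      set V := (volume (Metric.cthickening 1 (Set.range w))).toReal
      have hv : Tendsto (fun n => u n ^ d * V) atTop (𝓝 0) := by simpa using hud.mul_const V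
      have h1 := tendsto_one_sub_pow hv (N := N) (t := t * V)
        (by simpa [mul_assoc] using hN.mul_const V)
      refine Tendsto.congr' ?_ (ENNReal.tendsto_ofReal h1)
      filter_upwards [eventually_unif_farSet hq w hu hpos, hv.eventually (gt_mem_nhds zero_lt_one)]
        with n hn hn1
      rw [hn, ENNReal.ofReal_pow (by linarith)]
    have hR := hpow q.2.2 hA
    have hBl := hpow (Fin.cons 0 q.2.1 : Fin (k + 1) → EuclideanSpace ℝ (Fin d)) hB
    have hprod := ENNReal.Tendsto.mul (ENNReal.Tendsto.const_mul (a := connInd 1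
      (Fin.cons 0 q.2.1 : Fin (k + 1) → EuclideanSpace ℝ (Fin d)) q.2.2) hR
      (Or.inr (by unfold connInd; split_ifs <;> simp)))
      (Or.inr ENNReal.ofReal_ne_top) hBl (Or.inr (ENNReal.mul_ne_top
        (by unfold connInd; split_ifs <;> simp) ENNReal.ofReal_ne_top))
    have hval : limitIntegrand (k := k + 1) A B (Fin.cons 0 q.2.1) q.2.2 =
        connInd 1 (Fin.cons 0 q.2.1 : Fin (k + 1) → EuclideanSpace ℝ (Fin d)) q.2.2 *
        ENNReal.ofReal (Real.exp
            (-(A * (volume (Metric.cthickening 1 (Set.range q.2.2))).toReal))) *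
        ENNReal.ofReal (Real.exp (-(B * (volume (Metric.cthickening 1 (Set.range
          (Fin.cons 0 q.2.1 : Fin (k + 1) → EuclideanSpace ℝ (Fin d))))).toReal))) := by
      rw [limitIntegrand, neg_add, Real.exp_add, ENNReal.ofReal_mul (Real.exp_pos _).le, mul_assoc]
    rw [hval]
    refine Tendsto.congr' ?_ hprod
    filter_upwards [hmem q.2.1, hmem q.2.2] with n h1 h2
    have hq : q ∈ {q : EuclideanSpace ℝ (Fin d) ×
        ((Fin k → EuclideanSpace ℝ (Fin d)) × (Fin l → EuclideanSpace ℝ (Fin d))) |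
        (∀ i, q.1 + u n • q.2.1 i ∈ hcube d) ∧ ∀ j, q.1 + u n • q.2.2 j ∈ hcube d} := ⟨h1, h2⟩
    rw [scaledIntegrand, Set.indicator_of_mem hq, Pi.one_apply, one_mul]

end ScalingLimit

/-! ### The limiting number of components -/

section Frequencies

variable {d : ℕ}

/-- The numbers `a n` of red and `b n` of blue points among `n` points have limiting
fractions `α` and `1 - α`. -/
structure ColourFractions (α : ℝ) (a b : ℕ → ℕ) : Prop where
  pos : 0 < α
  lt_one : α < 1
  add_eq : ∀ n, a n + b n = n
  red : Tendsto (fun n => (a n : ℝ) / n) atTop (𝓝 α)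
  blue : Tendsto (fun n => (b n : ℝ) / n) atTop (𝓝 (1 - α))

lemma ColourFractions.swap {α : ℝ} {a b : ℕ → ℕ} (h : ColourFractions α a b) :
    ColourFractions (1 - α) b a where
  pos := sub_pos.2 h.lt_one
  lt_one := by linarith [h.pos]
  add_eq n := by rw [add_comm]; exact h.add_eq n
  red := h.blue
  blue := by simpa using h.red

lemma ColourFractions.tendsto_red_atTop {α : ℝ} {a b : ℕ → ℕ} (h : ColourFractions α a b) :
    Tendsto a atTop atTop := by
  have h1 := h.red.pos_mul_atTop h.pos (tendsto_natCast_atTop_atTop (R := ℝ))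
  rw [← tendsto_natCast_atTop_iff (R := ℝ)]
  refine h1.congr' ?_
  filter_upwards [eventually_gt_atTop 0] with n hn
  have : (n : ℝ) ≠ 0 := by exact_mod_cast hn.ne'
  field_simp

lemma ColourFractions.tendsto_choose {α : ℝ} {a b : ℕ → ℕ} (h : ColourFractions α a b) (k : ℕ) :
    Tendsto (fun n => ((a n).choose k : ℝ) / (n : ℝ) ^ k) atTop (𝓝 (α ^ k / k.factorial)) := by
  have h1 := (isEquivalent_choose k).comp_tendsto h.tendsto_red_atTop
  have h2 := h1.mul (Asymptotics.IsEquivalent.refl (u := fun n : ℕ => ((n : ℝ) ^ k)⁻¹))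
  have h3 := h2.symm.tendsto_nhds (c := α ^ k / k.factorial) ?_
  · exact h3
  · refine ((h.red.pow k).div_const (k.factorial : ℝ)).congr fun n => ?_
    simp only [Function.comp_apply, Pi.mul_apply, div_pow]
    ring

/-- Distances at the scale `n ^ (-1 / d)` of the typical nearest-neighbour distance. -/
noncomputable def scaleDist (d : ℕ) (s : ℝ) (n : ℕ) : ℝ := s * (n : ℝ) ^ (-(1 / (d : ℝ)))

lemma scaleDist_pow (hd : 1 ≤ d) (s : ℝ) (n : ℕ) : scaleDist d s n ^ d = s ^ d / n := by
  have hd' : (d : ℝ) ≠ 0 := by exact_mod_cast (by omega : d ≠ 0)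
  rw [scaleDist, mul_pow, ← Real.rpow_natCast ((n : ℝ) ^ _), ← Real.rpow_mul (Nat.cast_nonneg n),
    neg_mul, one_div_mul_cancel hd', Real.rpow_neg_one, div_eq_mul_inv]

lemma scaleDist_pos {s : ℝ} (hs : 0 < s) {n : ℕ} (hn : 0 < n) : 0 < scaleDist d s n := by
  unfold scaleDist
  have : (0 : ℝ) < n := by exact_mod_cast hn
  positivity

lemma tendsto_scaleDist (hd : 1 ≤ d) (s : ℝ) : Tendsto (scaleDist d s) atTop (𝓝 0) := by
  have hd' : (0 : ℝ) < 1 / d := by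
    have : (0 : ℝ) < d := by exact_mod_cast hd
    positivity
  have := ((tendsto_rpow_neg_atTop hd').comp (tendsto_natCast_atTop_atTop (R := ℝ))).const_mul s
  rw [mul_zero] at this
  exact this

lemma ColourFractions.tendsto_sub_mul {α : ℝ} {a b : ℕ → ℕ} (h : ColourFractions α a b)
    (hd : 1 ≤ d) (s : ℝ) (k : ℕ) :
    Tendsto (fun n => ((a n - k : ℕ) : ℝ) * scaleDist d s n ^ d) atTop (𝓝 (α * s ^ d)) := by
  have h1 : Tendsto (fun n : ℕ => ((a n : ℝ) / n - k / n) * s ^ d) atTop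
      (𝓝 ((α - 0) * s ^ d)) :=
    (h.red.sub (tendsto_const_div_atTop_nhds_zero_nat (k : ℝ))).mul_const _
  rw [sub_zero] at h1
  refine h1.congr' ?_
  filter_upwards [h.tendsto_red_atTop.eventually_ge_atTop k] with n hn
  rw [scaleDist_pow hd, Nat.cast_sub hn]
  ring

/-- The expected number, divided by `n`, of components with `k` red and `l` blue points. -/
noncomputable def compFreq (d : ℕ) (a b : ℕ → ℕ) (s : ℝ) (k l n : ℕ) : ℝ≥0∞ :=
  (a n).choose k * (b n).choose l *
    compProb d (scaleDist d s n) k l (a n - k) (b n - l) / n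

/-- The combinatorial factor of the limiting frequency of components of size `k + l`. -/
noncomputable def freqCoeff (d : ℕ) (α s : ℝ) (k l : ℕ) : ℝ :=
  α ^ k / k.factorial * ((1 - α) ^ l / l.factorial) * s ^ (d * (k + l - 1))

/-- The integral over configurations of `k + 1` red and `l` blue points with a red root at `0`. -/
noncomputable def redRootInt (d : ℕ) (A B : ℝ) (k l : ℕ) : ℝ≥0∞ :=
  ∫⁻ (r : Fin k → EuclideanSpace ℝ (Fin d)) (b : Fin l → EuclideanSpace ℝ (Fin d)),
    limitIntegrand (k := k + 1) A B (Fin.cons 0 r) b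

/-- The integral over configurations of `k` red and `l + 1` blue points with a blue root at `0`. -/
noncomputable def blueRootInt (d : ℕ) (A B : ℝ) (k l : ℕ) : ℝ≥0∞ :=
  ∫⁻ (r : Fin k → EuclideanSpace ℝ (Fin d)) (b : Fin l → EuclideanSpace ℝ (Fin d)),
    limitIntegrand (l := l + 1) A B r (Fin.cons 0 b)

lemma connInd_swap {A B : Type*} (u : ℝ) (r : A → EuclideanSpace ℝ (Fin d))
    (b : B → EuclideanSpace ℝ (Fin d)) : connInd u r b = connInd u b r := by
  have e : levelGraph u r b ≃g levelGraph u b r :=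
    ⟨Equiv.sumComm A B, by
      rintro (i | i) (j | j) <;> simp [levelGraph]⟩
  unfold connInd
  rw [e.connected_iff]

lemma limitIntegrand_swap {k l : ℕ} (A B : ℝ) (r : Fin k → EuclideanSpace ℝ (Fin d))
    (b : Fin l → EuclideanSpace ℝ (Fin d)) :
    limitIntegrand A B r b = limitIntegrand B A b r := by
  rw [limitIntegrand, limitIntegrand, connInd_swap, add_comm]

lemma redRootInt_swap (A B : ℝ) (k l : ℕ) :
    redRootInt d B A l k = blueRootInt d A B k l := by
  unfold redRootInt blueRootInt
  rw [lintegral_lintegral_swap]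
  · refine lintegral_congr fun r => lintegral_congr fun b => ?_
    rw [limitIntegrand_swap]
  · exact (measurable_limitIntegrand measurable_const measurable_const
      (measurable_cons.comp measurable_fst) measurable_snd).aemeasurable

lemma compProb_swap (u : ℝ) (k l k' l' : ℕ) :
    compProb d u k l k' l' = compProb d u l k l' k' := by
  unfold compProb
  rw [lintegral_lintegral_swap]
  · refine lintegral_congr fun r => lintegral_congr fun b => ?_
    rw [connInd_swap, mul_right_comm]
  · exact (((measurable_connInd u measurable_fst measurable_snd).mul
      (((measurable_measure_farSet u l (unif d)).comp measurable_snd).pow_const k')).mul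
      (((measurable_measure_farSet u k (unif d)).comp measurable_fst).pow_const l')).aemeasurable

lemma compFreq_swap (a b : ℕ → ℕ) (s : ℝ) (k l n : ℕ) :
    compFreq d a b s k l n = compFreq d b a s l k n := by
  rw [compFreq, compFreq, compProb_swap, mul_comm ((a n).choose k : ℝ≥0∞)]

/-- Convergence of the frequencies of components with a red point, which serves as the root. -/
theorem tendsto_compFreq_red (hd : 1 ≤ d) {α : ℝ} {a b : ℕ → ℕ} (h : ColourFractions α a b) {s : ℝ}
    (hs : 0 < s) (k l : ℕ) :
    Tendsto (compFreq d a b s (k + 1) l) atTop (𝓝 (ENNReal.ofReal (freqCoeff d α s (k + 1) l) *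
      redRootInt d (α * s ^ d) ((1 - α) * s ^ d) k l)) := by
  have h1 := tendsto_compProb_div k l (tendsto_scaleDist hd s)
    ((eventually_gt_atTop 0).mono fun n hn => scaleDist_pos hs hn)
    (h.tendsto_sub_mul hd s (k + 1)) (h.swap.tendsto_sub_mul hd s l) hd
  have h2 := ((h.tendsto_choose (k + 1)).mul (h.swap.tendsto_choose l)).mul_const
    (s ^ (d * (k + l)))
  have hpos : 0 < α ^ (k + 1) / (k + 1).factorial * ((1 - α) ^ l / l.factorial) *
      s ^ (d * (k + l)) := by
    have := h.pos
    have := h.swap.pos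
    positivity
  have h3 := ENNReal.Tendsto.mul (ENNReal.tendsto_ofReal h2)
    (Or.inl (by rw [Ne, ENNReal.ofReal_eq_zero, not_le]; exact hpos)) h1
    (Or.inr ENNReal.ofReal_ne_top)
  have hcoef : freqCoeff d α s (k + 1) l = α ^ (k + 1) / (k + 1).factorial *
      ((1 - α) ^ l / l.factorial) * s ^ (d * (k + l)) := by
    rw [freqCoeff, (by omega : k + 1 + l - 1 = k + l)]
  rw [hcoef]
  refine h3.congr' ?_
  filter_upwards [eventually_gt_atTop 0] with n hn
  have hn' : (0 : ℝ) < n := by exact_mod_cast hn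
  have hu := scaleDist_pos (d := d) hs hn
  have hpow : scaleDist d s n ^ (d * (k + l)) = s ^ (d * (k + l)) / (n : ℝ) ^ (k + l) := by
    rw [pow_mul, scaleDist_pow hd, div_pow, ← pow_mul]
  have hupos : 0 < scaleDist d s n ^ (d * (k + l)) := by positivity
  have hreal : ((a n).choose (k + 1) : ℝ) / (n : ℝ) ^ (k + 1) *
      (((b n).choose l : ℝ) / (n : ℝ) ^ l) *
      s ^ (d * (k + l)) =
      (a n).choose (k + 1) * (b n).choose l * (n : ℝ)⁻¹ * scaleDist d s n ^ (d * (k + l)) := by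
    rw [hpow, pow_succ, pow_add]
    field_simp
  rw [hreal, ENNReal.ofReal_mul (by positivity), mul_assoc,
    ENNReal.mul_div_cancel (by rwa [Ne, ENNReal.ofReal_eq_zero, not_le]) ENNReal.ofReal_ne_top,
    compFreq, ENNReal.ofReal_mul (by positivity), ENNReal.ofReal_mul (by positivity),
    ENNReal.ofReal_natCast, ENNReal.ofReal_natCast, ENNReal.ofReal_inv_of_pos hn',
    ENNReal.ofReal_natCast, div_eq_mul_inv]
  ring

/-- The same with a blue root, by exchanging the colours. -/
theorem tendsto_compFreq_blue (hd : 1 ≤ d) {α : ℝ} {a b : ℕ → ℕ} (h : ColourFractions α a b)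
    {s : ℝ} (hs : 0 < s) (k l : ℕ) :
    Tendsto (compFreq d a b s k (l + 1)) atTop (𝓝 (ENNReal.ofReal (freqCoeff d α s k (l + 1)) *
      blueRootInt d (α * s ^ d) ((1 - α) * s ^ d) k l)) := by
  have h1 := tendsto_compFreq_red hd h.swap hs l k
  have hc : freqCoeff d (1 - α) s (l + 1) k = freqCoeff d α s k (l + 1) := by
    rw [freqCoeff, freqCoeff, sub_sub_cancel, add_comm k (l + 1)]
    ring
  rw [sub_sub_cancel, redRootInt_swap, hc] at h1
  exact h1.congr fun n => compFreq_swap b a s (l + 1) k n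

lemma freqCoeff_pos {α s : ℝ} (h0 : 0 < α) (h1 : α < 1) (hs : 0 < s) (k l : ℕ) :
    0 < freqCoeff d α s k l := by
  have := sub_pos.2 h1
  unfold freqCoeff
  positivity

/-- The limiting frequency does not depend on the choice of the root: both sides are limits of the
same sequence. -/
lemma redRootInt_eq_blueRootInt (hd : 1 ≤ d) {α : ℝ} {a b : ℕ → ℕ} (h : ColourFractions α a b)
    {s : ℝ} (hs : 0 < s) (k l : ℕ) :
    redRootInt d (α * s ^ d) ((1 - α) * s ^ d) k (l + 1) =
      blueRootInt d (α * s ^ d) ((1 - α) * s ^ d) (k + 1) l := by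
  have h1 := tendsto_nhds_unique (tendsto_compFreq_red hd h hs k (l + 1))
    (tendsto_compFreq_blue hd h hs (k + 1) l)
  refine (ENNReal.mul_right_inj ?_ ENNReal.ofReal_ne_top).1 h1
  rw [Ne, ENNReal.ofReal_eq_zero, not_le]
  exact freqCoeff_pos h.pos h.lt_one hs _ _

/-- The limiting frequency of components with `k` red and `l` blue points. -/
noncomputable def limitFreq (d : ℕ) (α s : ℝ) : ℕ × ℕ → ℝ≥0∞
  | (0, 0) => 0
  | (0, l + 1) => ENNReal.ofReal (freqCoeff d α s 0 (l + 1)) *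
      blueRootInt d (α * s ^ d) ((1 - α) * s ^ d) 0 l
  | (k + 1, l) => ENNReal.ofReal (freqCoeff d α s (k + 1) l) *
      redRootInt d (α * s ^ d) ((1 - α) * s ^ d) k l

lemma tendsto_compFreq (hd : 1 ≤ d) {α : ℝ} {a b : ℕ → ℕ} (h : ColourFractions α a b) {s : ℝ}
    (hs : 0 < s) (q : ℕ × ℕ) :
    Tendsto (fun n => compFreq d a b s q.1 q.2 n) atTop (𝓝 (limitFreq d α s q)) := by
  match q with
  | (0, 0) =>
    have : ∀ n, compFreq d a b s 0 0 n = 0 := by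
      intro n
      have h0 : ∀ (r b : Fin 0 → EuclideanSpace ℝ (Fin d)), connInd (scaleDist d s n) r b = 0 := by
        intro r b
        refine if_neg fun hc => ?_
        obtain ⟨v⟩ := hc.nonempty
        exact isEmptyElim v
      simp [compFreq, compProb, h0]
    simp only [this, limitFreq]
    exact tendsto_const_nhds
  | (0, l + 1) => exact tendsto_compFreq_blue hd h hs 0 l
  | (k + 1, l) => exact tendsto_compFreq_red hd h hs k l

/-- Termwise convergence of a series whose terms have uniformly small weighted tails. -/
lemma tendsto_tsum_of_weight {ι : Type*} {f : ℕ → ι → ℝ≥0∞} {g : ι → ℝ≥0∞} (w : ι → ℕ)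
    (hw : ∀ K, {i | w i ≤ K}.Finite) (hfg : ∀ i, Tendsto (fun n => f n i) atTop (𝓝 (g i)))
    (hf : ∀ n, ∑' i, w i * f n i ≤ 1) :
    Tendsto (fun n => ∑' i, f n i) atTop (𝓝 (∑' i, g i)) := by
  refine tendsto_of_le_liminf_of_limsup_le ?_ ?_
  · rw [ENNReal.tsum_eq_iSup_sum]
    refine iSup_le fun S => ?_
    rw [← (tendsto_finsetSum S fun i _ => hfg i).liminf_eq]
    exact liminf_le_liminf (.of_forall fun n => ENNReal.sum_le_tsum S)
  · have hK : ∀ K : ℕ, limsup (fun n => ∑' i, f n i) atTop ≤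
        ∑' i, g i + ((K + 1 : ℕ) : ℝ≥0∞)⁻¹ := by
      intro K
      have hle : ∀ n, ∑' i, f n i ≤
          ∑ i ∈ (hw K).toFinset, f n i + ((K + 1 : ℕ) : ℝ≥0∞)⁻¹ := by
        intro n
        calc ∑' i, f n i ≤ ∑' i, ((((hw K).toFinset : Set ι).indicator (f n) i) +
              ((K + 1 : ℕ) : ℝ≥0∞)⁻¹ * (w i * f n i)) := by
              refine ENNReal.tsum_le_tsum fun i => ?_
              by_cases hi : w i ≤ K
              · rw [Set.indicator_of_mem (by simpa using hi)]
                exact le_self_add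
              · rw [← mul_assoc]
                refine le_add_of_nonneg_of_le zero_le (le_mul_of_one_le_left zero_le ?_)
                have hwi : ((K + 1 : ℕ) : ℝ≥0∞) ≤ w i := by exact_mod_cast not_le.1 hi
                rw [← ENNReal.inv_mul_cancel (a := ((K + 1 : ℕ) : ℝ≥0∞)) (by simp) (by simp)]
                gcongr
          _ = ∑ i ∈ (hw K).toFinset, f n i + ((K + 1 : ℕ) : ℝ≥0∞)⁻¹ * ∑' i, w i * f n i := by
              rw [ENNReal.tsum_add, ENNReal.tsum_mul_left, ← tsum_subtype,
                Finset.tsum_subtype']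
          _ ≤ _ := by
              gcongr
              exact mul_le_of_le_one_right zero_le (hf n)
      calc _ ≤ limsup (fun n => ∑ i ∈ (hw K).toFinset, f n i + ((K + 1 : ℕ) : ℝ≥0∞)⁻¹) atTop :=
            limsup_le_limsup (.of_forall hle)
        _ = ∑ i ∈ (hw K).toFinset, g i + ((K + 1 : ℕ) : ℝ≥0∞)⁻¹ :=
            ((tendsto_finsetSum _ fun i _ => hfg i).add tendsto_const_nhds).limsup_eq
        _ ≤ _ := by
            gcongr
            exact ENNReal.sum_le_tsum _
    have hlim : Tendsto (fun K : ℕ => ∑' i, g i + ((K + 1 : ℕ) : ℝ≥0∞)⁻¹) atTop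
        (𝓝 (∑' i, g i + 0)) :=
      tendsto_const_nhds.add ((tendsto_add_atTop_iff_nat 1).2 ENNReal.tendsto_inv_nat_nhds_zero)
    rw [add_zero] at hlim
    exact ge_of_tendsto' hlim hK

lemma tsum_compFreq_mul (a b : ℕ → ℕ) (s : ℝ) (φ : ℕ → ℕ → ℝ≥0∞) (n : ℕ) :
    ∑' q : ℕ × ℕ, φ q.1 q.2 * compFreq d a b s q.1 q.2 n =
      (∫⁻ z, componentSum φ (levelGraph (scaleDist d s n) z.1 z.2)
        ∂sampleLaw d (a n) (b n)) / n := by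
  have hin : ∀ k, ∑' l, φ k l * compFreq d a b s k l n =
      ∑ l ∈ Finset.range (b n + 1), φ k l * compFreq d a b s k l n := fun k => by
    refine tsum_eq_sum fun l hl => ?_
    rw [Finset.mem_range, not_lt] at hl
    simp [compFreq, Nat.choose_eq_zero_of_lt (by omega : b n < l)]
  have hout : ∑' k, ∑ l ∈ Finset.range (b n + 1), φ k l * compFreq d a b s k l n =
      ∑ k ∈ Finset.range (a n + 1), ∑ l ∈ Finset.range (b n + 1),
        φ k l * compFreq d a b s k l n := by
    refine tsum_eq_sum fun k hk => ?_
    rw [Finset.mem_range, not_lt] at hk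
    simp [compFreq, Nat.choose_eq_zero_of_lt (by omega : a n < k)]
  rw [ENNReal.tsum_prod (f := fun k l => φ k l * compFreq d a b s k l n)]
  simp_rw [hin]
  rw [hout, lintegral_componentSum, div_eq_mul_inv, Finset.sum_mul]
  refine Finset.sum_congr rfl fun k _ => ?_
  rw [Finset.sum_mul]
  refine Finset.sum_congr rfl fun l _ => ?_
  rw [compFreq, div_eq_mul_inv]
  ring

/-- The law of large numbers for the expected number of components at the critical scale. -/
theorem tendsto_cubeExcess_div (hd : 1 ≤ d) {α : ℝ} {a b : ℕ → ℕ} (h : ColourFractions α a b)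
    {s : ℝ} (hs : 0 < s) :
    Tendsto (fun n => cubeExcess d (a n) (b n) (scaleDist d s n) / n) atTop
      (𝓝 (∑' q, limitFreq d α s q)) := by
  have hmain : Tendsto (fun n => ∑' q : ℕ × ℕ, compFreq d a b s q.1 q.2 n) atTop
      (𝓝 (∑' q, limitFreq d α s q)) := by
    refine tendsto_tsum_of_weight (fun q : ℕ × ℕ => q.1 + q.2) (fun K => ?_)
      (fun q => tendsto_compFreq hd h hs q) fun n => ?_
    · refine ((Set.finite_Iic K).prod (Set.finite_Iic K)).subset ?_
      rintro ⟨k, l⟩ hq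
      have hq' : k + l ≤ K := hq
      exact ⟨Set.mem_Iic.2 (by omega), Set.mem_Iic.2 (by omega)⟩
    · rw [tsum_compFreq_mul a b s (fun k l => ((k + l : ℕ) : ℝ≥0∞)) n]
      simp_rw [componentSum_card, h.add_eq n]
      simp [ENNReal.div_self_le_one]
  have hcomp : ∀ n, ∑' q : ℕ × ℕ, compFreq d a b s q.1 q.2 n =
      (∫⁻ z, levelComp (scaleDist d s n) z.1 z.2 ∂sampleLaw d (a n) (b n)) / n := by
    intro n
    have := tsum_compFreq_mul (d := d) a b s (fun _ _ => 1) n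
    simp only [one_mul, componentSum_one] at this
    exact this
  simp_rw [hcomp] at hmain
  have hinv : Tendsto (fun n : ℕ => ((n : ℝ≥0∞))⁻¹) atTop (𝓝 0) :=
    ENNReal.tendsto_inv_nat_nhds_zero
  have hlow := ENNReal.Tendsto.sub hmain hinv (Or.inr ENNReal.zero_ne_top)
  rw [tsub_zero] at hlow
  refine tendsto_of_tendsto_of_tendsto_of_le_of_le hlow hmain (fun n => ?_) fun n => ?_
  · rw [tsub_le_iff_right, ← one_div, ← ENNReal.add_div]
    refine ENNReal.div_le_div_right ?_ _
    calc _ ≤ ∫⁻ z, ((levelComp (scaleDist d s n) z.1 z.2 - 1) + 1) ∂sampleLaw d (a n) (b n) :=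
          lintegral_mono fun z => le_tsub_add
      _ = _ := by
          rw [lintegral_add_right _ measurable_const]
          simp [cubeExcess]
  · exact ENNReal.div_le_div_right (lintegral_mono fun z => tsub_le_self) _

end Frequencies

/-! ### Integration over the scale -/

section ScaleIntegral

variable {d : ℕ}

lemma lintegral_Ioi_comp_mul {c : ℝ} (hc : 0 < c) (f : ℝ → ℝ≥0∞) :
    ∫⁻ u in Set.Ioi (0 : ℝ), f u = ENNReal.ofReal c * ∫⁻ s in Set.Ioi (0 : ℝ), f (s * c) := by
  have h := lintegral_comp_affine (volume : Measure ℝ) 0 hc ((Set.Ioi (0 : ℝ)).indicator f)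
  rw [lintegral_indicator measurableSet_Ioi, Module.finrank_self, pow_one] at h
  rw [h, ← lintegral_indicator measurableSet_Ioi]
  congr 1
  refine lintegral_congr fun s => ?_
  rw [zero_add, smul_eq_mul, mul_comm c s]
  by_cases hs : 0 < s
  · rw [Set.indicator_of_mem (Set.mem_Ioi.2 (mul_pos hs hc)),
      Set.indicator_of_mem (Set.mem_Ioi.2 hs)]
  · rw [Set.indicator_of_notMem, Set.indicator_of_notMem (by simpa using hs)]
    rw [Set.mem_Ioi, not_lt]
    exact mul_nonpos_of_nonpos_of_nonneg (not_lt.1 hs) hc.le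

/-- The cost in units of `n ^ (1 - p / d)`, as an integral over distances in units of
`n ^ (-1 / d)`. -/
lemma lintegral_div_rpow_eq {p : ℝ} (K : ℝ → ℝ≥0∞) {n : ℕ} (hn : 0 < n)
    (hK : Measurable K) :
    (∫⁻ u in Set.Ioi (0 : ℝ), ENNReal.ofReal (p * u ^ (p - 1)) * K u) /
      ENNReal.ofReal ((n : ℝ) ^ (1 - p / d)) =
    ∫⁻ s in Set.Ioi (0 : ℝ), ENNReal.ofReal (p * s ^ (p - 1)) * (K (scaleDist d s n) / n) := by
  have hn' : (0 : ℝ) < n := by exact_mod_cast hn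
  set c : ℝ := (n : ℝ) ^ (-(1 / (d : ℝ))) with hc
  have hc0 : 0 < c := by positivity
  have hcp : c ^ p * n = (n : ℝ) ^ (1 - p / d) := by
    rw [hc, ← Real.rpow_mul hn'.le, ← Real.rpow_add_one hn'.ne']
    congr 1
    ring
  have hKs : Measurable fun s => K (scaleDist d s n) := by
    unfold scaleDist
    exact hK.comp (by fun_prop)
  have hterm : ∀ s ∈ Set.Ioi (0 : ℝ), ENNReal.ofReal (p * (s * c) ^ (p - 1)) * K (s * c) =
      ENNReal.ofReal (c ^ (p - 1)) * n *
        (ENNReal.ofReal (p * s ^ (p - 1)) * (K (scaleDist d s n) / n)) := by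
    intro s hs
    rw [Real.mul_rpow (le_of_lt hs) hc0.le, ← mul_assoc, mul_comm _ (c ^ (p - 1)),
      ENNReal.ofReal_mul (by positivity), div_eq_mul_inv]
    have h1 : (n : ℝ≥0∞) * (n : ℝ≥0∞)⁻¹ = 1 :=
      ENNReal.mul_inv_cancel (by exact_mod_cast hn.ne') (by simp)
    calc _ = ENNReal.ofReal (c ^ (p - 1)) * ENNReal.ofReal (p * s ^ (p - 1)) * K (s * c) *
          ((n : ℝ≥0∞) * (n : ℝ≥0∞)⁻¹) := by rw [h1, mul_one]
      _ = _ := by rw [scaleDist, ← hc]; ring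
  have hm : Measurable fun s => ENNReal.ofReal (p * s ^ (p - 1)) * (K (scaleDist d s n) / n) :=
    Measurable.mul (by fun_prop) (hKs.div_const _)
  rw [lintegral_Ioi_comp_mul hc0, setLIntegral_congr_fun measurableSet_Ioi hterm,
    lintegral_const_mul _ hm, ← mul_assoc, ← mul_assoc,
    ← ENNReal.ofReal_mul hc0.le, ← ENNReal.ofReal_natCast n, ← ENNReal.ofReal_mul (by positivity)]
  have h2 : c * c ^ (p - 1) * n = (n : ℝ) ^ (1 - p / d) := by
    rw [← hcp, Real.rpow_sub_one hc0.ne']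
    field_simp
  rw [h2, mul_comm, ENNReal.mul_div_cancel_right _ ENNReal.ofReal_ne_top]
  rw [Ne, ENNReal.ofReal_eq_zero, not_le]
  positivity

/-- Eventually both colours occur, in comparable proportions. -/
lemma ColourFractions.exists_ratio {α : ℝ} {a b : ℕ → ℕ} (h : ColourFractions α a b) :
    ∃ c : ℝ, 0 < c ∧ ∀ᶠ n in atTop, 0 < a n ∧ 0 < b n ∧ c * n ≤ a n ∧ c * n ≤ b n ∧
      c * a n ≤ b n ∧ c * b n ≤ a n := by
  have h1 := h.pos
  have h2 := h.swap.pos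
  refine ⟨min α (1 - α) / 2, by positivity, ?_⟩
  have ha := h.red.eventually (lt_mem_nhds (a := min α (1 - α) / 2) (by
    have := min_le_left α (1 - α); linarith [lt_min h1 h2]))
  have hb := h.blue.eventually (lt_mem_nhds (a := min α (1 - α) / 2) (by
    have := min_le_right α (1 - α); linarith [lt_min h1 h2]))
  filter_upwards [ha, hb, eventually_gt_atTop 0, h.tendsto_red_atTop.eventually_gt_atTop 0,
    h.swap.tendsto_red_atTop.eventually_gt_atTop 0] with n han hbn hn ha0 hb0
  have hn' : (0 : ℝ) < n := by exact_mod_cast hn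
  rw [lt_div_iff₀ hn'] at han hbn
  have hab : (a n : ℝ) + b n = n := by exact_mod_cast h.add_eq n
  have hc : 0 < min α (1 - α) / 2 := by positivity
  have ha1 : (a n : ℝ) ≤ n := by linarith [(Nat.cast_nonneg (b n) : (0 : ℝ) ≤ b n)]
  have hb1 : (b n : ℝ) ≤ n := by linarith [(Nat.cast_nonneg (a n) : (0 : ℝ) ≤ a n)]
  refine ⟨ha0, hb0, han.le, hbn.le, ?_, ?_⟩
  · exact (mul_le_mul_of_nonneg_left ha1 hc.le).trans hbn.le
  · exact (mul_le_mul_of_nonneg_left hb1 hc.le).trans han.le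

/-- The dominating function `p * s ^ (p - 1) * min 1 (D / s ^ d)` is integrable for `p < d`. -/
lemma lintegral_dominating_lt_top {p D : ℝ} (hp : 0 < p) (hpd : p < d) :
    ∫⁻ s in Set.Ioi (0 : ℝ), ENNReal.ofReal (p * s ^ (p - 1)) *
      min 1 (ENNReal.ofReal (D * (s ^ d)⁻¹)) < ∞ := by
  rw [← Set.Ioc_union_Ioi_eq_Ioi zero_le_one]
  refine (lintegral_union_le _ _ _).trans_lt (ENNReal.add_lt_top.2 ⟨?_, ?_⟩)
  · have hint : IntegrableOn (fun s : ℝ => p * s ^ (p - 1)) (Set.Ioc 0 1) := by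
      have := (intervalIntegral.intervalIntegrable_rpow' (a := 0) (b := 1) (r := p - 1)
        (by linarith)).const_mul p
      rwa [intervalIntegrable_iff_integrableOn_Ioc_of_le zero_le_one] at this
    refine lt_of_le_of_lt (lintegral_mono fun s => ?_) hint.lintegral_lt_top
    exact mul_le_of_le_one_right zero_le (min_le_left _ _)
  · have hint : IntegrableOn (fun s : ℝ => p * D * s ^ (p - 1 - d)) (Set.Ioi 1) :=
      (integrableOn_Ioi_rpow_of_lt (by linarith) zero_lt_one).const_mul _
    refine lt_of_le_of_lt (setLIntegral_mono' measurableSet_Ioi fun s hs => ?_)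
      hint.lintegral_lt_top
    have hs0 : (0 : ℝ) < s := zero_lt_one.trans hs
    calc _ ≤ ENNReal.ofReal (p * s ^ (p - 1)) * ENNReal.ofReal (D * (s ^ d)⁻¹) := by
          gcongr
          exact min_le_right _ _
      _ = _ := by
          rw [← ENNReal.ofReal_mul (by positivity)]
          congr 1
          rw [Real.rpow_sub_natCast hs0.ne']
          ring

lemma measurable_joint_limitIntegrand {Ω : Type*} [MeasurableSpace Ω] {k l : ℕ} (α : ℝ)
    {r : Ω → Fin k → EuclideanSpace ℝ (Fin d)} {b : Ω → Fin l → EuclideanSpace ℝ (Fin d)}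
    (hr : Measurable r) (hb : Measurable b) :
    Measurable fun q : ℝ × Ω =>
      limitIntegrand (α * q.1 ^ d) ((1 - α) * q.1 ^ d) (r q.2) (b q.2) := by
  exact measurable_limitIntegrand (by fun_prop) (by fun_prop) (hr.comp measurable_snd)
    (hb.comp measurable_snd)

lemma redRootInt_eq_lintegral_prod (A B : ℝ) (k l : ℕ) :
    redRootInt d A B k l = ∫⁻ c : (Fin k → EuclideanSpace ℝ (Fin d)) ×
      (Fin l → EuclideanSpace ℝ (Fin d)),
        limitIntegrand (k := k + 1) A B (Fin.cons 0 c.1) c.2 := by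
  have hm := measurable_limitIntegrand (d := d) (Ω := (Fin k → EuclideanSpace ℝ (Fin d)) ×
    (Fin l → EuclideanSpace ℝ (Fin d))) (measurable_const (a := A)) (measurable_const (a := B))
    (measurable_cons.comp measurable_fst) measurable_snd
  exact (lintegral_prod _ hm.aemeasurable).symm

lemma blueRootInt_eq_lintegral_prod (A B : ℝ) (k l : ℕ) :
    blueRootInt d A B k l = ∫⁻ c : (Fin k → EuclideanSpace ℝ (Fin d)) ×
      (Fin l → EuclideanSpace ℝ (Fin d)),
        limitIntegrand (l := l + 1) A B c.1 (Fin.cons 0 c.2) := by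
  have hm := measurable_limitIntegrand (d := d) (Ω := (Fin k → EuclideanSpace ℝ (Fin d)) ×
    (Fin l → EuclideanSpace ℝ (Fin d))) (measurable_const (a := A)) (measurable_const (a := B))
    measurable_fst (measurable_cons.comp measurable_snd)
  exact (lintegral_prod _ hm.aemeasurable).symm

lemma measurable_freqCoeff (α : ℝ) (k l : ℕ) : Measurable fun s => freqCoeff d α s k l := by
  unfold freqCoeff
  fun_prop

lemma measurable_limitFreq (α : ℝ) (q : ℕ × ℕ) : Measurable fun s => limitFreq d α s q := by
  match q with
  | (0, 0) => exact measurable_const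
  | (0, l + 1) =>
    have h := (measurable_joint_limitIntegrand (d := d)
      (Ω := (Fin 0 → EuclideanSpace ℝ (Fin d)) × (Fin l → EuclideanSpace ℝ (Fin d))) α
      measurable_fst (measurable_cons.comp measurable_snd)).lintegral_prod_right' (ν := volume)
    simp only [limitFreq, blueRootInt_eq_lintegral_prod]
    exact (measurable_freqCoeff α 0 (l + 1)).ennreal_ofReal.mul h
  | (k + 1, l) =>
    have h := (measurable_joint_limitIntegrand (d := d)
      (Ω := (Fin k → EuclideanSpace ℝ (Fin d)) × (Fin l → EuclideanSpace ℝ (Fin d))) α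
      (measurable_cons.comp measurable_fst) measurable_snd).lintegral_prod_right' (ν := volume)
    simp only [limitFreq, redRootInt_eq_lintegral_prod]
    exact (measurable_freqCoeff α (k + 1) l).ennreal_ofReal.mul h

/-- The limit of the rescaled cube cost, as an integral over the scale, with its finiteness. -/
theorem tendsto_cube_integral (hd : 1 ≤ d) {α : ℝ} {a b : ℕ → ℕ} (h : ColourFractions α a b) {p : ℝ}
    (hp : 0 < p) (hpd : p < d) :
    Tendsto (fun n : ℕ => (∫⁻ u in Set.Ioi (0 : ℝ), ENNReal.ofReal (p * u ^ (p - 1)) *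
        cubeExcess d (a n) (b n) u) / ENNReal.ofReal ((n : ℝ) ^ (1 - p / d))) atTop
      (𝓝 (∫⁻ s in Set.Ioi (0 : ℝ), ENNReal.ofReal (p * s ^ (p - 1)) * ∑' q, limitFreq d α s q)) ∧
    ∫⁻ s in Set.Ioi (0 : ℝ), ENNReal.ofReal (p * s ^ (p - 1)) * ∑' q, limitFreq d α s q < ∞ := by
  obtain ⟨c, hc, hev⟩ := h.exists_ratio
  set D : ℝ := (2 * √d) ^ d * (1 + 2 / c) with hD
  have hbound : ∀ᶠ n : ℕ in atTop, ∀ s ∈ Set.Ioi (0 : ℝ),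
      cubeExcess d (a n) (b n) (scaleDist d s n) / n ≤
        min 1 (ENNReal.ofReal (D * (s ^ d)⁻¹)) := by
    filter_upwards [hev, eventually_gt_atTop 0] with n hn hn0 s hs
    obtain ⟨ha, hb, -, -, hab, hba⟩ := hn
    have hs' : (0 : ℝ) < s := hs
    have hn' : (0 : ℝ) < n := by exact_mod_cast hn0
    have hne : (n : ℝ≥0∞) ≠ 0 := by exact_mod_cast hn0.ne'
    refine le_min ?_ ?_
    · refine ENNReal.div_le_of_le_mul ?_
      rw [one_mul]
      refine (cubeExcess_le_card d (a n) (b n) _).trans ?_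
      rw [h.add_eq n]
    · refine ENNReal.div_le_of_le_mul ?_
      refine (cubeExcess_le_inv_pow hd ha hb hc hab hba (scaleDist_pos hs hn0)).trans ?_
      rw [scaleDist_pow hd, ← ENNReal.ofReal_natCast n, ← ENNReal.ofReal_mul (by positivity)]
      refine ENNReal.ofReal_le_ofReal (le_of_eq ?_)
      rw [hD]
      field_simp
  have hlim : ∀ s ∈ Set.Ioi (0 : ℝ), Tendsto (fun n : ℕ => ENNReal.ofReal (p * s ^ (p - 1)) *
      (cubeExcess d (a n) (b n) (scaleDist d s n) / n)) atTop
      (𝓝 (ENNReal.ofReal (p * s ^ (p - 1)) * ∑' q, limitFreq d α s q)) := fun s hs =>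
    ENNReal.Tendsto.const_mul (tendsto_cubeExcess_div hd h hs) (Or.inr ENNReal.ofReal_ne_top)
  have hfin := lintegral_dominating_lt_top (d := d) (D := D) hp hpd
  constructor
  · have hdom := tendsto_lintegral_filter_of_dominated_convergence
      (μ := volume.restrict (Set.Ioi (0 : ℝ))) (l := atTop)
      (F := fun (n : ℕ) s => ENNReal.ofReal (p * s ^ (p - 1)) *
        (cubeExcess d (a n) (b n) (scaleDist d s n) / n))
      (f := fun s => ENNReal.ofReal (p * s ^ (p - 1)) * ∑' q, limitFreq d α s q)
      (fun s => ENNReal.ofReal (p * s ^ (p - 1)) * min 1 (ENNReal.ofReal (D * (s ^ d)⁻¹)))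
      (.of_forall fun n => ?_) ?_ hfin.ne ?_
    · refine hdom.congr' ?_
      filter_upwards [eventually_gt_atTop 0] with n hn
      exact (lintegral_div_rpow_eq _ hn (measurable_cubeExcess d _ _)).symm
    · refine Measurable.mul (by fun_prop) (Measurable.div_const ?_ _)
      refine (measurable_cubeExcess d _ _).comp ?_
      unfold scaleDist
      fun_prop
    · filter_upwards [hbound] with n hn
      filter_upwards [ae_restrict_mem measurableSet_Ioi] with s hs
      gcongr
      exact hn s hs
    · filter_upwards [ae_restrict_mem measurableSet_Ioi] with s hs
      exact hlim s hs
  · refine lt_of_le_of_lt (setLIntegral_mono' measurableSet_Ioi fun s hs => ?_) hfin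
    gcongr
    exact le_of_tendsto (tendsto_cubeExcess_div hd h hs) (hbound.mono fun n hn => hn s hs)

end ScaleIntegral

/-! ### Evaluation of the limit constant -/

section LimitConstant

variable {d : ℕ}

lemma lintegral_rpow_mul_exp_neg_mul_pow (hd : 1 ≤ d) {p W : ℝ} (hp : 0 < p) (hW : 0 < W) (m : ℕ) :
    ∫⁻ s in Set.Ioi (0 : ℝ), ENNReal.ofReal (p * s ^ (p - 1)) *
      ENNReal.ofReal (s ^ (d * m) * Real.exp (-(W * s ^ d))) =
    ENNReal.ofReal (p / d * Real.Gamma (m + p / d)) * ENNReal.ofReal W ^ (-(m + p / d)) := by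
  have hd' : (0 : ℝ) < d := by exact_mod_cast hd
  have hq : -1 < p - 1 + d * m := by
    have : (0 : ℝ) ≤ d * m := by positivity
    linarith
  have hterm : ∀ s ∈ Set.Ioi (0 : ℝ), ENNReal.ofReal (p * s ^ (p - 1)) *
      ENNReal.ofReal (s ^ (d * m) * Real.exp (-(W * s ^ d))) =
      ENNReal.ofReal (p * (s ^ (p - 1 + d * m) * Real.exp (-W * s ^ (d : ℝ)))) := by
    intro s hs
    have hs' : (0 : ℝ) < s := hs
    rw [← ENNReal.ofReal_mul (by positivity), Real.rpow_natCast, Real.rpow_add hs',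
      ← Nat.cast_mul, Real.rpow_natCast, neg_mul]
    congr 1
    ring
  rw [setLIntegral_congr_fun measurableSet_Ioi hterm, ← ofReal_integral_eq_lintegral_ofReal,
    integral_const_mul, integral_rpow_mul_exp_neg_mul_rpow hd' hq hW,
    ENNReal.ofReal_rpow_of_pos hW, ← ENNReal.ofReal_mul]
  · congr 1
    have h1 : -(p - 1 + d * m + 1) / (d : ℝ) = -(m + p / d) := by
      field_simp
      ring
    have h2 : (p - 1 + d * m + 1) / (d : ℝ) = m + p / d := by
      field_simp
      ring
    rw [h1, h2]
    ring
  · have : 0 < Real.Gamma (m + p / d) := Real.Gamma_pos_of_pos (by positivity)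
    positivity
  · exact (integrableOn_rpow_mul_exp_neg_mul_rpow hq hd' hW).const_mul p
  · filter_upwards [ae_restrict_mem measurableSet_Ioi] with s hs
    have hs' : (0 : ℝ) < s := hs
    simp only [Pi.zero_apply]
    positivity

/-- The average volume `α |D(b)| + (1 - α) |D(r)|` of the forbidden regions of a configuration. -/
noncomputable def forbiddenVolume {k l : ℕ} (α : ℝ) (r : Fin k → EuclideanSpace ℝ (Fin d))
    (b : Fin l → EuclideanSpace ℝ (Fin d)) : ℝ :=
  α * (volume (Metric.cthickening 1 (Set.range b))).toReal +
    (1 - α) * (volume (Metric.cthickening 1 (Set.range r))).toReal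

lemma volume_cthickening_range_pos {l : ℕ} (hl : l ≠ 0) (b : Fin l → EuclideanSpace ℝ (Fin d)) :
    0 < (volume (Metric.cthickening 1 (Set.range b))).toReal := by
  refine ENNReal.toReal_pos (ne_of_gt ?_) (volume_cthickening_lt_top b).ne
  refine lt_of_lt_of_le (Metric.measure_closedBall_pos volume (b ⟨0, by omega⟩) one_pos)
    (measure_mono ?_)
  exact Metric.closedBall_subset_cthickening (Set.mem_range_self _) 1

lemma forbiddenVolume_pos {k l : ℕ} {α : ℝ} (h0 : 0 < α) (h1 : α < 1) (hkl : k + l ≠ 0)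
    (r : Fin k → EuclideanSpace ℝ (Fin d)) (b : Fin l → EuclideanSpace ℝ (Fin d)) :
    0 < forbiddenVolume α r b := by
  have h1' := sub_pos.2 h1
  rcases eq_or_ne l 0 with hl | hl
  · have := volume_cthickening_range_pos (by omega : k ≠ 0) r
    unfold forbiddenVolume
    positivity
  · have := volume_cthickening_range_pos hl b
    unfold forbiddenVolume
    positivity

lemma limitIntegrand_eq {k l : ℕ} (α t : ℝ) (r : Fin k → EuclideanSpace ℝ (Fin d))
    (b : Fin l → EuclideanSpace ℝ (Fin d)) :
    limitIntegrand (α * t) ((1 - α) * t) r b =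
      connInd 1 r b * ENNReal.ofReal (Real.exp (-(forbiddenVolume α r b * t))) := by
  rw [limitIntegrand, forbiddenVolume]
  congr 4
  ring

lemma configDensity_eq {k l : ℕ} {α : ℝ} (h0 : 0 < α) (h1 : α < 1) (σ : ℝ)
    (r : Fin k → EuclideanSpace ℝ (Fin d)) (b : Fin l → EuclideanSpace ℝ (Fin d)) :
    configDensity α σ r b = connInd 1 r b * ENNReal.ofReal (forbiddenVolume α r b) ^ (-σ) := by
  have h1' := sub_pos.2 h1
  have hW : ENNReal.ofReal (forbiddenVolume α r b) =
      ENNReal.ofReal α * volume (Metric.cthickening 1 (Set.range b)) +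
      ENNReal.ofReal (1 - α) * volume (Metric.cthickening 1 (Set.range r)) := by
    rw [forbiddenVolume, ENNReal.ofReal_add (by positivity) (by positivity),
      ENNReal.ofReal_mul h0.le, ENNReal.ofReal_mul h1'.le,
      ENNReal.ofReal_toReal (volume_cthickening_lt_top _).ne,
      ENNReal.ofReal_toReal (volume_cthickening_lt_top _).ne]
  rw [hW, configDensity, connInd]
  by_cases hc : (levelGraph 1 r b).Connected
  · rw [if_pos hc, one_mul, Set.indicator_of_mem]
    exact hc
  · rw [if_neg hc, zero_mul, Set.indicator_of_notMem]
    exact hc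

lemma measurable_configDensity {Ω : Type*} [MeasurableSpace Ω] {k l : ℕ} {α : ℝ} (h0 : 0 < α)
    (h1 : α < 1) (σ : ℝ) {r : Ω → Fin k → EuclideanSpace ℝ (Fin d)}
    {b : Ω → Fin l → EuclideanSpace ℝ (Fin d)} (hr : Measurable r) (hb : Measurable b) :
    Measurable fun ω => configDensity α σ (r ω) (b ω) := by
  simp_rw [configDensity_eq h0 h1]
  refine (measurable_connInd 1 hr hb).mul (Measurable.pow_const ?_ _)
  exact ((((measurable_volume_cthickening l).comp hb).const_mul α).add
    (((measurable_volume_cthickening k).comp hr).const_mul (1 - α))).ennreal_ofReal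

/-- Integrating the limiting frequency over the scale turns the exponential weight of a
configuration into a power of the volume of its forbidden regions. -/
lemma lintegral_freqCoeff_mul {Ω : Type*} [MeasurableSpace Ω] (μ : Measure Ω) [SFinite μ] {k l : ℕ}
    (hd : 1 ≤ d) {p α : ℝ} (hp : 0 < p) (h0 : 0 < α) (h1 : α < 1) (hkl : k + l ≠ 0)
    {r : Ω → Fin k → EuclideanSpace ℝ (Fin d)} {b : Ω → Fin l → EuclideanSpace ℝ (Fin d)}
    (hr : Measurable r) (hb : Measurable b) :
    ∫⁻ s in Set.Ioi (0 : ℝ), ENNReal.ofReal (p * s ^ (p - 1)) *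
      (ENNReal.ofReal (freqCoeff d α s k l) *
        ∫⁻ ω, limitIntegrand (α * s ^ d) ((1 - α) * s ^ d) (r ω) (b ω) ∂μ) =
    ENNReal.ofReal (p / d * (α ^ k / k.factorial) * ((1 - α) ^ l / l.factorial) *
      Real.Gamma ((k + l - 1 : ℕ) + p / d)) *
        ∫⁻ ω, configDensity α ((k + l - 1 : ℕ) + p / d) (r ω) (b ω) ∂μ := by
  have h1' := sub_pos.2 h1
  set m := k + l - 1 with hm
  set c : ℝ := α ^ k / k.factorial * ((1 - α) ^ l / l.factorial) with hc
  have hc0 : 0 < c := by positivity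
  have hjoint := measurable_joint_limitIntegrand α hr hb
  have hfm : Measurable fun q : ℝ × Ω => ENNReal.ofReal (p * q.1 ^ (p - 1)) *
      (ENNReal.ofReal (freqCoeff d α q.1 k l) *
        limitIntegrand (α * q.1 ^ d) ((1 - α) * q.1 ^ d) (r q.2) (b q.2)) :=
    Measurable.mul (by fun_prop)
      (((measurable_freqCoeff α k l).comp measurable_fst).ennreal_ofReal.mul hjoint)
  have hslice : ∀ s, Measurable fun ω =>
      limitIntegrand (α * s ^ d) ((1 - α) * s ^ d) (r ω) (b ω) := fun s =>
    measurable_limitIntegrand measurable_const measurable_const hr hb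
  have hslice' : ∀ s, Measurable fun ω => ENNReal.ofReal (freqCoeff d α s k l) *
      limitIntegrand (α * s ^ d) ((1 - α) * s ^ d) (r ω) (b ω) := fun s => (hslice s).const_mul _
  have hcd := measurable_configDensity h0 h1 (m + p / d) hr hb
  calc _ = ∫⁻ s in Set.Ioi (0 : ℝ), ∫⁻ ω, ENNReal.ofReal (p * s ^ (p - 1)) *
        (ENNReal.ofReal (freqCoeff d α s k l) *
          limitIntegrand (α * s ^ d) ((1 - α) * s ^ d) (r ω) (b ω)) ∂μ := by
        refine lintegral_congr fun s => ?_
        rw [lintegral_const_mul _ (hslice' s), lintegral_const_mul _ (hslice s)]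
    _ = ∫⁻ ω, (∫⁻ s in Set.Ioi (0 : ℝ), ENNReal.ofReal (p * s ^ (p - 1)) *
        (ENNReal.ofReal (freqCoeff d α s k l) *
          limitIntegrand (α * s ^ d) ((1 - α) * s ^ d) (r ω) (b ω))) ∂μ :=
        lintegral_lintegral_swap hfm.aemeasurable
    _ = ∫⁻ ω, ENNReal.ofReal (p / d * c * Real.Gamma (m + p / d)) *
        configDensity α (m + p / d) (r ω) (b ω) ∂μ := by
        refine lintegral_congr fun ω => ?_
        have hW := forbiddenVolume_pos h0 h1 hkl (r ω) (b ω)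
        have hterm : ∀ s ∈ Set.Ioi (0 : ℝ), ENNReal.ofReal (p * s ^ (p - 1)) *
            (ENNReal.ofReal (freqCoeff d α s k l) *
              limitIntegrand (α * s ^ d) ((1 - α) * s ^ d) (r ω) (b ω)) =
            (ENNReal.ofReal c * connInd 1 (r ω) (b ω)) * (ENNReal.ofReal (p * s ^ (p - 1)) *
              ENNReal.ofReal (s ^ (d * m) *
                Real.exp (-(forbiddenVolume α (r ω) (b ω) * s ^ d)))) := by
          intro s hs
          have hs' : (0 : ℝ) < s := hs
          rw [limitIntegrand_eq, freqCoeff, ← hm, ← hc, ENNReal.ofReal_mul hc0.le,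
            ENNReal.ofReal_mul (by positivity : 0 ≤ s ^ (d * m))]
          ring
        have hmeas : Measurable fun s : ℝ => ENNReal.ofReal (p * s ^ (p - 1)) *
            ENNReal.ofReal (s ^ (d * m) *
              Real.exp (-(forbiddenVolume α (r ω) (b ω) * s ^ d))) := by fun_prop
        rw [setLIntegral_congr_fun measurableSet_Ioi hterm, lintegral_const_mul _ hmeas,
          lintegral_rpow_mul_exp_neg_mul_pow hd hp hW, configDensity_eq h0 h1,
          mul_right_comm _ c, mul_comm _ c, ENNReal.ofReal_mul hc0.le]
        ring
    _ = _ := by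
        rw [lintegral_const_mul _ hcd, hc, ← mul_assoc (p / d)]

lemma connInd_eq_zero_of_red_eq_zero {l : ℕ} (u : ℝ) (r : Fin 0 → EuclideanSpace ℝ (Fin d))
    (b : Fin (l + 2) → EuclideanSpace ℝ (Fin d)) : connInd u r b = 0 := by
  refine if_neg fun hc => ?_
  have : Nontrivial (Fin 0 ⊕ Fin (l + 2)) := Sum.inr_injective.nontrivial
  obtain ⟨v, hv, -⟩ := hc.preconnected.exists_adj_of_nontrivial (Sum.inr 0)
  rcases v with v | v
  · exact isEmptyElim v
  · simp at hv

lemma configDensity_swap {k l : ℕ} {α : ℝ} (h0 : 0 < α) (h1 : α < 1) (σ : ℝ)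
    (r : Fin k → EuclideanSpace ℝ (Fin d)) (b : Fin l → EuclideanSpace ℝ (Fin d)) :
    configDensity α σ r b = configDensity (1 - α) σ b r := by
  rw [configDensity_eq h0 h1, configDensity_eq (by linarith) (by linarith), connInd_swap,
    forbiddenVolume, forbiddenVolume, sub_sub_cancel, add_comm]

lemma configDensity_eq_zero_of_red_eq_zero {l : ℕ} {α : ℝ} (h0 : 0 < α) (h1 : α < 1) (σ : ℝ)
    (r : Fin 0 → EuclideanSpace ℝ (Fin d)) (b : Fin (l + 2) → EuclideanSpace ℝ (Fin d)) :
    configDensity α σ r b = 0 := by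
  rw [configDensity_eq h0 h1, connInd_eq_zero_of_red_eq_zero, zero_mul]

lemma configDensity_isolated {α : ℝ} (h0 : 0 < α) (h1 : α < 1) (σ : ℝ)
    (r b : Fin 0 → EuclideanSpace ℝ (Fin d)) :
    configDensity (l := 1) α σ r (Fin.cons 0 b) = ENNReal.ofReal (α ^ (-σ)) *
      volume (Metric.closedBall (0 : EuclideanSpace ℝ (Fin d)) 1) ^ (-σ) := by
  have hc : (levelGraph (B := Fin 1) 1 r (Fin.cons 0 b)).Connected := by
    have : Nonempty (Fin 0 ⊕ Fin 1) := ⟨Sum.inr 0⟩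
    have : Subsingleton (Fin 0 ⊕ Fin 1) := (Equiv.emptySum (Fin 0) (Fin 1)).subsingleton
    exact ⟨SimpleGraph.Preconnected.of_subsingleton⟩
  have hb : Set.range (Fin.cons 0 b : Fin 1 → EuclideanSpace ℝ (Fin d)) = {0} := by
    ext x
    simp
  have hr : Set.range r = ∅ := Set.range_eq_empty r
  have hW : forbiddenVolume (l := 1) α r (Fin.cons 0 b) =
      α * (volume (Metric.closedBall (0 : EuclideanSpace ℝ (Fin d)) 1)).toReal := by
    rw [forbiddenVolume, hb, hr, Metric.cthickening_singleton _ zero_le_one,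
      Metric.cthickening_empty]
    simp
  rw [configDensity_eq h0 h1, connInd, if_pos hc, one_mul, hW, ENNReal.ofReal_mul h0.le,
    ENNReal.ofReal_toReal measure_closedBall_lt_top.ne,
    ENNReal.mul_rpow_of_ne_top ENNReal.ofReal_ne_top measure_closedBall_lt_top.ne,
    ENNReal.ofReal_rpow_of_pos h0]

/-- The contribution to the limit of the components with `q.1` red and `q.2` blue points. -/
noncomputable def limitMass (d : ℕ) (p α : ℝ) (q : ℕ × ℕ) : ℝ≥0∞ :=
  ∫⁻ s in Set.Ioi (0 : ℝ), ENNReal.ofReal (p * s ^ (p - 1)) * limitFreq d α s q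

/-- The coefficient in `limitMass` of the integral over configurations with a root at the origin. -/
noncomputable def massCoeff (d k l : ℕ) (p α : ℝ) : ℝ :=
  p / d * (α ^ k / k.factorial) * ((1 - α) ^ l / l.factorial) *
    Real.Gamma ((k + l - 1 : ℕ) + p / d)

lemma limitMass_red (hd : 1 ≤ d) {p α : ℝ} (hp : 0 < p) (h0 : 0 < α) (h1 : α < 1) (k l : ℕ) :
    limitMass d p α (k + 1, l) = ENNReal.ofReal (massCoeff d (k + 1) l p α) *
      ∫⁻ (r : Fin k → EuclideanSpace ℝ (Fin d)) (b : Fin l → EuclideanSpace ℝ (Fin d)),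
        configDensity (k := k + 1) α ((k + 1 + l - 1 : ℕ) + p / d) (Fin.cons 0 r) b := by
  have hm := measurable_configDensity (d := d) (Ω := (Fin k → EuclideanSpace ℝ (Fin d)) ×
    (Fin l → EuclideanSpace ℝ (Fin d))) h0 h1 ((k + 1 + l - 1 : ℕ) + p / d)
    (measurable_cons.comp measurable_fst) measurable_snd
  have h := lintegral_freqCoeff_mul (d := d) (volume : Measure ((Fin k → EuclideanSpace ℝ (Fin d)) ×
    (Fin l → EuclideanSpace ℝ (Fin d)))) hd hp h0 h1 (by omega : k + 1 + l ≠ 0)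
    (measurable_cons.comp measurable_fst) measurable_snd
  rw [limitMass, massCoeff]
  simp only [limitFreq, redRootInt_eq_lintegral_prod]
  exact h.trans (congrArg _ (lintegral_prod _ hm.aemeasurable))

lemma limitMass_blue (hd : 1 ≤ d) {p α : ℝ} (hp : 0 < p) (h0 : 0 < α) (h1 : α < 1) (k l : ℕ) :
    ∫⁻ s in Set.Ioi (0 : ℝ), ENNReal.ofReal (p * s ^ (p - 1)) *
      (ENNReal.ofReal (freqCoeff d α s k (l + 1)) *
        blueRootInt d (α * s ^ d) ((1 - α) * s ^ d) k l) =
    ENNReal.ofReal (massCoeff d k (l + 1) p α) *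
      ∫⁻ (r : Fin k → EuclideanSpace ℝ (Fin d)) (b : Fin l → EuclideanSpace ℝ (Fin d)),
        configDensity (l := l + 1) α ((k + (l + 1) - 1 : ℕ) + p / d) r (Fin.cons 0 b) := by
  have hm := measurable_configDensity (d := d) (Ω := (Fin k → EuclideanSpace ℝ (Fin d)) ×
    (Fin l → EuclideanSpace ℝ (Fin d))) h0 h1 ((k + (l + 1) - 1 : ℕ) + p / d)
    measurable_fst (measurable_cons.comp measurable_snd)
  have h := lintegral_freqCoeff_mul (d := d) (volume : Measure ((Fin k → EuclideanSpace ℝ (Fin d)) ×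
    (Fin l → EuclideanSpace ℝ (Fin d)))) hd hp h0 h1 (by omega : k + (l + 1) ≠ 0)
    measurable_fst (measurable_cons.comp measurable_snd)
  rw [massCoeff]
  simp only [blueRootInt_eq_lintegral_prod]
  exact h.trans (congrArg _ (lintegral_prod _ hm.aemeasurable))

/-- Averaging over the two kinds of roots, with weights proportional to the numbers of red and
blue points, produces the summand of the series for the limit constant. -/
lemma limitMass_succ_succ (hd : 1 ≤ d) {α : ℝ} {a b : ℕ → ℕ} (h : ColourFractions α a b) {p : ℝ}
    (hp : 0 < p) (k l : ℕ) :
    limitMass d p α (k + 1, l + 1) = ENNReal.ofReal (betaCoeff d (k + 1) (l + 1) p α) *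
      configIntegral d k l α ((k + 1 : ℝ) + (l + 1) - 1 + p / d) := by
  have hred := limitMass_red hd hp h.pos h.lt_one k (l + 1)
  have hblue := limitMass_blue hd hp h.pos h.lt_one (k + 1) l
  have hrb : limitMass d p α (k + 1, l + 1) = ∫⁻ s in Set.Ioi (0 : ℝ),
      ENNReal.ofReal (p * s ^ (p - 1)) * (ENNReal.ofReal (freqCoeff d α s (k + 1) (l + 1)) *
        blueRootInt d (α * s ^ d) ((1 - α) * s ^ d) (k + 1) l) := by
    refine setLIntegral_congr_fun measurableSet_Ioi fun s hs => ?_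
    simp only [limitFreq]
    rw [redRootInt_eq_blueRootInt hd h hs]
  rw [← hrb] at hblue
  have hσ : ((k + 1 + (l + 1) - 1 : ℕ) : ℝ) = (k + 1 : ℝ) + (l + 1) - 1 := by
    rw [(by omega : k + 1 + (l + 1) - 1 = k + l + 1)]
    push_cast
    ring
  have hN : (0 : ℝ) < (k + 1 : ℕ) + (l + 1 : ℕ) := by positivity
  have hcoef : betaCoeff d (k + 1) (l + 1) p α =
      ((k + 1 : ℕ) + (l + 1 : ℕ) : ℝ)⁻¹ * massCoeff d (k + 1) (l + 1) p α := by
    rw [betaCoeff, massCoeff, hσ]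
    push_cast
    ring
  rw [hσ] at hred hblue
  rw [configIntegral, hcoef, ENNReal.ofReal_mul (by positivity), mul_add]
  have h1 : ∀ (m : ℕ) (I : ℝ≥0∞), ENNReal.ofReal ((k + 1 : ℕ) + (l + 1 : ℕ) : ℝ)⁻¹ *
      ENNReal.ofReal (massCoeff d (k + 1) (l + 1) p α) * (m * I) =
      ENNReal.ofReal (((k + 1 : ℕ) + (l + 1 : ℕ) : ℝ)⁻¹ * m) *
        (ENNReal.ofReal (massCoeff d (k + 1) (l + 1) p α) * I) := by
    intro m I
    rw [ENNReal.ofReal_mul (by positivity), ENNReal.ofReal_natCast]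
    ring
  rw [h1, h1, ← hred, ← hblue, ← add_mul, ← ENNReal.ofReal_add (by positivity) (by positivity),
    ← mul_add, inv_mul_cancel₀ hN.ne', ENNReal.ofReal_one, one_mul]

/-- The integral of the limiting frequencies over all scales is the limit constant. -/
theorem lintegral_tsum_limitFreq (hd : 1 ≤ d) {α : ℝ} {a b : ℕ → ℕ} (h : ColourFractions α a b)
    {p : ℝ} (hp : 0 < p) :
    ∫⁻ s in Set.Ioi (0 : ℝ), ENNReal.ofReal (p * s ^ (p - 1)) * ∑' q, limitFreq d α s q =
      betaBMST d p α := by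
  have h0 := h.pos
  have h1 := h.lt_one
  have h1' := sub_pos.2 h1
  have hd' : (0 : ℝ) < d := by exact_mod_cast hd
  have hΓ : 0 < Real.Gamma (p / d) := Real.Gamma_pos_of_pos (by positivity)
  have hm : ∀ q, Measurable fun s : ℝ => ENNReal.ofReal (p * s ^ (p - 1)) * limitFreq d α s q :=
    fun q => Measurable.mul (by fun_prop) (measurable_limitFreq α q)
  simp_rw [← ENNReal.tsum_mul_left]
  rw [lintegral_tsum fun q => (hm q).aemeasurable]
  have hblue2 : ∀ l, limitMass d p α (0, l + 2) = 0 := by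
    intro l
    rw [limitMass]
    simp only [limitFreq]
    rw [limitMass_blue hd hp h0 h1 0 (l + 1)]
    have (r : Fin 0 → EuclideanSpace ℝ (Fin d)) (b : Fin (l + 1) → EuclideanSpace ℝ (Fin d)) :=
      configDensity_eq_zero_of_red_eq_zero h0 h1 ((0 + (l + 1 + 1) - 1 : ℕ) + p / d) r
        (Fin.cons 0 b)
    simp_rw [this]
    simp
  have hred2 : ∀ k, limitMass d p α (k + 2, 0) = 0 := by
    intro k
    rw [limitMass_red hd hp h0 h1 (k + 1) 0]
    have (r : Fin (k + 1) → EuclideanSpace ℝ (Fin d)) (b : Fin 0 → EuclideanSpace ℝ (Fin d)) :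
        configDensity (k := k + 2) α ((k + 1 + 1 + 0 - 1 : ℕ) + p / d) (Fin.cons 0 r) b = 0 := by
      rw [configDensity_swap h0 h1]
      exact configDensity_eq_zero_of_red_eq_zero h1' (by linarith) _ b (Fin.cons 0 r)
    simp_rw [this]
    simp
  have huniv : volume (Set.univ : Set (Fin 0 → EuclideanSpace ℝ (Fin d))) = 1 := by
    simp [volume_pi]
  have hred1 : limitMass d p α (1, 0) = ENNReal.ofReal (p / d * Real.Gamma (p / d) *
      (α * (1 - α) ^ (-(p / d)))) *
        volume (Metric.closedBall (0 : EuclideanSpace ℝ (Fin d)) 1) ^ (-(p / d)) := by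
    have hcd (r b : Fin 0 → EuclideanSpace ℝ (Fin d)) : configDensity (k := 1) α (p / d)
        (Fin.cons 0 r) b = ENNReal.ofReal ((1 - α) ^ (-(p / d))) *
          volume (Metric.closedBall (0 : EuclideanSpace ℝ (Fin d)) 1) ^ (-(p / d)) := by
      rw [configDensity_swap h0 h1, configDensity_isolated h1' (by linarith)]
    have hK : massCoeff d 1 0 p α = p / d * Real.Gamma (p / d) * α := by
      simp [massCoeff]
      ring
    have hσ : ((0 + 1 + 0 - 1 : ℕ) : ℝ) + p / d = p / d := by simp
    rw [limitMass_red hd hp h0 h1 0 0, hσ, hK]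
    simp_rw [hcd]
    rw [lintegral_const, lintegral_const, huniv, mul_one, mul_one, ← mul_assoc,
      ← ENNReal.ofReal_mul (by positivity), mul_assoc (p / d * _)]
  have hblue1 : limitMass d p α (0, 1) = ENNReal.ofReal (p / d * Real.Gamma (p / d) *
      ((1 - α) * α ^ (-(p / d)))) *
        volume (Metric.closedBall (0 : EuclideanSpace ℝ (Fin d)) 1) ^ (-(p / d)) := by
    have hK : massCoeff d 0 1 p α = p / d * Real.Gamma (p / d) * (1 - α) := by
      simp [massCoeff]
      ring
    have hσ : ((0 + (0 + 1) - 1 : ℕ) : ℝ) + p / d = p / d := by simp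
    rw [limitMass]
    simp only [limitFreq]
    rw [limitMass_blue hd hp h0 h1 0 0, hσ, hK]
    simp_rw [configDensity_isolated h0 h1]
    rw [lintegral_const, lintegral_const, huniv, mul_one, mul_one, ← mul_assoc,
      ← ENNReal.ofReal_mul (by positivity), mul_assoc (p / d * _)]
  have h00 : limitMass d p α (0, 0) = 0 := by simp [limitMass, limitFreq]
  calc _ = ∑' q : ℕ × ℕ, limitMass d p α q := rfl
    _ = ∑' k, ∑' l, limitMass d p α (k, l) :=
        ENNReal.tsum_prod (f := fun k l => limitMass d p α (k, l))
    _ = limitMass d p α (0, 1) + (limitMass d p α (1, 0) +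
          ∑' k, ∑' l, limitMass d p α (k + 1, l + 1)) := by
        rw [tsum_eq_zero_add' ENNReal.summable, tsum_eq_single 1]
        · congr 1
          have : ∀ k, ∑' l, limitMass d p α (k + 1, l) =
              limitMass d p α (k + 1, 0) + ∑' l, limitMass d p α (k + 1, l + 1) := fun k =>
            tsum_eq_zero_add' ENNReal.summable
          simp_rw [this]
          rw [ENNReal.tsum_add, tsum_eq_single 0]
          intro k hk
          obtain ⟨k, rfl⟩ := Nat.exists_eq_succ_of_ne_zero hk
          exact hred2 k
        · intro l hl
          rcases l with _ | _ | l
          · exact h00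
          · exact absurd rfl hl
          · exact hblue2 l
    _ = _ := by
        simp_rw [limitMass_succ_succ hd h hp]
        rw [hblue1, hred1, betaBMST, ← add_assoc, ← add_mul,
          ← ENNReal.ofReal_add (by positivity) (by positivity)]
        congr 3
        ring

end LimitConstant

/-! ### The cost of leaving the torus -/

section BoundaryCost

variable {d : ℕ}

lemma lintegral_rpow_mul_indicator {p T : ℝ} (hp : 0 < p) (hT : 0 ≤ T) (c : ℝ≥0∞) :
    ∫⁻ u in Set.Ioi (0 : ℝ), ENNReal.ofReal (p * u ^ (p - 1)) *
      (Set.Ioc 0 T).indicator (fun _ => c) u = ENNReal.ofReal (T ^ p) * c := by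
  have h1 : ∀ u : ℝ, ENNReal.ofReal (p * u ^ (p - 1)) * (Set.Ioc 0 T).indicator (fun _ => c) u =
      (Set.Ioc 0 T).indicator (fun u => ENNReal.ofReal (p * u ^ (p - 1)) * c) u := by
    intro u
    by_cases hu : u ∈ Set.Ioc 0 T
    · rw [Set.indicator_of_mem hu, Set.indicator_of_mem hu]
    · rw [Set.indicator_of_notMem hu, Set.indicator_of_notMem hu, mul_zero]
  simp_rw [h1]
  rw [setLIntegral_indicator measurableSet_Ioc, Set.inter_eq_left.2 fun u hu => hu.1,
    lintegral_mul_const _ (by fun_prop), setLIntegral_Ioc_rpow hp hT]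

/-- A pointwise bound on `F - G` by multiples of indicators of three intervals, integrated
against `p * u ^ (p - 1)`. -/
lemma lintegral_le_add_of_indicators {p : ℝ} (hp : 0 < p) {F G : ℝ → ℝ≥0∞} {T₁ T₂ T₃ : ℝ}
    (h₁ : 0 ≤ T₁) (h₂ : 0 ≤ T₂) (h₃ : 0 ≤ T₃) (c₁ c₂ c₃ : ℝ≥0∞)
    (h : ∀ u, 0 < u → F u ≤ G u + ((Set.Ioc 0 T₁).indicator (fun _ => c₁) u +
      (Set.Ioc 0 T₂).indicator (fun _ => c₂) u + (Set.Ioc 0 T₃).indicator (fun _ => c₃) u)) :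
    ∫⁻ u in Set.Ioi (0 : ℝ), ENNReal.ofReal (p * u ^ (p - 1)) * F u ≤
      (∫⁻ u in Set.Ioi (0 : ℝ), ENNReal.ofReal (p * u ^ (p - 1)) * G u) +
        (ENNReal.ofReal (T₁ ^ p) * c₁ + ENNReal.ofReal (T₂ ^ p) * c₂ +
          ENNReal.ofReal (T₃ ^ p) * c₃) := by
  have hm : ∀ (T : ℝ) (c : ℝ≥0∞), Measurable fun u : ℝ =>
      ENNReal.ofReal (p * u ^ (p - 1)) * (Set.Ioc 0 T).indicator (fun _ => c) u := fun T c =>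
    Measurable.mul (by fun_prop) (measurable_const.indicator measurableSet_Ioc)
  have hm2 := (hm T₁ c₁).add (hm T₂ c₂)
  have hm3 := hm2.add (hm T₃ c₃)
  simp only [Pi.add_def] at hm2 hm3
  calc _ ≤ ∫⁻ u in Set.Ioi (0 : ℝ), (ENNReal.ofReal (p * u ^ (p - 1)) * G u +
        (ENNReal.ofReal (p * u ^ (p - 1)) * (Set.Ioc 0 T₁).indicator (fun _ => c₁) u +
          ENNReal.ofReal (p * u ^ (p - 1)) * (Set.Ioc 0 T₂).indicator (fun _ => c₂) u +
          ENNReal.ofReal (p * u ^ (p - 1)) * (Set.Ioc 0 T₃).indicator (fun _ => c₃) u)) := by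
        refine setLIntegral_mono' measurableSet_Ioi fun u hu => ?_
        rw [← mul_add, ← mul_add, ← mul_add]
        gcongr
        exact h u hu
    _ = _ := by
        rw [lintegral_add_right _ hm3, lintegral_add_right _ (hm T₃ c₃),
          lintegral_add_right _ (hm T₂ c₂), lintegral_rpow_mul_indicator hp h₁,
          lintegral_rpow_mul_indicator hp h₂, lintegral_rpow_mul_indicator hp h₃]

lemma lintegral_cubeExcess_lt_top {a b : ℕ} (ha : 0 < a) (hb : 0 < b) {p : ℝ} (hp : 0 < p) :
    ∫⁻ u in Set.Ioi (0 : ℝ), ENNReal.ofReal (p * u ^ (p - 1)) * cubeExcess d a b u < ∞ := by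
  have h : ∀ u : ℝ, 0 < u → cubeExcess d a b u ≤
      (Set.Ioc 0 √d).indicator (fun _ => ((a + b : ℕ) : ℝ≥0∞)) u := by
    intro u hu
    by_cases hud : u ≤ √d
    · rw [Set.indicator_of_mem (show u ∈ Set.Ioc 0 √(d : ℝ) from ⟨hu, hud⟩)]
      exact cubeExcess_le_card d a b u
    · rw [cubeExcess_eq_zero ha hb (not_le.1 hud)]
      exact zero_le
  calc _ ≤ ∫⁻ u in Set.Ioi (0 : ℝ), ENNReal.ofReal (p * u ^ (p - 1)) *
        (Set.Ioc 0 √d).indicator (fun _ => ((a + b : ℕ) : ℝ≥0∞)) u := by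
        refine setLIntegral_mono' measurableSet_Ioi fun u hu => ?_
        gcongr
        exact h u hu
    _ < ∞ := by
        rw [lintegral_rpow_mul_indicator hp (Real.sqrt_nonneg _)]
        exact ENNReal.mul_lt_top ENNReal.ofReal_lt_top (ENNReal.natCast_lt_top _)

/-- The connectivity scale `(log n / n) ^ (1 / d)`. -/
noncomputable def logScale (d n : ℕ) : ℝ := (Real.log n / n) ^ (1 / (d : ℝ))

lemma logScale_pow (hd : 1 ≤ d) {n : ℕ} : logScale d n ^ d = Real.log n / n := by
  have hd' : (d : ℝ) ≠ 0 := by exact_mod_cast (by omega : d ≠ 0)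
  have h0 : 0 ≤ Real.log n / n := div_nonneg (Real.log_natCast_nonneg n) (Nat.cast_nonneg n)
  rw [logScale, ← Real.rpow_natCast, ← Real.rpow_mul h0, one_div_mul_cancel hd', Real.rpow_one]

lemma mul_logScale_rpow {n : ℕ} (hn : 0 < n) (q : ℝ) :
    n * logScale d n ^ q = (n : ℝ) ^ (1 - q / d) * Real.log n ^ (q / d) := by
  have hn' : (0 : ℝ) < n := by exact_mod_cast hn
  have h0 := Real.log_natCast_nonneg n
  rw [logScale, ← Real.rpow_mul (by positivity), one_div_mul_eq_div, Real.div_rpow h0 hn'.le,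
    Real.rpow_sub hn', Real.rpow_one]
  ring

lemma tendsto_logScale (hd : 1 ≤ d) : Tendsto (logScale d) atTop (𝓝 0) := by
  have hd' : (0 : ℝ) < 1 / d := by
    have : (0 : ℝ) < d := by exact_mod_cast hd
    positivity
  have h := (Real.isLittleO_log_id_atTop.tendsto_div_nhds_zero).comp
    (tendsto_natCast_atTop_atTop (R := ℝ))
  have h2 := h.rpow_const (p := 1 / (d : ℝ)) (Or.inr hd'.le)
  rw [Real.zero_rpow hd'.ne'] at h2
  exact h2

/-- The expected costs on the cube and on the torus differ by at most `(2 d + 2) n ε ^ (p + 1)` at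
the connectivity scale `ε`. Up to `ε`, the number of points near the boundary of the cube bounds the
difference. Between `ε` and a large multiple of `ε`, the number of boundary cells of side comparable
to the scale does, which is smaller by a factor `log n`; beyond that, the level graph is connected
with high probability. -/
theorem eventually_cube_le_torus_add (hd : 1 ≤ d) {α : ℝ} {a b : ℕ → ℕ} (h : ColourFractions α a b)
    {p : ℝ} (hp : 0 < p) :
    ∀ᶠ n : ℕ in atTop,
      ∫⁻ u in Set.Ioi (0 : ℝ), ENNReal.ofReal (p * u ^ (p - 1)) * cubeExcess d (a n) (b n) u ≤
      (∫⁻ u in Set.Ioi (0 : ℝ), ENNReal.ofReal (p * u ^ (p - 1)) * torusExcess d (a n) (b n) u) +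
        ENNReal.ofReal ((2 * d + 2) * (n : ℝ) ^ (1 - (p + 1) / d) *
          Real.log n ^ ((p + 1) / d)) := by
  obtain ⟨c, hc, hev⟩ := h.exists_ratio
  have hd' : (0 : ℝ) < d := by exact_mod_cast hd
  set A : ℝ := 2 + (p + 1) / d with hA
  have hA0 : 0 < A := by positivity
  set v : ℝ := (4 * √d) ^ d with hv
  have hv0 : 0 < v := by positivity
  -- The multiple `K` of the connectivity scale makes `exp (-c K ^ d log n / v) = n ^ (-A)`.
  set K : ℝ := (A * v / c) ^ (1 / (d : ℝ)) with hK
  have hK0 : 0 < K := by positivity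
  have hKd : K ^ d = A * v / c := by
    rw [hK, ← Real.rpow_natCast, ← Real.rpow_mul (by positivity), one_div_mul_cancel hd'.ne',
      Real.rpow_one]
  set D : ℝ := (2 * √d) ^ d * (4 * d * (1 + 1 / c)) with hD
  have hD0 : 0 < D := by positivity
  have hlog : Tendsto (fun n : ℕ => Real.log n) atTop atTop :=
    Real.tendsto_log_atTop.comp tendsto_natCast_atTop_atTop
  have hKε : ∀ᶠ n in atTop, K * logScale d n < √d := by
    have := (tendsto_logScale hd).const_mul K
    rw [mul_zero] at this
    exact this.eventually (gt_mem_nhds (by positivity))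
  filter_upwards [hev, hKε, hlog.eventually_ge_atTop 1, hlog.eventually_ge_atTop (D * K ^ (p + 1)),
    (tendsto_natCast_atTop_atTop (R := ℝ)).eventually_ge_atTop (√d ^ p * (2 * (v / K ^ d))),
    eventually_gt_atTop 0] with n hn hKn hL1 hLD hnd hn0
  obtain ⟨ha, hb, hca, hcb, hab, hba⟩ := hn
  have hn' : (0 : ℝ) < n := by exact_mod_cast hn0
  set L := Real.log n with hL
  have hL0 : 0 < L := zero_lt_one.trans_le hL1
  set ε := logScale d n with hε
  have hε0 : 0 < ε := by
    rw [hε, logScale]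
    positivity
  have hεd : ε ^ d = L / n := logScale_pow hd
  have habn : (a n : ℝ) + b n = n := by exact_mod_cast h.add_eq n
  have hu0 : 0 < K * ε := by positivity
  set G : ℝ := v * ((K * ε) ^ d)⁻¹ with hG
  have hGval : G = v / K ^ d * (n / L) := by
    rw [hG, mul_pow, hεd]
    field_simp
  have hexp : Real.exp (-(c * n / G)) = (n : ℝ) ^ (-A) := by
    rw [Real.rpow_def_of_pos hn', ← hL, hGval, hKd]
    congr 1
    field_simp
  set c₁ : ℝ := n * (2 * d * ε) with hc₁
  set c₂ : ℝ := D * (n / L) * (K * ε) with hc₂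
  set c₃ : ℝ := 2 * n * G * (n : ℝ) ^ (-A) with hc₃
  have hpt := lintegral_le_add_of_indicators hp (F := cubeExcess d (a n) (b n))
    (G := torusExcess d (a n) (b n)) hε0.le hu0.le (Real.sqrt_nonneg (d : ℝ))
    (ENNReal.ofReal c₁) (ENNReal.ofReal c₂) (ENNReal.ofReal c₃) fun u hu => by
      rcases le_or_gt u ε with h1 | h1
      · rw [Set.indicator_of_mem (show u ∈ Set.Ioc 0 ε from ⟨hu, h1⟩), add_assoc]
        refine (cubeExcess_le_torusExcess_add_points d (a n) (b n) u).trans ?_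
        gcongr
        refine le_trans ?_ le_self_add
        rw [h.add_eq n, hc₁, ENNReal.ofReal_mul hn'.le, ENNReal.ofReal_mul (by positivity),
          ENNReal.ofReal_natCast, ENNReal.ofReal_mul zero_le_two, ENNReal.ofReal_natCast,
          ENNReal.ofReal_ofNat]
        gcongr
      rcases le_or_gt u (K * ε) with h2 | h2
      · rw [Set.indicator_of_mem (show u ∈ Set.Ioc 0 (K * ε) from ⟨hu, h2⟩)]
        refine (cubeExcess_le_torusExcess_add_cells hd hc hab hba hu (h2.trans hKn.le)).trans ?_
        gcongr
        refine le_trans ?_ (le_self_add.trans' le_add_self)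
        refine ENNReal.ofReal_le_ofReal ?_
        have h3 : (u ^ d)⁻¹ ≤ n / L := by
          rw [← inv_div, ← hεd]
          gcongr
        calc _ = D * (u ^ d)⁻¹ * u := by
              rw [hD]
              ring
          _ ≤ c₂ := by
              rw [hc₂]
              gcongr
      rcases le_or_gt u √d with h3 | h3
      · rw [Set.indicator_of_mem (show u ∈ Set.Ioc 0 √(d : ℝ) from ⟨hu, h3⟩)]
        refine le_trans ?_ (le_add_self.trans le_add_self)
        refine (cubeExcess_anti d (a n) (b n) h2.le).trans
          ((cubeExcess_le_exp hd hca hcb (by positivity) hu0 hKn.le).trans (le_of_eq ?_))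
        rw [habn, ← hv, ← hG, hexp]
      · rw [cubeExcess_eq_zero ha hb h3]
        exact zero_le
  refine hpt.trans ?_
  gcongr
  have hT : ∀ q : ℝ, n * ε ^ q = (n : ℝ) ^ (1 - q / d) * L ^ (q / d) := mul_logScale_rpow hn0
  have hεp : ε ^ p * ε = ε ^ (p + 1) := (Real.rpow_add_one hε0.ne' p).symm
  have hKp : K ^ p * K = K ^ (p + 1) := (Real.rpow_add_one hK0.ne' p).symm
  have h1 : ε ^ p * c₁ = 2 * d * (n * ε ^ (p + 1)) := by
    rw [hc₁, ← hεp]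
    ring
  have h2 : (K * ε) ^ p * c₂ ≤ n * ε ^ (p + 1) := by
    rw [Real.mul_rpow hK0.le hε0.le]
    calc K ^ p * ε ^ p * c₂ = D * K ^ (p + 1) / L * (n * ε ^ (p + 1)) := by
          rw [hc₂, ← hεp, ← hKp]
          ring
      _ ≤ 1 * (n * ε ^ (p + 1)) := by
          gcongr
          rwa [div_le_one hL0]
      _ = _ := one_mul _
  have h3 : √d ^ p * c₃ ≤ n * ε ^ (p + 1) := by
    have hGle : G ≤ v / K ^ d * n := by
      rw [hGval]
      gcongr
      exact div_le_self hn'.le hL1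
    have hpow : (n : ℝ) * n * (n : ℝ) ^ (-A) = (n : ℝ) ^ (-((p + 1) / d)) := by
      rw [hA, neg_add, Real.rpow_add hn', Real.rpow_neg hn'.le 2, Real.rpow_two]
      field_simp
    calc √d ^ p * c₃ ≤ √d ^ p * (2 * n * (v / K ^ d * n) * (n : ℝ) ^ (-A)) := by
          rw [hc₃]
          gcongr
      _ = √d ^ p * (2 * (v / K ^ d)) * (n * n * (n : ℝ) ^ (-A)) := by ring
      _ = √d ^ p * (2 * (v / K ^ d)) * (n : ℝ) ^ (-((p + 1) / d)) := by rw [hpow]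
      _ ≤ n * (n : ℝ) ^ (-((p + 1) / d)) := by gcongr
      _ ≤ n * (n : ℝ) ^ (-((p + 1) / d)) * L ^ ((p + 1) / d) :=
          le_mul_of_one_le_right (by positivity) (Real.one_le_rpow hL1 (by positivity))
      _ = _ := by
          rw [hT, sub_eq_add_neg, Real.rpow_add hn', Real.rpow_one]
  have hc₁0 : 0 ≤ c₁ := by positivity
  have hc₂0 : 0 ≤ c₂ := by positivity
  have hG0 : 0 < G := by positivity
  have hc₃0 : 0 ≤ c₃ := by positivity
  rw [← ENNReal.ofReal_mul (by positivity), ← ENNReal.ofReal_mul (by positivity),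
    ← ENNReal.ofReal_mul (by positivity), ← ENNReal.ofReal_add (by positivity) (by positivity),
    ← ENNReal.ofReal_add (by positivity) (by positivity), mul_assoc _ ((n : ℝ) ^ _), ← hT]
  refine ENNReal.ofReal_le_ofReal ?_
  linarith

end BoundaryCost

/-! ### The limit theorem -/

lemma betaBMST_pos {d : ℕ} (hd : 1 ≤ d) {p α : ℝ} (hp : 0 < p) (h0 : 0 < α) (h1 : α < 1) :
    0 < betaBMST d p α := by
  have hd' : (0 : ℝ) < d := by exact_mod_cast hd
  have hΓ : 0 < Real.Gamma (p / d) := Real.Gamma_pos_of_pos (by positivity)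
  have h1' := sub_pos.2 h1
  rw [betaBMST]
  refine lt_of_lt_of_le (ENNReal.mul_pos (ne_of_gt (ENNReal.ofReal_pos.2 (by positivity))) ?_)
    le_self_add
  refine (ENNReal.rpow_pos (Metric.measure_closedBall_pos volume _ one_pos) ?_).ne'
  exact measure_closedBall_lt_top.ne

theorem mainTheorem5 (d : ℕ) (hd : 1 ≤ d) (p : ℝ) (hp : 0 < p) :
    ∃ C : ℝ, 0 < C ∧
      ∀ (α : ℝ) (_ : 0 < α) (_ : α < 1)
        (nR nB : ℕ → ℕ) (_ : ∀ n, nR n + nB n = n)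
        (_ : Tendsto (fun n => (nR n : ℝ) / n) atTop (𝓝 α))
        (_ : Tendsto (fun n => (nB n : ℝ) / n) atTop (𝓝 (1 - α)))
        (Ω : ℕ → Type*) [∀ n, MeasurableSpace (Ω n)]
        (P : ∀ n, Measure (Ω n)) [∀ n, IsProbabilityMeasure (P n)]
        (X : ∀ n, Fin (nR n) → Ω n → EuclideanSpace ℝ (Fin d))
        (Y : ∀ n, Fin (nB n) → Ω n → EuclideanSpace ℝ (Fin d))
        (_ : ∀ n, IsUniformSample (P n) (X n) (Y n)),
        (∀ᶠ n : ℕ in atTop,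
          expectedCubeCost (P n) p (X n) (Y n) < ∞ ∧
          expectedTorusCost (P n) p (X n) (Y n) < ∞ ∧
          (expectedCubeCost (P n) p (X n) (Y n)).toReal
              - (expectedTorusCost (P n) p (X n) (Y n)).toReal
            ≤ C * (n : ℝ) ^ (1 - (p + 1) / d) * Real.log n ^ ((p + 1) / d)) ∧
        (p < d →
          0 < betaBMST d p α ∧ betaBMST d p α < ∞ ∧
          Tendsto (fun n : ℕ =>
              (expectedTorusCost (P n) p (X n) (Y n)).toReal / (n : ℝ) ^ (1 - p / d))
            atTop (𝓝 (betaBMST d p α).toReal) ∧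
          Tendsto (fun n : ℕ =>
              (expectedCubeCost (P n) p (X n) (Y n)).toReal / (n : ℝ) ^ (1 - p / d))
            atTop (𝓝 (betaBMST d p α).toReal)) := by
  have hd' : (0 : ℝ) < d := by exact_mod_cast hd
  refine ⟨2 * d + 2, by positivity, ?_⟩
  intro α h0 h1 nR nB hsum hR hB Ω _ P _ X Y hXY
  have hcf : ColourFractions α nR nB := ⟨h0, h1, hsum, hR, hB⟩
  obtain ⟨c, -, hev⟩ := hcf.exists_ratio
  have hcube : ∀ᶠ n in atTop, expectedCubeCost (P n) p (X n) (Y n) =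
      ∫⁻ u in Set.Ioi (0 : ℝ), ENNReal.ofReal (p * u ^ (p - 1)) *
        cubeExcess d (nR n) (nB n) u := by
    filter_upwards [hev] with n hn
    exact expectedCubeCost_eq_lintegral hn.1 hn.2.1 (hXY n) hp
  have hle : ∀ᶠ n in atTop, expectedTorusCost (P n) p (X n) (Y n) ≤
      expectedCubeCost (P n) p (X n) (Y n) := by
    filter_upwards [hev, hcube] with n hn hc
    rw [hc, expectedTorusCost_eq_lintegral hn.1 hn.2.1 (hXY n) hp]
    gcongr
    exact torusExcess_le_cubeExcess d _ _ _
  have hfin : ∀ᶠ n in atTop, expectedCubeCost (P n) p (X n) (Y n) < ∞ := by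
    filter_upwards [hev, hcube] with n hn hc
    rw [hc]
    exact lintegral_cubeExcess_lt_top hn.1 hn.2.1 hp
  have hdiff : ∀ᶠ n : ℕ in atTop, (expectedCubeCost (P n) p (X n) (Y n)).toReal
      - (expectedTorusCost (P n) p (X n) (Y n)).toReal
        ≤ (2 * d + 2) * (n : ℝ) ^ (1 - (p + 1) / d) * Real.log n ^ ((p + 1) / d) := by
    filter_upwards [hev, hcube, hle, hfin, eventually_cube_le_torus_add hd hcf hp]
      with n hn hc hl hf hbound
    rw [← hc, ← expectedTorusCost_eq_lintegral hn.1 hn.2.1 (hXY n) hp] at hbound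
    have hft := hl.trans_lt hf
    have hnn : 0 ≤ (2 * d + 2) * (n : ℝ) ^ (1 - (p + 1) / d) * Real.log n ^ ((p + 1) / d) := by
      have := Real.log_natCast_nonneg n
      positivity
    have h := ENNReal.toReal_mono (ENNReal.add_ne_top.2 ⟨hft.ne, ENNReal.ofReal_ne_top⟩) hbound
    rw [ENNReal.toReal_add hft.ne ENNReal.ofReal_ne_top, ENNReal.toReal_ofReal hnn] at h
    linarith
  refine ⟨?_, fun hpd => ?_⟩
  · filter_upwards [hle, hfin, hdiff] with n hl hf hb
    exact ⟨hf, hl.trans_lt hf, hb⟩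
  obtain ⟨hlim, hβ⟩ := tendsto_cube_integral hd hcf hp hpd
  rw [lintegral_tsum_limitFreq hd hcf hp] at hlim hβ
  have hcubelim : Tendsto (fun n : ℕ =>
      (expectedCubeCost (P n) p (X n) (Y n)).toReal / (n : ℝ) ^ (1 - p / d))
      atTop (𝓝 (betaBMST d p α).toReal) := by
    refine ((ENNReal.tendsto_toReal hβ.ne).comp hlim).congr' ?_
    filter_upwards [hcube] with n hc
    rw [Function.comp_apply, ← hc, ENNReal.toReal_div, ENNReal.toReal_ofReal (by positivity)]
  have hzero : Tendsto (fun n : ℕ => (2 * d + 2) * (n : ℝ) ^ (1 - (p + 1) / d) *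
      Real.log n ^ ((p + 1) / d) / (n : ℝ) ^ (1 - p / d)) atTop (𝓝 0) := by
    have h := ((isLittleO_log_rpow_rpow_atTop ((p + 1) / d)
      (by positivity : 0 < 1 / (d : ℝ))).tendsto_div_nhds_zero.comp
        (tendsto_natCast_atTop_atTop (R := ℝ))).const_mul (2 * d + 2 : ℝ)
    rw [mul_zero] at h
    refine h.congr' ?_
    filter_upwards [eventually_gt_atTop 0] with n hn
    have hn' : (0 : ℝ) < n := by exact_mod_cast hn
    have hpow : (n : ℝ) ^ (1 - p / d) = (n : ℝ) ^ (1 - (p + 1) / d) * (n : ℝ) ^ (1 / (d : ℝ)) := by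
      rw [← Real.rpow_add hn']
      congr 1
      ring
    rw [Function.comp_apply, hpow]
    field_simp
  refine ⟨betaBMST_pos hd hp h0 h1, hβ, ?_, hcubelim⟩
  have hlow := hcubelim.sub hzero
  rw [sub_zero] at hlow
  refine tendsto_of_tendsto_of_tendsto_of_le_of_le' hlow hcubelim ?_ ?_
  · filter_upwards [hdiff] with n hn
    rw [← sub_div]
    gcongr
    linarith
  · filter_upwards [hle, hfin] with n hl hf
    gcongr
    exact hf.ne
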